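/- **Setting.** Let $V$ be a finite set and $\mu:V\to(0,\infty)$ with $\sum_v\mu(v)=1$. Let $\Gamma$ be a finite undirected multigraph (loops allowed) with vertex set $V$. Its directed edges $\vec E$ are: two, $\epsilon$ and $\epsilon^{op}$, for each edge with distinct endpoints (one for each direction), and one, $\epsilon=\epsilon^{op}$, for each loop. Write $s(\epsilon),t(\epsilon)$ for source and target and $\mu(\epsilon)=\sqrt{\mu(s(\epsilon))\mu(t(\epsilon))}$. Let $\ell(\epsilon)$ be the creation operators on the Fock module $\mathcal F(\Gamma)$ over $\ell^\infty(V)$, whose orthogonal basis is the set of directed paths (paths of length $0$ are the vertices, $\langle\gamma|\gamma\rangle=p_{t(\gamma)}$): $\ell(\epsilon)\gamma=\epsilon\gamma$ if $\gamma$ begins at $t(\epsilon)$, and $0$ otherwise. Put $$x_\epsilon=\Big(\tfrac{\mu(s(\epsilon))}{\mu(t(\epsilon))}\Big)^{1/4}\ell(\epsilon)+\Big(\tfrac{\mu(t(\epsilon))}{\mu(s(\epsilon))}\Big)^{1/4}\ell(\epsilon^{op})^*,$$ let $\mathcal S(\Gamma,\mu)$ be the C*-algebra generated by the projections $p_v$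 and the $x_\epsilon$, and let $\tau(T)=\sum_v\mu(v)\langle p_v|Tp_v\rangle(v)$. Let $B$ be the universal unital $*$-algebra generated by $\ell^\infty(V)$ and $z_\epsilon$ with $z_\epsilon^*=z_{\epsilon^{op}}$ and $p_vz_\epsilon p_w=\delta_{v,s(\epsilon)}\delta_{w,t(\epsilon)}z_\epsilon$; it has the paths as a basis. For $R>0$ let $B_R$ be its completion in $$\Big\|\sum_v b_vp_v+\sum_\gamma a_\gamma z_\gamma\Big\|_R=\sup_v|b_v|+\sum_\gamma|a_\gamma|R^{|\gamma|}$$ (paths $\gamma$ of length $|\gamma|\ge1$), that is, the power series of finite $\|\cdot\|_R$. Let $\partial_\epsilon$ be the derivation with $\partial_\epsilon p_v=0$, $\partial_\epsilon z_{\epsilon'}=\delta_{\epsilon,\epsilon'}\,p_{s(\epsilon)}\otimes p_{t(\epsilon)}$, let $\mathscr D_\epsilon=m\circ\sigma\circ\partial_{\epsilon^{op}}$, where $\sigma(a\otimes b)=b\otimes a$ and $m(a\otimes b)=ab$, and let $\mathscr D=(\mathscr D_\epsilon)_\epsilon$. Put $V_\mu=\frac12\sum_\epsilon\mu(\epsilon)z_\epsilon^*z_\epsilon$.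 For $R>\max_\epsilon\|x_\epsilon\|$ let $A_R=\{g(x):g\in B_R\}$, identified with $B_R$. A tuple $y$ with $y_\epsilon=p_{s(\epsilon)}y_\epsilon p_{t(\epsilon)}\in\mathcal S(\Gamma,\mu)$ and $\|y_\epsilon\|<S$ has the joint law $\varphi_y(q)=\tau(q(y))$. For $U\in B_S$ it *satisfies the Schwinger–Dyson equation with potential $U$* if $$\varphi_y\big([\mathscr D_\epsilon U]^*q\big)=(\varphi_y\otimes\varphi_y)(\partial_\epsilon q)\qquad\text{for all }\epsilon\in\vec E,\ q\in B .$$ Let $B^{\vec E}$ be the set of tuples $f$ in $B$ with $f_\epsilon=p_{s(\epsilon)}f_\epsilon p_{t(\epsilon)}$, let $[\mathscr Jf]_{\epsilon\phi}=\partial_\phi f_\epsilon$, and let $P$ be the diagonal matrix with $P_{\epsilon\epsilon}=p_{s(\epsilon)}\otimes p_{t(\epsilon)}$. If $y_\epsilon^*=y_{\epsilon^{op}}$ for all $\epsilon$, then $\mathscr J_y^*(P)$ is the adjoint of $\mathscr J_y:f(y)\mapsto(\mathscr Jf)(y)$ applied to $P$: the element $\xi$ of the closure of $\{f(y):f\in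 B^{\vec E}\}$ for $\langle f,h\rangle=\sum_\epsilon\tau(f_\epsilon^*h_\epsilon)$ with $\langle\xi,f(y)\rangle=\langle P,(\mathscr Jf)(y)\rangle$ for all $f\in B^{\vec E}$, where $\langle Q_1,Q_2\rangle=(\tau\otimes\tau)\operatorname{Tr}(Q_1^*Q_2)$. **Corollary 2.13 (Exists_SD).** For all $R>0$ and $S>R+\frac1R$ there is a constant $K>0$, depending only on $R$, $S$ and $(V,\mu)$, such that the following holds for every such graph $\Gamma$ with $R\min_\epsilon\mu(\epsilon)>4$ and every $W\in B_S$ with $$\|W\|_S\le\tfrac12\min_\epsilon\mu(\epsilon),\qquad \|W\|_S\le 2e\big(R+\tfrac1R\big)\log\frac{S}{R+\frac1R},\qquad \|W\|_S<K .$$ There is $g\in A_R$ such that $y=x+\mathscr Dg$ is a tuple as above (in particular $\|y_\epsilon\|<S$) whose joint law with respect to $\tau$ satisfies the Schwinger–Dyson equation with potential $V_\mu+W$. If moreover $W=W^*$, then $y_\epsilon^*=y_{\epsilon^{op}}$ for all $\epsilon$, and $$\mathscr J_y^*(P)=\big(\mu(\epsilon)y_\epsilon\big)_\epsilon+(\mathscr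 DW)(y)=\mathscr D(V_\mu+W)(y).$$ -/

import Mathlib

open scoped ENNReal

namespace FreeGraph

noncomputable section

/-! ## The directed graph -/

/-- The directed edges of the undirected multigraph with vertex set `V`, edge set `E` and endpoint
map `ends`. An edge with two distinct endpoints gives two directed edges, a loop gives one. -/
@[ext]
structure DEdge {V E : Type*} (ends : E → Sym2 V) where
  edge : E
  src : V
  tgt : V
  ends_eq : s(src, tgt) = ends edge

variable {V E : Type*} {ends : E → Sym2 V}

instance [Finite V] [Finite E] : Finite (DEdge ends) :=
  Finite.of_injective (fun d : DEdge ends => (d.edge, d.src, d.tgt)) (by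
    intro a b h
    simp only [Prod.mk.injEq] at h
    exact DEdge.ext h.1 h.2.1 h.2.2)

instance [Finite V] [Finite E] : Fintype (DEdge ends) := Fintype.ofFinite _

/-- The opposite edge; a loop is its own opposite. -/
def DEdge.op (e : DEdge ends) : DEdge ends :=
  ⟨e.edge, e.tgt, e.src, by rw [Sym2.eq_swap]; exact e.ends_eq⟩

/-- `μ(ε) = √(μ(s(ε)) μ(t(ε)))`. -/
def edgeWeight (μ : V → ℝ) (e : DEdge ends) : ℝ := Real.sqrt (μ e.src * μ e.tgt)

/-! ## Paths in the directed graph (paths of length zero are the vertices) -/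

/-- The list of edges is a path that begins at `v`. -/
def IsPathFrom : V → List (DEdge ends) → Prop
  | _, [] => True
  | v, e :: l => e.src = v ∧ IsPathFrom e.tgt l

/-- The vertex at which a list of edges ends, when it is followed from `v`. -/
def endpoint : V → List (DEdge ends) → V
  | v, [] => v
  | _, e :: l => endpoint e.tgt l

theorem isPathFrom_append (v : V) (l m : List (DEdge ends)) :
    IsPathFrom v (l ++ m) ↔ IsPathFrom v l ∧ IsPathFrom (endpoint v l) m := by
  induction l generalizing v with
  | nil => simp [IsPathFrom, endpoint]
  | cons e l ih => simp [IsPathFrom, endpoint, ih, and_assoc]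

theorem endpoint_append (v : V) (l m : List (DEdge ends)) :
    endpoint v (l ++ m) = endpoint (endpoint v l) m := by
  induction l generalizing v with
  | nil => simp [endpoint]
  | cons e l ih => simp [endpoint, ih]

theorem isPathFrom_reverse (v : V) (l : List (DEdge ends)) (h : IsPathFrom v l) :
    IsPathFrom (endpoint v l) (l.map DEdge.op).reverse ∧
      endpoint (endpoint v l) (l.map DEdge.op).reverse = v := by
  induction l generalizing v with
  | nil => simp [IsPathFrom, endpoint]
  | cons e l ih =>
    obtain ⟨h1, h2⟩ := h
    obtain ⟨h3, h4⟩ := ih _ h2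
    simp only [List.map_cons, List.reverse_cons, endpoint]
    rw [isPathFrom_append, endpoint_append, h4]
    exact ⟨⟨h3, rfl, trivial⟩, h1⟩

/-- A path in the directed graph: its first vertex and its list of edges. -/
@[ext]
structure GPath {V E : Type*} (ends : E → Sym2 V) where
  src : V
  edges : List (DEdge ends)
  isPath : IsPathFrom src edges

namespace GPath

/-- The last vertex of a path. -/
def tgt (γ : GPath ends) : V := endpoint γ.src γ.edges

/-- The number of edges of a path. -/
def len (γ : GPath ends) : ℕ := γ.edges.length

/-- The path of length zero at `v`. -/
def vertex (v : V) : GPath ends := ⟨v, [], trivial⟩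

/-- The path of length one that consists of `e`. -/
def single (e : DEdge ends) : GPath ends := ⟨e.src, [e], rfl, trivial⟩

/-- The path made of the first `i` edges of `γ`. -/
def take (i : ℕ) (γ : GPath ends) : GPath ends :=
  ⟨γ.src, γ.edges.take i, by
    have h := γ.isPath
    rw [← List.take_append_drop i γ.edges, isPathFrom_append] at h
    exact h.1⟩

/-- The path that remains of `γ` after its first `i` edges. -/
def drop (i : ℕ) (γ : GPath ends) : GPath ends :=
  ⟨endpoint γ.src (γ.edges.take i), γ.edges.drop i, by
    have h := γ.isPath
    rw [← List.take_append_drop i γ.edges, isPathFrom_append] at h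
    exact h.2⟩

/-- The path `a e b`, when `a` ends where `e` begins and `b` begins where `e` ends. -/
def join (a : GPath ends) (e : DEdge ends) (b : GPath ends)
    (h : a.tgt = e.src ∧ e.tgt = b.src) : GPath ends :=
  ⟨a.src, a.edges ++ e :: b.edges, by
    rw [isPathFrom_append]
    refine ⟨a.isPath, h.1.symm, ?_⟩
    rw [h.2]
    exact b.isPath⟩

/-- The path that runs through the opposite edges in the opposite order. -/
def rev (γ : GPath ends) : GPath ends :=
  ⟨γ.tgt, (γ.edges.map DEdge.op).reverse, (isPathFrom_reverse _ _ γ.isPath).1⟩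

end GPath

/-! ## The algebras `B` and `B_R`

An element of `B_R`, and of `B`, is given by its coefficients on the paths: the coefficient of `p_v`
is the one on the path of length zero at `v`, the coefficient of `z_{ε₁} ⋯ z_{εₙ}` the one on the
path `ε₁ ⋯ εₙ`. -/

/-- Formal power series in the `z_ε`, with coefficients on the paths. -/
abbrev Series {V E : Type*} (ends : E → Sym2 V) := GPath ends → ℂ

/-- Formal series in the elementary tensors `a ⊗ b` of two paths. -/
abbrev Tensor {V E : Type*} (ends : E → Sym2 V) := GPath ends → GPath ends → ℂ

/-- `B`: the series with finitely many terms. -/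
def IsPoly (c : Series ends) : Prop := (Function.support c).Finite

/-- `B_R`: the series for which `‖·‖_R` is finite (the completion of `B` in this norm). -/
def MemB (R : ℝ) (c : Series ends) : Prop := Summable fun γ => ‖c γ‖ * R ^ γ.len

/-- The norm `‖·‖_R` on `B_R`. -/
def normB (R : ℝ) (c : Series ends) : ℝ :=
  (⨆ v : V, ‖c (GPath.vertex v)‖) + ∑' γ : {γ : GPath ends // γ.len ≠ 0}, ‖c γ‖ * R ^ γ.1.len

open Classical in
/-- The monomial of a path. -/
def mono (γ : GPath ends) : Series ends := Pi.single γ 1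

/-- The elementary tensor of two series. -/
def tensor (c d : Series ends) : Tensor ends := fun a b => c a * d b

/-- The multiplication map `a ⊗ b ↦ ab`. The product of two paths is their concatenation, or zero
if they cannot be concatenated, so the coefficient on `γ` is a sum over the ways to cut `γ`. -/
def mulMap (T : Tensor ends) : Series ends :=
  fun γ => ∑ i ∈ Finset.range (γ.len + 1), T (γ.take i) (γ.drop i)

/-- The product in `B_R`. -/
def mulB (c d : Series ends) : Series ends := mulMap (tensor c d)

/-- The adjoint in `B_R`: conjugate linear, `p_v^* = p_v`, and `(z_{ε₁} ⋯ z_{εₙ})^*` is the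
monomial of the reversed path. -/
def adjB (c : Series ends) : Series ends := fun γ => star (c γ.rev)

/-- The flip `a ⊗ b ↦ b ⊗ a`. -/
def flip (T : Tensor ends) : Tensor ends := fun a b => T b a

/-- The product `(a₁ ⊗ b₁)(a₂ ⊗ b₂) = a₁a₂ ⊗ b₂b₁`. -/
def tmul (T U : Tensor ends) : Tensor ends := fun a b =>
  ∑ i ∈ Finset.range (a.len + 1), ∑ j ∈ Finset.range (b.len + 1),
    T (a.take i) (b.drop j) * U (a.drop i) (b.take j)

/-- The adjoint `(a ⊗ b)^* = a^* ⊗ b^*`. -/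
def tadj (T : Tensor ends) : Tensor ends := fun a b => star (T a.rev b.rev)

/-! ## Differential operators -/

open Classical in
/-- The free difference quotient `∂_ε`: the derivation with `∂_ε(p_v) = 0` and
`∂_ε(z_{ε'}) = δ_{ε,ε'} p_{s(ε)} ⊗ p_{t(ε)}`. On a path it is the sum of `a ⊗ b` over the
factorizations `a ε b` of the path. -/
def dq (e : DEdge ends) (c : Series ends) : Tensor ends := fun a b =>
  if h : a.tgt = e.src ∧ e.tgt = b.src then c (a.join e b h) else 0

/-- The cyclic derivative `𝒟_ε = m ∘ σ ∘ ∂_{ε^op}`. -/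
def cyc (e : DEdge ends) (c : Series ends) : Series ends := mulMap (flip (dq e.op c))

/-- The vectors in `B^E⃗`: each entry lies in `B` and `f_ε = p_{s(ε)} f_ε p_{t(ε)}`. -/
def IsPolyVec (f : DEdge ends → Series ends) : Prop :=
  ∀ e, IsPoly (f e) ∧ ∀ γ, f e γ ≠ 0 → γ.src = e.src ∧ γ.tgt = e.tgt

/-- Matrices over the tensors, indexed by the directed edges. -/
abbrev Mat {V E : Type*} (ends : E → Sym2 V) := DEdge ends → DEdge ends → Tensor ends

/-- The Jacobian `[𝒥 f]_{εφ} = ∂_φ f_ε`. -/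
def jac (f : DEdge ends → Series ends) : Mat ends := fun e e' => dq e' (f e)

open Classical in
/-- The diagonal matrix `P` with `P_{εε} = p_{s(ε)} ⊗ p_{t(ε)}`. -/
def matP : Mat ends := fun e e' =>
  if e = e' then tensor (mono (GPath.vertex e.src)) (mono (GPath.vertex e.tgt)) else 0

/-- `[Q^*]_{εε'} = [Q]_{ε'ε}^*`. -/
def madj (Q : Mat ends) : Mat ends := fun e e' => tadj (Q e' e)

/-- The potential `V_μ = ½ ∑_ε μ(ε) z_ε^* z_ε`. -/
def potential [Finite V] [Finite E] (ends : E → Sym2 V) (μ : V → ℝ) : Series ends :=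
  ∑ e : DEdge ends, ((1 / 2 * edgeWeight μ e : ℝ) : ℂ) •
    mulB (adjB (mono (GPath.single e))) (mono (GPath.single e))

/-! ## The free graph algebra

The Fock module is a right module over the finite-dimensional commutative algebra `ℓ^∞(V)`, and it
has the paths as orthogonal basis, with `⟨γ|γ⟩ = p_{t(γ)}`. It is the direct sum of the Hilbert
spaces `ℱ(Γ) p_w`, each with the paths that end at `w` as orthonormal basis; right-module operators
preserve every summand, and their norm is the maximum of the norms on the summands. They are thus
represented, isometrically and with the same adjoints, as operators on `ℓ²` of the set of paths. -/

/-- `ℓ²` of the set of paths. -/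
abbrev Fock {V E : Type*} (ends : E → Sym2 V) := lp (fun _ : GPath ends => ℂ) 2

/-- The bounded operators on `ℓ²` of the set of paths. -/
abbrev Op {V E : Type*} (ends : E → Sym2 V) := Fock ends →L[ℂ] Fock ends

theorem sum_elim_le (f : GPath ends → Option (GPath ends))
    (hf : ∀ a b c, f a = some c → f b = some c → a = b) (ξ : Fock ends)
    (s : Finset (GPath ends)) :
    ∑ γ ∈ s, ‖(f γ).elim 0 ξ‖ ^ (2 : ℝ≥0∞).toReal ≤ ‖ξ‖ ^ (2 : ℝ≥0∞).toReal := by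
  classical
  refine le_trans ?_ (lp.sum_rpow_le_norm_rpow (by norm_num) ξ (s.filterMap f hf))
  rw [← Finset.sum_filter_of_ne (p := fun γ => (f γ).isSome)]
  · refine le_of_eq (Finset.sum_bij (fun γ h => (f γ).get (Finset.mem_filter.1 h).2) ?_ ?_ ?_ ?_)
    · intro a ha
      rw [Finset.mem_filterMap]
      exact ⟨a, (Finset.mem_filter.1 ha).1, by simp⟩
    · intro a ha b hb h
      refine hf a b _ (Option.some_get (Finset.mem_filter.1 ha).2).symm ?_
      rw [h]
      exact (Option.some_get (Finset.mem_filter.1 hb).2).symm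
    · intro b hb
      rw [Finset.mem_filterMap] at hb
      obtain ⟨a, ha, hab⟩ := hb
      exact ⟨a, Finset.mem_filter.2 ⟨ha, by simp [hab]⟩, by simp [hab]⟩
    · intro a ha
      obtain ⟨c, hc⟩ := Option.isSome_iff_exists.1 (Finset.mem_filter.1 ha).2
      simp [hc]
  · intro γ _ h
    cases hγ : f γ with
    | none => simp [hγ] at h
    | some c => rfl

/-- The contraction `(T ξ)(γ) = ξ(f(γ))`, with value `0` where `f(γ)` is undefined, for a partially
defined injection `f` of the set of paths. -/
def pullback (f : GPath ends → Option (GPath ends))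
    (hf : ∀ a b c, f a = some c → f b = some c → a = b) : Op ends :=
  LinearMap.mkContinuous
    { toFun := fun ξ => ⟨fun γ => (f γ).elim 0 ξ, memℓp_gen' (sum_elim_le f hf ξ)⟩
      map_add' := by
        intro ξ η
        ext γ
        change (f γ).elim 0 (⇑(ξ + η)) = (f γ).elim 0 ⇑ξ + (f γ).elim 0 ⇑η
        cases f γ with
        | none => exact (add_zero (0 : ℂ)).symm
        | some c => rfl
      map_smul' := by
        intro r ξ
        ext γ
        cases h : f γ <;> simp [h] } 1 (by
      intro ξ
      rw [one_mul]
      exact lp.norm_le_of_forall_sum_le (by norm_num) (norm_nonneg _) (sum_elim_le f hf ξ))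

open Classical in
/-- The path `γ` with its first edge removed, if that edge is `e`. -/
def removeFirst (e : DEdge ends) (γ : GPath ends) : Option (GPath ends) :=
  if γ.edges.head? = some e then some (γ.drop 1) else none

theorem removeFirst_inj (e : DEdge ends) (a b c : GPath ends)
    (ha : removeFirst e a = some c) (hb : removeFirst e b = some c) : a = b := by
  unfold removeFirst at ha hb
  split_ifs at ha hb with h1 h2
  obtain ⟨v, l, hl⟩ := a
  obtain ⟨w, m, hm⟩ := b
  cases l with
  | nil => simp at h1
  | cons x l =>
    cases m with
    | nil => simp at h2
    | cons x' m =>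
      simp only [List.head?_cons, Option.some.injEq] at h1 h2
      subst h1 h2
      simp only [Option.some.injEq] at ha hb
      have h := congrArg GPath.edges (ha.trans hb.symm)
      simp only [GPath.drop, List.drop_succ_cons, List.drop_zero] at h
      have h3 := hl.1
      have h4 := hm.1
      ext1
      · exact h3.symm.trans h4
      · exact congrArg (List.cons _) h

open Classical in
/-- The path `γ`, if it begins at `v`. -/
def beginsAt (v : V) (γ : GPath ends) : Option (GPath ends) :=
  if γ.src = v then some γ else none

theorem beginsAt_inj (v : V) (a b c : GPath ends)
    (ha : beginsAt v a = some c) (hb : beginsAt v b = some c) : a = b := by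
  unfold beginsAt at ha hb
  split_ifs at ha hb with h1 h2
  simp only [Option.some.injEq] at ha hb
  exact ha.trans hb.symm

/-- The creation operator `ℓ(ε)`: it maps a path `γ` to the path `εγ`, or to `0` if `γ` does not
begin at `t(ε)`. -/
def creation (e : DEdge ends) : Op ends := pullback (removeFirst e) (removeFirst_inj e)

/-- The projection `p_v` onto the paths that begin at `v` (the left action of `ℓ^∞(V)`). -/
def proj (v : V) : Op ends := pullback (beginsAt v) (beginsAt_inj v)

/-- `x_ε = (μ(s(ε))/μ(t(ε)))^{1/4} ℓ(ε) + (μ(t(ε))/μ(s(ε)))^{1/4} ℓ(ε^op)^*`. -/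
def gen (μ : V → ℝ) (e : DEdge ends) : Op ends :=
  (((μ e.src / μ e.tgt) ^ (1 / 4 : ℝ) : ℝ) : ℂ) • creation e +
    (((μ e.tgt / μ e.src) ^ (1 / 4 : ℝ) : ℝ) : ℂ) • ContinuousLinearMap.adjoint (creation e.op)

/-- `𝒮(Γ, μ)`: the C*-algebra generated by `ℓ^∞(V)` and the `x_ε`. -/
def graphAlgebra (ends : E → Sym2 V) (μ : V → ℝ) : StarSubalgebra ℂ (Op ends) :=
  (StarAlgebra.adjoin ℂ
    (Set.range (proj : V → Op ends) ∪ Set.range (gen μ : DEdge ends → Op ends))).topologicalClosure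

open Classical in
/-- The vacuum vector `p_v` of the Fock module. -/
def vac (v : V) : Fock ends := lp.single 2 (GPath.vertex v) (1 : ℂ)

/-- The conditional expectation onto `ℓ^∞(V)`: its value at `v` is the coefficient of `p_v` in
`⟨p_v | T p_v⟩`. -/
def condExp (T : Op ends) : V → ℂ := fun v => inner ℂ (vac v) (T (vac v))

/-- The free graph law `τ = μ ∘ E`. -/
def trace [Fintype V] (μ : V → ℝ) (T : Op ends) : ℂ := ∑ v, (μ v : ℂ) * condExp T v

/-! ## Evaluation and the Schwinger–Dyson equation -/

/-- The value of a path at a tuple of operators: `p_v` for the path of length zero at `v`, and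
`y_{ε₁} ⋯ y_{εₙ}` for `ε₁ ⋯ εₙ`. -/
def word (y : DEdge ends → Op ends) (γ : GPath ends) : Op ends :=
  proj γ.src * (γ.edges.map y).prod

/-- The value `c(y)` of a series. The sum converges absolutely in norm when `c ∈ B_S` and
`‖y_ε‖ ≤ S` for all `ε`. -/
def ev (y : DEdge ends → Op ends) (c : Series ends) : Op ends := ∑' γ, c γ • word y γ

section Law

variable [Fintype V] [Finite E]

/-- The joint law of `y` with respect to `τ`. -/
def law (μ : V → ℝ) (y : DEdge ends → Op ends) (c : Series ends) : ℂ := trace μ (ev y c)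

/-- The value of `φ ⊗ φ` on a tensor, where `φ` is the joint law of `y`. -/
def lawTensor (μ : V → ℝ) (y : DEdge ends → Op ends) (T : Tensor ends) : ℂ :=
  ∑' q : GPath ends × GPath ends, T q.1 q.2 * (law μ y (mono q.1) * law μ y (mono q.2))

/-- The joint law `φ` of the tuple `y` is defined on some `B_r` with `r < S` and satisfies the
Schwinger–Dyson equation with potential `U ∈ B_S`: `φ([𝒟_ε U]^* q) = (φ ⊗ φ)(∂_ε q)` for all `ε`
and all `q ∈ B`. As `𝒟_ε U ∈ B_r` for every `r < S`, the first norm condition makes all series that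
occur absolutely convergent at `y`. -/
structure LawSatisfiesSD (μ : V → ℝ) (S : ℝ) (U : Series ends)
    (y : DEdge ends → Op ends) : Prop where
  mem : ∀ e, y e ∈ graphAlgebra ends μ
  corner : ∀ e, proj e.src * y e * proj e.tgt = y e
  norm_lt : ∀ e, ‖y e‖ < S
  eqn : ∀ (e : DEdge ends) (q : Series ends), IsPoly q →
    law μ y (mulB (adjB (cyc e U)) q) = lawTensor μ y (dq e q)

/-- `⟨f, g⟩ = τ(f^* # g)`, where `(f^*)_ε = (f_{ε^op})^*` and `f # g = ∑_ε f_ε g_{ε^op}`. -/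
def vecInner (μ : V → ℝ) (f g : DEdge ends → Op ends) : ℂ :=
  trace μ (∑ e : DEdge ends, star (f e.op) * g e.op)

/-- `⟨Q₁, Q₂⟩ = (τ ⊗ τ)(Tr(Q₁^* Q₂))`, evaluated at `y`. -/
def matInner (μ : V → ℝ) (y : DEdge ends → Op ends) (Q₁ Q₂ : Mat ends) : ℂ :=
  lawTensor μ y (∑ e : DEdge ends, ∑ e' : DEdge ends, tmul (madj Q₁ e e') (Q₂ e' e))

/-- `ξ = 𝒥_y^*(Q)`, for a tuple `y` with `y_ε^* = y_{ε^op}`. The Jacobian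
`𝒥_y : f(y) ↦ (𝒥 f)(y)`, `f ∈ B^E⃗`, is densely defined on the closure of `{f(y) : f ∈ B^E⃗}` for
`⟨·,·⟩`; the adjoint is the element `ξ` of this closure with
`⟨ξ, f(y)⟩ = ⟨Q, 𝒥_y f(y)⟩` for all `f`. -/
structure IsJacobianAdjoint (μ : V → ℝ) (y : DEdge ends → Op ends) (Q : Mat ends)
    (ξ : DEdge ends → Op ends) : Prop where
  mem_closure : ∀ δ : ℝ, 0 < δ → ∃ f : DEdge ends → Series ends, IsPolyVec f ∧
    (vecInner μ (fun e => ξ e - ev y (f e)) (fun e => ξ e - ev y (f e))).re < δ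
  pairing : ∀ f : DEdge ends → Series ends, IsPolyVec f →
    vecInner μ ξ (fun e => ev y (f e)) = matInner μ y Q (jac f)

end Law

/-- The tuple `y = x + 𝒟g`, where `g` stands for the element `g(x)` of `A_R`. -/
def perturbed (μ : V → ℝ) (g : Series ends) : DEdge ends → Op ends :=
  fun e => gen μ e + ev (gen μ) (cyc e g)

end

end FreeGraph

/-! The tuple is found as a transport `y = (z + f)(x)` with a gradient `f = 𝒟g`. Let `φ` be the law
of `x`, let `d_h` be the derivation with `d_h z = h`, and put `M = 𝒥f`. The Schwinger–Dyson equation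
of `x` for `V_μ` says `φ(d_h V_μ) = (φ ⊗ φ) Tr 𝒥h` (`PathLaw.trM_jacT`). Suppose that for all `h`
the functional `φ ∘ d_h` takes the same value on `U(y)` and on `V_μ + (id ⊗ φ + φ ⊗ id) Tr log(1 +
M)`, a free Monge–Ampère equation. Choose `h` such that `d_h y` is a given word in one entry and `0`
in the others. The chain rule `𝒥(q(y)) = (𝒥q)(y)(1 + M)` and the formula `d Tr log(1 + M) = Tr(dM (1
+ M)⁻¹)` then turn this identity into the Schwinger–Dyson equation of `y` for that word
(`PathLaw.schwingerDyson_of_potential`).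

To solve the equation, write `f = 𝒟 N⁻¹ G`, with `N` the number operator. The functionals `φ ∘ d_h`
are tracial and vanish at the vertices. Under such functionals `V_μ(z + f) - V_μ` becomes a term
linear in `G` plus a quadratic one, and the linear term is inverted by `Lam`, the quotient of `N` by
the weighted number operator (`sum_cyclic_dcyc_Lam`). What remains is `G = -Lam (remainder G)`, a
contraction of the unit ball of `B_R` with constant `3/4` (`exists_potential`). Two points make this
work. First, `∑_e ‖𝒟_e N⁻¹ G‖ ≤ ‖G‖ / R`, so no estimate sees the number of edges and the constant
is uniform in the graph. Second, `φ` is bounded by powers of `c = R/2`, so the tensor square can be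
weighted such that Jacobian and partial trace lose no radius (`jac'_bound_half`,
`PathLaw.ptr_bound`).

The law of `x` is tracial and satisfies its own Schwinger–Dyson equation because the right
annihilation operators commute with all left operators up to a rank one term at the vacuum
(`rightAnn_word`, `genLaw_sd`, `genLaw_mul_comm`). If `W = W^*`, then `G^*` solves the same fixed
point equation, so `G = G^*` by uniqueness and `y_ε^* = y_{ε^op}`. The Schwinger–Dyson equation,
summed over the entries of a vector, is then the defining property of `𝒥_y^*(P)`
(`isJacobianAdjoint_of_eqn`). -/

namespace FreeGraph
noncomputable section

/-! ## Weighted `ℓ¹` spaces -/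

/-- A positive weight function on an index set. -/
structure Weight (P : Type*) where
  toFun : P → ℝ
  pos' : ∀ p, 0 < toFun p

namespace Weight

instance {P : Type*} : CoeFun (Weight P) fun _ => P → ℝ := ⟨Weight.toFun⟩

theorem pos {P : Type*} (w : Weight P) (p : P) : 0 < w p := w.pos' p

end Weight

/-- The weighted `ℓ¹` space of families `c` with norm `∑ ‖c p‖ w p`; internally the rescaled
family `c p * w p` is stored. -/
def WL1 {P : Type*} (_w : Weight P) : Type _ := lp (fun _ : P => ℂ) 1

namespace WL1

variable {P Q : Type*} {w : Weight P} {w' : Weight Q}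
variable {X : Type*} [NormedAddCommGroup X] [NormedSpace ℂ X]

instance : NormedAddCommGroup (WL1 w) := inferInstanceAs (NormedAddCommGroup (lp (fun _ : P => ℂ) 1))
instance : NormedSpace ℂ (WL1 w) := inferInstanceAs (NormedSpace ℂ (lp (fun _ : P => ℂ) 1))
instance : CompleteSpace (WL1 w) := inferInstanceAs (CompleteSpace (lp (fun _ : P => ℂ) 1))

/-- The coefficient at `p`. -/
def coef (p : P) : WL1 w →L[ℂ] ℂ :=
  ((w p : ℂ)⁻¹) • (lp.evalCLM ℂ (fun _ : P => ℂ) 1 p : lp (fun _ : P => ℂ) 1 →L[ℂ] ℂ)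

theorem coef_eq (u : WL1 w) (p : P) :
    coef p u = (w p : ℂ)⁻¹ * (show lp (fun _ : P => ℂ) 1 from u) p := rfl

open Classical in
/-- The basis element at `p`. -/
def mon (p : P) : WL1 w := lp.single 1 p (w p : ℂ)

theorem weight_ne (w : Weight P) (p : P) : (w p : ℂ) ≠ 0 := by
  exact_mod_cast (w.pos p).ne'

theorem norm_coef_mul (u : WL1 w) (p : P) :
    ‖coef p u‖ * w p = ‖(show lp (fun _ : P => ℂ) 1 from u) p‖ := by
  rw [coef_eq, norm_mul, norm_inv, Complex.norm_real, Real.norm_of_nonneg (w.pos p).le]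
  field_simp [(w.pos p).ne']

theorem hasSum_norm (u : WL1 w) : HasSum (fun p => ‖coef p u‖ * w p) ‖u‖ := by
  have h := lp.hasSum_norm (p := 1) (by norm_num) (show lp (fun _ : P => ℂ) 1 from u)
  simp only [ENNReal.toReal_one, Real.rpow_one] at h
  simp only [norm_coef_mul]
  exact h

open Classical in
theorem coef_mon (p q : P) : coef p (mon q : WL1 w) = if p = q then 1 else 0 := by
  rw [coef_eq]
  change (w p : ℂ)⁻¹ * (lp.single 1 q (w q : ℂ) : lp (fun _ : P => ℂ) 1) p = _
  rw [lp.single_apply]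
  split_ifs with h
  · subst h; simpa using inv_mul_cancel₀ (weight_ne w p)
  · rw [Pi.single_eq_of_ne h, mul_zero]

theorem norm_mon (p : P) : ‖(mon p : WL1 w)‖ = w p := by
  classical
  have h : ‖(lp.single 1 p (w p : ℂ) : lp (fun _ : P => ℂ) 1)‖ = ‖(w p : ℂ)‖ :=
    lp.norm_single one_pos p _
  rw [Complex.norm_real, Real.norm_of_nonneg (w.pos p).le] at h
  rw [← h]
  unfold mon
  congr!

theorem hasSum_mon (u : WL1 w) : HasSum (fun p => coef p u • (mon p : WL1 w)) u := by
  classical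
  have h := lp.hasSum_single (p := 1) (by norm_num) (show lp (fun _ : P => ℂ) 1 from u)
  have h' : (fun p => coef p u • (mon p : WL1 w)) =
      fun p => lp.single 1 p ((show lp (fun _ : P => ℂ) 1 from u) p) := by
    funext p
    have h1 : (mon p : WL1 w) = (lp.single 1 p (w p : ℂ) : lp (fun _ : P => ℂ) 1) := by
      unfold mon
      congr!
    have h2 : coef p u • (lp.single 1 p (w p : ℂ) : lp (fun _ : P => ℂ) 1) =
        lp.single 1 p (coef p u • (w p : ℂ)) := 
      (lp.single_smul (E := fun _ : P => ℂ) 1 p (coef p u) (w p : ℂ)).symm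
    rw [h1]
    refine h2.trans (congrArg _ ?_)
    rw [coef_eq, smul_eq_mul, mul_right_comm, inv_mul_cancel₀ (weight_ne w p), one_mul]
  rw [h']
  exact h

theorem ext_coef {u v : WL1 w} (h : ∀ p, coef p u = coef p v) : u = v :=
  (hasSum_mon u).unique (by simpa only [h] using hasSum_mon v)

theorem clm_ext {Y : Type*} [AddCommMonoid Y] [TopologicalSpace Y] [T2Space Y] [Module ℂ Y]
    {S T : WL1 w →L[ℂ] Y} (h : ∀ p, S (mon p) = T (mon p)) : S = T := by
  ext u
  refine ((hasSum_mon u).mapL S).unique ?_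
  convert (hasSum_mon u).mapL T using 2 with p
  simp [h]

/-- The family `f` grows at most like the weight. -/
def Bdd (w : Weight P) (f : P → X) : Prop := ∃ C, ∀ p, ‖f p‖ ≤ C * w p

theorem summable_lift {f : P → X} {C : ℝ} (hf : ∀ p, ‖f p‖ ≤ C * w p) (u : WL1 w) :
    Summable fun p => ‖coef p u • f p‖ := by
  refine Summable.of_nonneg_of_le (fun _ => norm_nonneg _) (fun p => ?_)
    ((hasSum_norm u).summable.mul_left C)
  rw [norm_smul]
  calc _ ≤ ‖coef p u‖ * (C * w p) := by gcongr; exact hf p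
    _ = _ := by ring

variable [CompleteSpace X]

open Classical in
/-- The bounded linear map with given values on the basis. -/
def lift (f : P → X) : WL1 w →L[ℂ] X :=
  -- Families that outgrow the weight get the zero map as a default; statements about `lift`
  -- therefore always carry a bound on the basis.
  if h : Bdd w f then
    LinearMap.mkContinuous
      { toFun := fun u => ∑' p, coef p u • f p
        map_add' := by
          obtain ⟨C, hC⟩ := h
          intro u v
          simp only [map_add, add_smul]
          exact (summable_lift hC u).of_norm.tsum_add (summable_lift hC v).of_norm
        map_smul' := by
          intro a u
          simp only [map_smul, smul_eq_mul, mul_smul, RingHom.id_apply]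
          exact tsum_const_smul'' _ } h.choose (by
      intro u
      refine tsum_of_norm_bounded ((hasSum_norm u).mul_left _) (fun p => ?_)
      rw [norm_smul]
      calc _ ≤ ‖coef p u‖ * (h.choose * w p) := by gcongr; exact h.choose_spec p
        _ = _ := by ring)
  else 0

theorem lift_apply {f : P → X} (h : Bdd w f) (u : WL1 w) : lift f u = ∑' p, coef p u • f p := by
  rw [lift, dif_pos h]; rfl

theorem hasSum_lift {f : P → X} (h : Bdd w f) (u : WL1 w) :
    HasSum (fun p => coef p u • f p) (lift f u) := by
  rw [lift_apply h]
  obtain ⟨C, hC⟩ := h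
  exact (summable_lift hC u).of_norm.hasSum

theorem lift_mon {f : P → X} (h : Bdd w f) (p : P) : lift f (mon p : WL1 w) = f p := by
  classical
  rw [lift_apply h, tsum_eq_single p]
  · simp [coef_mon]
  · intro q hq; simp [coef_mon, hq]

theorem norm_lift_le {f : P → X} {C : ℝ} (hf : ∀ p, ‖f p‖ ≤ C * w p) (u : WL1 w) :
    ‖lift f u‖ ≤ C * ‖u‖ := by
  rw [lift_apply ⟨C, hf⟩]
  refine tsum_of_norm_bounded ((hasSum_norm u).mul_left _) (fun p => ?_)
  rw [norm_smul]
  calc _ ≤ ‖coef p u‖ * (C * w p) := by gcongr; exact hf p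
    _ = _ := by ring

/-- The finite sum is moved inside the `ℓ¹` sum, so the family costs only one constant. This keeps
gradient estimates independent of the number of edges. -/
theorem sum_norm_lift_le {ι : Type*} (s : Finset ι) {f : ι → P → X} {C : ℝ}
    (hf : ∀ p, ∑ i ∈ s, ‖f i p‖ ≤ C * w p) (u : WL1 w) :
    ∑ i ∈ s, ‖lift (f i) u‖ ≤ C * ‖u‖ := by
  have hi : ∀ i ∈ s, ∀ p, ‖f i p‖ ≤ C * w p := fun i hi p =>
    (Finset.single_le_sum (f := fun i => ‖f i p‖) (fun _ _ => norm_nonneg _) hi).trans (hf p)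
  have h1 : ∀ i ∈ s, ‖lift (f i) u‖ ≤ ∑' p, ‖coef p u • f i p‖ := fun i h => by
    rw [lift_apply ⟨C, hi i h⟩]
    exact norm_tsum_le_tsum_norm (summable_lift (hi i h) u)
  refine (Finset.sum_le_sum h1).trans ?_
  rw [← Summable.tsum_finsetSum fun i h => summable_lift (hi i h) u]
  rw [← ((hasSum_norm u).mul_left C).tsum_eq]
  refine Summable.tsum_le_tsum (fun p => ?_) (summable_sum fun i h => summable_lift (hi i h) u)
    ((hasSum_norm u).mul_left C).summable
  simp only [norm_smul, ← Finset.mul_sum]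
  calc _ ≤ ‖coef p u‖ * (C * w p) := by gcongr; exact hf p
    _ = _ := by ring

/-- The element with given coefficients. -/
def ofCoef (w : Weight P) (c : P → ℂ) (h : Summable fun p => ‖c p‖ * w p) : WL1 w :=
  (⟨fun p => c p * w p, by
    refine memℓp_gen ?_
    simpa [norm_mul, Complex.norm_real, abs_of_pos (w.pos _)] using h⟩ : lp (fun _ : P => ℂ) 1)

theorem coef_ofCoef (c : P → ℂ) (h : Summable fun p => ‖c p‖ * w p) (p : P) :
    coef p (ofCoef w c h) = c p := by
  rw [coef_eq]
  change (w p : ℂ)⁻¹ * (c p * w p) = c p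
  rw [mul_comm, mul_assoc, mul_inv_cancel₀ (weight_ne w p), mul_one]

/-- A weight preserving involution. -/
structure WInv (w : Weight P) where
  map : P → P
  invol : ∀ p, map (map p) = p
  weight_eq : ∀ p, w (map p) = w p

/-- The conjugate linear map that sends the basis element at `p` to the one at `ι p`. -/
def starMap (ι : WInv w) (u : WL1 w) : WL1 w :=
  ofCoef w (fun p => star (coef (ι.map p) u)) (by
    have h := ((Function.Involutive.toPerm ι.map ι.invol).summable_iff
      (f := fun p => ‖coef p u‖ * w p)).2 (hasSum_norm u).summable
    refine h.congr fun p => ?_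
    change ‖coef (ι.map p) u‖ * w (ι.map p) = _
    rw [norm_star, ι.weight_eq])

section Star

variable {ι : WInv w}

theorem coef_starMap (u : WL1 w) (p : P) : coef p (starMap ι u) = star (coef (ι.map p) u) :=
  coef_ofCoef _ _ _

theorem starMap_add (u v : WL1 w) : starMap ι (u + v) = starMap ι u + starMap ι v :=
  ext_coef fun p => by simp [coef_starMap]

theorem starMap_smul (a : ℂ) (u : WL1 w) : starMap ι (a • u) = star a • starMap ι u :=
  ext_coef fun p => by simp [coef_starMap]

theorem starMap_mon (p : P) : starMap ι (mon p) = mon (ι.map p) :=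
  ext_coef fun q => by
    classical
    have : ι.map q = p ↔ q = ι.map p :=
      ⟨fun h => by rw [← h, ι.invol], fun h => by rw [h, ι.invol]⟩
    simp only [coef_starMap, coef_mon, this]
    split_ifs <;> simp

theorem norm_starMap (u : WL1 w) : ‖starMap ι u‖ = ‖u‖ := by
  refine (hasSum_norm _).unique ?_
  have h := ((Function.Involutive.toPerm ι.map ι.invol).hasSum_iff
    (f := fun p => ‖coef p u‖ * w p)).2 (hasSum_norm u)
  convert h using 2 with p
  change _ = ‖coef (ι.map p) u‖ * w (ι.map p)
  rw [coef_starMap, norm_star, ι.weight_eq]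

variable (ι) in
/-- `starMap` as an additive map. -/
def starHom : WL1 w →+ WL1 w :=
  { toFun := starMap ι
    map_zero' := ext_coef fun p => by simp [coef_starMap]
    map_add' := starMap_add }

theorem continuous_starMap : Continuous (starMap ι) :=
  AddMonoidHomClass.continuous_of_bound (starHom ι) 1 fun u => by
    rw [one_mul]; exact (norm_starMap (ι := ι) u).le

/-- `starMap` is only conjugate linear, so `clm_ext` does not apply; the comparison on the basis is
passed through the convergent expansion instead. -/
theorem starMap_comp {ι' : WInv w'} {S T : WL1 w →L[ℂ] WL1 w'}
    (h : ∀ p, starMap ι' (S (mon p)) = T (mon (ι.map p)))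
    (u : WL1 w) : starMap ι' (S u) = T (starMap ι u) := by
  have h1 : HasSum (fun p => starMap ι' (S (coef p u • mon p))) (starMap ι' (S u)) :=
    ((hasSum_mon u).mapL S).map (starHom ι') continuous_starMap
  have h2 : HasSum (fun p => T (starMap ι (coef p u • mon p))) (T (starMap ι u)) :=
    ((hasSum_mon u).map (starHom ι) continuous_starMap).mapL T
  refine h1.unique ?_
  convert h2 using 2 with p
  simp only [map_smul, starMap_smul, starMap_mon, h]

end Star

-- This hides the encoding by rescaled families; later arguments use only coefficients, basis
-- elements and the lemmas above.
attribute [irreducible] coef mon lift starMap ofCoef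

end WL1
end
end FreeGraph

namespace FreeGraph
noncomputable section

/-! ## Weighted `ℓ¹` algebras of small categories -/

/-- A set with a partially defined associative multiplication and finitely many local units. -/
class PMon (P : Type*) where
  pmul : P → P → Option P
  pmul_assoc : ∀ a b c, (pmul a b).bind (fun x => pmul x c) = (pmul b c).bind (fun y => pmul a y)
  units : Finset P
  lu : P → P
  ru : P → P
  lu_mem : ∀ a, lu a ∈ units
  ru_mem : ∀ a, ru a ∈ units
  lu_mul : ∀ a, pmul (lu a) a = some a
  mul_ru : ∀ a, pmul a (ru a) = some a
  lu_ne : ∀ a, ∀ u ∈ units, u ≠ lu a → pmul u a = none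
  ru_ne : ∀ a, ∀ u ∈ units, u ≠ ru a → pmul a u = none

open PMon (pmul)

/-- Submultiplicative weights. -/
class SubMul {P : Type*} [PMon P] (w : Weight P) : Prop where
  le : ∀ a b c, pmul a b = some c → w c ≤ w a * w b

namespace WL1

variable {P Q : Type*} {w : Weight P} {w' : Weight Q}
variable {X : Type*} [NormedAddCommGroup X] [NormedSpace ℂ X]

theorem ext_apply {Y : Type*} [AddCommMonoid Y] [TopologicalSpace Y] [T2Space Y] [Module ℂ Y]
    {S T : WL1 w →L[ℂ] Y} (h : ∀ p, S (mon p) = T (mon p)) (u : WL1 w) : S u = T u :=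
  congrArg (fun L => L u) (clm_ext h)

/-- The device behind almost every bilinear identity below: both sides are written as continuous
bilinear maps and compared on pairs of basis elements. -/
theorem ext_apply₂ {S T : WL1 w →L[ℂ] WL1 w' →L[ℂ] X}
    (h : ∀ p q, S (mon p) (mon q) = T (mon p) (mon q)) (u : WL1 w) (v : WL1 w') :
    S u v = T u v :=
  congrArg (fun L => L v) (ext_apply (fun p => clm_ext fun q => h p q) u)

/-- The basis element of a partially defined index. -/
def omon (o : Option P) : WL1 w := o.elim 0 mon

@[simp] theorem omon_some (p : P) : (omon (some p) : WL1 w) = mon p := rfl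
@[simp] theorem omon_none : (omon none : WL1 w) = 0 := rfl

section Alg

variable [PMon P] [SubMul w]

theorem norm_omon_pmul (a b : P) : ‖(omon (pmul a b) : WL1 w)‖ ≤ w a * w b := by
  cases h : pmul a b with
  | none => simpa using mul_nonneg (w.pos a).le (w.pos b).le
  | some c => rw [omon_some, norm_mon]; exact SubMul.le a b c h

variable (w) in
/-- The multiplication as a bilinear map. -/
def mulL : WL1 w →L[ℂ] WL1 w →L[ℂ] WL1 w :=
  lift fun a => lift fun b => omon (pmul a b)

theorem norm_mulL_mon (a : P) :
    ‖(lift fun b => omon (pmul a b) : WL1 w →L[ℂ] WL1 w)‖ ≤ 1 * w a := by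
  refine ContinuousLinearMap.opNorm_le_bound _ (by simpa using (w.pos a).le) fun u => ?_
  rw [one_mul]
  exact norm_lift_le (norm_omon_pmul a) u

theorem mulL_mon (a b : P) : mulL w (mon a) (mon b) = omon (pmul a b) := by
  rw [mulL, lift_mon ⟨1, norm_mulL_mon⟩, lift_mon ⟨w a, norm_omon_pmul a⟩]

instance : Mul (WL1 w) := ⟨fun u v => mulL w u v⟩

omit [SubMul w] in
theorem mul_def (u v : WL1 w) : u * v = mulL w u v := rfl

theorem mon_mul_mon (a b : P) : (mon a * mon b : WL1 w) = omon (pmul a b) := mulL_mon a b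

theorem norm_mul_le' (u v : WL1 w) : ‖u * v‖ ≤ ‖u‖ * ‖v‖ := by
  rw [mul_def]
  have h : ‖mulL w u‖ ≤ 1 * ‖u‖ := norm_lift_le norm_mulL_mon u
  rw [one_mul] at h
  exact (ContinuousLinearMap.le_opNorm _ _).trans (by gcongr)

theorem omon_mul_mon (o : Option P) (c : P) :
    (omon o * mon c : WL1 w) = omon (o.bind fun x => pmul x c) := by
  cases o with
  | none => simp [mul_def]
  | some a => exact mon_mul_mon a c

theorem mon_mul_omon (o : Option P) (a : P) :
    (mon a * omon o : WL1 w) = omon (o.bind fun x => pmul a x) := by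
  cases o with
  | none => simp [mul_def]
  | some c => exact mon_mul_mon a c

theorem mul_assoc' (u v x : WL1 w) : u * v * x = u * (v * x) := by
  have h : ∀ (a b : P) (x : WL1 w), mon a * mon b * x = mon a * (mon b * x) := fun a b x =>
    ext_apply (S := mulL w (mulL w (mon a) (mon b)))
      (T := (mulL w (mon a)).comp (mulL w (mon b))) (fun c => by
        change mon a * mon b * mon c = mon a * (mon b * mon c)
        rw [mon_mul_mon, mon_mul_mon, omon_mul_mon, mon_mul_omon, PMon.pmul_assoc]) x
  exact ext_apply₂
    (S := (ContinuousLinearMap.compL ℂ (WL1 w) (WL1 w) (WL1 w) ((mulL w).flip x)).comp (mulL w))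
    (T := ((ContinuousLinearMap.compL ℂ (WL1 w) (WL1 w) (WL1 w)).flip
      ((mulL w).flip x)).comp (mulL w)) (fun a b => h a b x) u v

theorem starMap_mul {ι : WInv w}
    (h : ∀ a b, pmul (ι.map b) (ι.map a) = (pmul a b).map ι.map) (u v : WL1 w) :
    starMap ι (u * v) = starMap ι v * starMap ι u := by
  have h1 : ∀ (a : P) (v : WL1 w), starMap ι (mon a * v) = starMap ι v * mon (ι.map a) :=
    fun a v => starMap_comp (S := mulL w (mon a)) (T := (mulL w).flip (mon (ι.map a))) (fun b => by
      change starMap ι (mon a * mon b) = mon (ι.map b) * mon (ι.map a)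
      rw [mon_mul_mon, mon_mul_mon, h]
      cases pmul a b with
      | none => exact map_zero (starHom ι)
      | some c => exact starMap_mon c) v
  exact starMap_comp (S := (mulL w).flip v) (T := mulL w (starMap ι v)) (fun a => h1 a v) u

/-- A unit exists because there are finitely many local units, and each basis element is fixed by
exactly one of them on each side and killed by the others. -/
instance : One (WL1 w) := ⟨∑ u ∈ PMon.units, mon u⟩

omit [SubMul w] in
theorem one_def : (1 : WL1 w) = ∑ u ∈ PMon.units, mon u := rfl

theorem one_mul' (u : WL1 w) : 1 * u = u :=
  ext_apply (S := mulL w 1) (T := ContinuousLinearMap.id ℂ _) (fun a => by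
    change 1 * mon a = mon a
    rw [mul_def, one_def, map_sum, sum_apply,
      Finset.sum_eq_single_of_mem (PMon.lu a) (PMon.lu_mem a)]
    · rw [mulL_mon, PMon.lu_mul, omon_some]
    · intro b hb hne
      rw [mulL_mon, PMon.lu_ne a b hb hne, omon_none]) u

theorem mul_one' (u : WL1 w) : u * 1 = u :=
  ext_apply (S := (mulL w).flip 1) (T := ContinuousLinearMap.id ℂ _) (fun a => by
    change mon a * 1 = mon a
    rw [mul_def, one_def, map_sum, Finset.sum_eq_single_of_mem (PMon.ru a) (PMon.ru_mem a)]
    · rw [mulL_mon, PMon.mul_ru, omon_some]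
    · intro b hb hne
      rw [mulL_mon, PMon.ru_ne a b hb hne, omon_none]) u

instance : Ring (WL1 w) :=
  { (inferInstance : AddCommGroup (WL1 w)) with
    mul := (· * ·)
    one := 1
    left_distrib := fun u v x => map_add (mulL w u) v x
    right_distrib := fun u v x => by
      change mulL w (u + v) x = mulL w u x + mulL w v x
      rw [map_add]; rfl
    zero_mul := fun u => by
      change mulL w 0 u = 0
      rw [map_zero]; rfl
    mul_zero := fun u => map_zero (mulL w u)
    mul_assoc := mul_assoc'
    one_mul := one_mul'
    mul_one := mul_one' }

instance : NormedRing (WL1 w) :=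
  { (inferInstance : NormedAddCommGroup (WL1 w)), (inferInstance : Ring (WL1 w)) with
    norm_mul_le := norm_mul_le' }

theorem smul_mul' (a : ℂ) (u v : WL1 w) : a • u * v = a • (u * v) := by
  change mulL w (a • u) v = a • mulL w u v
  rw [map_smul, smul_apply]

theorem mul_smul' (a : ℂ) (u v : WL1 w) : u * a • v = a • (u * v) :=
  map_smul (mulL w u) a v

instance : Algebra ℂ (WL1 w) := Algebra.ofModule smul_mul' mul_smul'

instance : NormedAlgebra ℂ (WL1 w) :=
  { (inferInstance : Algebra ℂ (WL1 w)) with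
    norm_smul_le := norm_smul_le (α := ℂ) (β := WL1 w) }

end Alg
end WL1
end
end FreeGraph

namespace FreeGraph
noncomputable section

/-! ## Combinatorics of paths -/

section Paths

variable {V E : Type*} {ends : E → Sym2 V}

theorem DEdge.op_op (e : DEdge ends) : e.op.op = e := rfl

@[simp] theorem DEdge.src_op (e : DEdge ends) : e.op.src = e.tgt := rfl
@[simp] theorem DEdge.tgt_op (e : DEdge ends) : e.op.tgt = e.src := rfl

theorem DEdge.op_injective : Function.Injective (DEdge.op : DEdge ends → DEdge ends) :=
  fun a b h => by rw [← a.op_op, h, b.op_op]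

namespace GPath

@[simp] theorem tgt_vertex (v : V) : (vertex v : GPath ends).tgt = v := rfl
@[simp] theorem src_vertex (v : V) : (vertex v : GPath ends).src = v := rfl
@[simp] theorem len_vertex (v : V) : (vertex v : GPath ends).len = 0 := rfl

/-- The path `fγ`. -/
def cons (f : DEdge ends) (γ : GPath ends) (h : f.tgt = γ.src) : GPath ends :=
  ⟨f.src, f :: γ.edges, rfl, h ▸ γ.isPath⟩

@[simp] theorem src_cons (f : DEdge ends) (γ : GPath ends) (h) : (cons f γ h).src = f.src := rfl
@[simp] theorem tgt_cons (f : DEdge ends) (γ : GPath ends) (h) : (cons f γ h).tgt = γ.tgt := by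
  simp only [tgt, cons, endpoint, h]
@[simp] theorem len_cons (f : DEdge ends) (γ : GPath ends) (h) :
    (cons f γ h).len = γ.len + 1 := rfl

@[elab_as_elim]
theorem induction {p : GPath ends → Prop} (hv : ∀ v, p (vertex v))
    (hc : ∀ f γ h, p γ → p (cons f γ h)) (γ : GPath ends) : p γ := by
  obtain ⟨v, l, hl⟩ := γ
  induction l generalizing v with
  | nil => exact hv v
  | cons f l ih =>
    obtain ⟨h1, h2⟩ := hl
    subst h1
    exact hc f ⟨f.tgt, l, h2⟩ rfl (ih _ h2)

/-- The concatenation of two paths. -/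
def comp (a b : GPath ends) (h : a.tgt = b.src) : GPath ends :=
  ⟨a.src, a.edges ++ b.edges, by
    rw [isPathFrom_append]
    refine ⟨a.isPath, ?_⟩
    have := b.isPath
    rwa [← h] at this⟩

@[simp] theorem src_comp (a b : GPath ends) (h) : (comp a b h).src = a.src := rfl
@[simp] theorem tgt_comp (a b : GPath ends) (h) : (comp a b h).tgt = b.tgt := by
  simp only [tgt] at h
  simp only [tgt, comp, endpoint_append, h]
@[simp] theorem len_comp (a b : GPath ends) (h) : (comp a b h).len = a.len + b.len := by
  simp [comp, len]

theorem comp_assoc (a b c : GPath ends) (h h' h1 h1') :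
    comp (comp a b h) c h' = comp a (comp b c h1) h1' := by
  ext1
  · rfl
  · exact List.append_assoc _ _ _

theorem vertex_comp (v : V) (a : GPath ends) (h) : comp (vertex v) a h = a := by
  ext1
  · exact h
  · rfl

theorem comp_vertex (v : V) (a : GPath ends) (h) : comp a (vertex v) h = a := by
  ext1
  · rfl
  · exact List.append_nil _

theorem cons_comp (f : DEdge ends) (a b : GPath ends) (h h') :
    comp (cons f a h) b h' = cons f (comp a b (by simpa using h')) (by simpa using h) := rfl

@[simp] theorem src_single (f : DEdge ends) : (single f).src = f.src := rfl
@[simp] theorem tgt_single (f : DEdge ends) : (single f).tgt = f.tgt := rfl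
@[simp] theorem len_single (f : DEdge ends) : (single f).len = 1 := rfl

theorem single_eq_cons (f : DEdge ends) : single f = cons f (vertex f.tgt) (src_vertex _).symm := rfl

theorem single_comp (f : DEdge ends) (b : GPath ends) (h) :
    comp (single f) b h = cons f b (by simpa using h) := rfl

open Classical in
/-- `cons` with a default value. -/
def consD (f : DEdge ends) (γ : GPath ends) : GPath ends :=
  if h : f.tgt = γ.src then cons f γ h else vertex f.src

open Classical in
/-- `comp` with a default value. -/
def compD (a b : GPath ends) : GPath ends := if h : a.tgt = b.src then comp a b h else a

theorem consD_eq {f : DEdge ends} {γ : GPath ends} (h : f.tgt = γ.src) :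
    consD f γ = cons f γ h := dif_pos h

theorem compD_eq {a b : GPath ends} (h : a.tgt = b.src) : compD a b = comp a b h := dif_pos h

theorem src_take (i : ℕ) (γ : GPath ends) : (γ.take i).src = γ.src := rfl

theorem tgt_drop (i : ℕ) (γ : GPath ends) : (γ.drop i).tgt = γ.tgt := by
  simp only [tgt, drop]
  rw [← endpoint_append, List.take_append_drop]

theorem len_take {i : ℕ} {γ : GPath ends} (h : i ≤ γ.len) : (γ.take i).len = i := by
  simpa [len, take] using h

theorem len_drop (i : ℕ) (γ : GPath ends) : (γ.drop i).len = γ.len - i := by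
  simp [len, drop]

theorem take_comp_drop (i : ℕ) (γ : GPath ends) : comp (γ.take i) (γ.drop i) rfl = γ := by
  ext1
  · rfl
  · exact List.take_append_drop _ _

theorem src_getElem {γ : GPath ends} {i : ℕ} (h : i < γ.edges.length) :
    γ.edges[i].src = (γ.take i).tgt := by
  have h1 := (γ.drop i).isPath
  simp only [drop, List.drop_eq_getElem_cons h] at h1
  exact h1.1

theorem tgt_getElem {γ : GPath ends} {i : ℕ} (h : i < γ.edges.length) :
    γ.edges[i].tgt = (γ.drop (i + 1)).src := by
  simp only [drop, List.take_succ_eq_append_getElem h, endpoint_append]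
  rfl

end GPath

open GPath

/-- The sum of `F a f b` over all ways to write the path as `a f b` with an edge `f`. -/
def splitSum {X : Type*} [AddCommMonoid X] (γ : GPath ends)
    (F : GPath ends → DEdge ends → GPath ends → X) : X :=
  ∑ i : Fin γ.edges.length, F (γ.take i) γ.edges[i] (γ.drop (i + 1))

section SplitSum

variable {X : Type*} [AddCommMonoid X]

theorem splitSum_congr {γ : GPath ends} {F G : GPath ends → DEdge ends → GPath ends → X}
    (h : ∀ a f b, a.src = γ.src → a.tgt = f.src → f.tgt = b.src → b.tgt = γ.tgt →
      a.len + b.len + 1 = γ.len → F a f b = G a f b) : splitSum γ F = splitSum γ G := by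
  refine Finset.sum_congr rfl fun i _ => h _ _ _ rfl (src_getElem i.2).symm
    (tgt_getElem i.2) (tgt_drop _ _) ?_
  have := i.2
  rw [len_take (by exact i.2.le), len_drop]
  change _ = γ.edges.length
  change i + (γ.edges.length - (i + 1)) + 1 = γ.edges.length
  omega

theorem splitSum_eq_zero {γ : GPath ends} {F : GPath ends → DEdge ends → GPath ends → X}
    (h : ∀ a f b, a.src = γ.src → a.tgt = f.src → f.tgt = b.src → b.tgt = γ.tgt →
      a.len + b.len + 1 = γ.len → F a f b = 0) : splitSum γ F = 0 :=
  (splitSum_congr h).trans (Finset.sum_const_zero)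

@[simp] theorem splitSum_vertex (v : V) (F : GPath ends → DEdge ends → GPath ends → X) :
    splitSum (vertex v) F = 0 := rfl

theorem splitSum_add (γ : GPath ends) (F G : GPath ends → DEdge ends → GPath ends → X) :
    splitSum γ (fun a f b => F a f b + G a f b) = splitSum γ F + splitSum γ G :=
  Finset.sum_add_distrib

theorem map_splitSum {Y H : Type*} [AddCommMonoid Y] [FunLike H X Y] [AddMonoidHomClass H X Y]
    (T : H) (γ : GPath ends) (F : GPath ends → DEdge ends → GPath ends → X) :
    T (splitSum γ F) = splitSum γ (fun a f b => T (F a f b)) := map_sum T _ _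

theorem splitSum_mul {A : Type*} [NonUnitalNonAssocSemiring A] (γ : GPath ends)
    (F : GPath ends → DEdge ends → GPath ends → A) (x : A) :
    splitSum γ F * x = splitSum γ (fun a f b => F a f b * x) := Finset.sum_mul _ _ _

theorem mul_splitSum {A : Type*} [NonUnitalNonAssocSemiring A] (γ : GPath ends)
    (F : GPath ends → DEdge ends → GPath ends → A) (x : A) :
    x * splitSum γ F = splitSum γ (fun a f b => x * F a f b) := Finset.mul_sum _ _ _

theorem splitSum_sum {ι : Type*} (s : Finset ι) (γ : GPath ends)
    (F : ι → GPath ends → DEdge ends → GPath ends → X) :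
    splitSum γ (fun a f b => ∑ i ∈ s, F i a f b) = ∑ i ∈ s, splitSum γ (F i) :=
  Finset.sum_comm

/-- Either the distinguished edge is the new first edge, with a vertex on its left, or it lies in
`γ` and `f` joins the left factor. Inductions on paths rest on this recursion. -/
theorem splitSum_cons (f : DEdge ends) (γ : GPath ends) (h)
    (F : GPath ends → DEdge ends → GPath ends → X) :
    splitSum (cons f γ h) F =
      F (vertex f.src) f γ + splitSum γ fun a e b => F (consD f a) e b := by
  refine (Fin.sum_univ_succ (n := γ.edges.length) _).trans ?_
  congr 1
  · change F ((cons f γ h).take 0) f ((cons f γ h).drop 1) = _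
    congr 1
    ext1
    · exact h
    · rfl
  · refine Finset.sum_congr rfl fun i _ => ?_
    change F ((cons f γ h).take (i + 1)) γ.edges[i] ((cons f γ h).drop (i + 1 + 1)) =
      F (consD f (γ.take i)) γ.edges[i] (γ.drop (i + 1))
    rw [consD_eq (h.trans (src_take i γ).symm)]
    congr 1
    ext1
    · simp only [drop, cons, List.take_succ_cons, endpoint, h]
    · rfl

theorem splitSum_comp (a b : GPath ends) (h) (F : GPath ends → DEdge ends → GPath ends → X) :
    splitSum (comp a b h) F = splitSum a (fun a₁ f a₂ => F a₁ f (compD a₂ b)) +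
      splitSum b (fun b₁ f b₂ => F (compD a b₁) f b₂) := by
  induction a using GPath.induction generalizing F with
  | hv v =>
    rw [vertex_comp, splitSum_vertex, zero_add]
    refine splitSum_congr fun a f c h1 _ _ _ _ => ?_
    rw [compD_eq (h.trans h1.symm), vertex_comp]
  | hc f a h' ih =>
    have hab : a.tgt = b.src := by simpa using h
    rw [cons_comp, splitSum_cons, ih hab, splitSum_cons, add_assoc, compD_eq hab]
    congr 2
    refine splitSum_congr fun b₁ g b₂ h1 _ _ _ _ => ?_
    have h2 : a.tgt = b₁.src := hab.trans h1.symm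
    rw [compD_eq h2, consD_eq (h'.trans (src_comp a b₁ h2).symm), compD_eq (by simpa using h2), cons_comp]

/-- Both sides run over the ordered pairs of distinguished edges of `γ`. This is the combinatorial
form of the commutation of second derivatives. -/
theorem splitSum_splitSum (γ : GPath ends)
    (G : GPath ends → DEdge ends → GPath ends → DEdge ends → GPath ends → X) :
    splitSum γ (fun a f b => splitSum a fun a₁ f₁ a₂ => G a₁ f₁ a₂ f b) =
      splitSum γ fun a₁ f₁ b' => splitSum b' fun a₂ f b => G a₁ f₁ a₂ f b := by
  induction γ using GPath.induction generalizing G with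
  | hv v => rfl
  | hc g γ h ih =>
    rw [splitSum_cons, splitSum_cons, splitSum_vertex, zero_add, ← ih, ← splitSum_add]
    refine splitSum_congr fun a f b h1 _ _ _ _ => ?_
    rw [consD_eq (h.trans h1.symm), splitSum_cons]

/-- The edge at position `i` has `i` edges on its left and `γ.len - (i + 1)` on its right. -/
theorem norm_splitSum_le {X : Type*} [SeminormedAddCommGroup X] (γ : GPath ends)
    {F : GPath ends → DEdge ends → GPath ends → X} {B : ℕ → ℕ → ℝ}
    (h : ∀ a f b, a.tgt = f.src → f.tgt = b.src → a.len + b.len + 1 = γ.len →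
      ‖F a f b‖ ≤ B a.len b.len) :
    ‖splitSum γ F‖ ≤ ∑ i ∈ Finset.range γ.len, B i (γ.len - (i + 1)) := by
  rw [Finset.sum_range]
  refine norm_sum_le_of_le _ fun i _ => ?_
  have h2 : (γ.take i).len = i := len_take (by exact i.2.le)
  have h3 := len_drop (i + 1) γ
  have := i.2
  have h4 := h (γ.take i) γ.edges[i] (γ.drop (i + 1)) (src_getElem i.2).symm (tgt_getElem i.2) (by
    rw [h2, h3]
    change i < γ.len at this
    omega)
  rwa [h2, h3] at h4

/-- `B` bounds the whole family at one factorization, so only the length of the path enters, not the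
size of `s`. -/
theorem sum_norm_splitSum_le {ι X : Type*} [SeminormedAddCommGroup X] (s : Finset ι)
    (γ : GPath ends) {F : ι → GPath ends → DEdge ends → GPath ends → X} {B : ℝ}
    (h : ∀ a f b, a.len + b.len + 1 = γ.len → ∑ i ∈ s, ‖F i a f b‖ ≤ B) :
    ∑ i ∈ s, ‖splitSum γ (F i)‖ ≤ γ.len * B := by
  calc ∑ i ∈ s, ‖splitSum γ (F i)‖ ≤ ∑ i ∈ s, splitSum γ fun a f b => ‖F i a f b‖ :=
        Finset.sum_le_sum fun i _ => norm_sum_le _ _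
    _ = splitSum γ fun a f b => ∑ i ∈ s, ‖F i a f b‖ := (splitSum_sum _ _ _).symm
    _ ≤ ∑ _i : Fin γ.edges.length, B := Finset.sum_le_sum fun i _ => h _ _ _ (by
        rw [len_take (by exact i.2.le), len_drop]
        have := i.2
        change i < γ.len at this
        omega)
    _ = γ.len * B := by simp [len]

end SplitSum

/-! ### Reversal of paths. -/

namespace GPath

@[simp] theorem rev_vertex (v : V) : (vertex v : GPath ends).rev = vertex v := rfl

@[simp] theorem src_rev (γ : GPath ends) : γ.rev.src = γ.tgt := rfl

@[simp] theorem tgt_rev (γ : GPath ends) : γ.rev.tgt = γ.src :=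
  (isPathFrom_reverse _ _ γ.isPath).2

@[simp] theorem len_rev (γ : GPath ends) : γ.rev.len = γ.len := by simp [len, rev]

theorem rev_rev (γ : GPath ends) : γ.rev.rev = γ := by
  ext1
  · exact tgt_rev γ
  · have : (DEdge.op ∘ DEdge.op : DEdge ends → DEdge ends) = id := rfl
    simp [rev, List.map_reverse, this]

theorem rev_comp (a b : GPath ends) (h) :
    (comp a b h).rev = comp b.rev a.rev (by simpa using h.symm) := by
  ext1
  · exact tgt_comp _ _ _
  · simp [rev, comp]

theorem rev_single (e : DEdge ends) : (single e).rev = single e.op := rfl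

theorem rev_cons (f : DEdge ends) (γ : GPath ends) (h) :
    (cons f γ h).rev = comp γ.rev (single f.op) (by simpa using h.symm) := by
  rw [← single_comp f γ (by simpa using h), rev_comp]
  rfl

end GPath

theorem splitSum_rev {X : Type*} [AddCommMonoid X] (γ : GPath ends)
    (F : GPath ends → DEdge ends → GPath ends → X) :
    splitSum γ.rev F = splitSum γ fun a f b => F b.rev f.op a.rev := by
  induction γ using GPath.induction generalizing F with
  | hv v => rfl
  | hc f γ h ih =>
    rw [rev_cons, splitSum_comp, ih, splitSum_cons, add_comm]
    congr 1
    · rw [single_eq_cons, splitSum_cons, splitSum_vertex, add_zero]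
      congr 1
      rw [compD_eq (by simpa using h.symm)]
      exact comp_vertex _ _ _
    · refine splitSum_congr fun a e b h1 _ _ _ _ => ?_
      rw [consD_eq (h.trans h1.symm), rev_cons, compD_eq (by simpa using (h.trans h1.symm).symm)]

end Paths
end
end FreeGraph

namespace FreeGraph
noncomputable section

open PMon (pmul)
open GPath

/-! ## The path algebra and the matrix algebra over its tensor square -/

section Algebras

variable {V E : Type*} {ends : E → Sym2 V}

open Classical in
/-- The concatenation of two paths, if it is defined. -/
def pathMul (a b : GPath ends) : Option (GPath ends) :=
  if h : a.tgt = b.src then some (comp a b h) else none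

theorem pathMul_of_eq {a b : GPath ends} (h : a.tgt = b.src) :
    pathMul a b = some (comp a b h) := dif_pos h

theorem pathMul_of_ne {a b : GPath ends} (h : a.tgt ≠ b.src) : pathMul a b = none := dif_neg h

open Classical in
instance [Fintype V] : PMon (GPath ends) where
  pmul := pathMul
  pmul_assoc a b c := by
    by_cases h1 : a.tgt = b.src <;> by_cases h2 : b.tgt = c.src
    · rw [pathMul_of_eq h1, pathMul_of_eq h2, Option.bind_some, Option.bind_some,
        pathMul_of_eq ((tgt_comp a b h1).trans h2), pathMul_of_eq (h1.trans (src_comp b c h2).symm)]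
      exact congrArg some (comp_assoc _ _ _ _ _ _ _)
    · rw [pathMul_of_eq h1, pathMul_of_ne h2, Option.bind_some, Option.bind_none,
        pathMul_of_ne fun h => h2 ((tgt_comp a b h1).symm.trans h)]
    · rw [pathMul_of_ne h1, pathMul_of_eq h2, Option.bind_some, Option.bind_none,
        pathMul_of_ne fun h => h1 (h.trans (src_comp b c h2))]
    · rw [pathMul_of_ne h1, pathMul_of_ne h2, Option.bind_none, Option.bind_none]
  units := Finset.univ.image vertex
  lu a := vertex a.src
  ru a := vertex a.tgt
  lu_mem a := Finset.mem_image_of_mem _ (Finset.mem_univ _)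
  ru_mem a := Finset.mem_image_of_mem _ (Finset.mem_univ _)
  lu_mul a := (pathMul_of_eq (tgt_vertex _)).trans (congrArg some (vertex_comp _ _ _))
  mul_ru a := (pathMul_of_eq (src_vertex _).symm).trans (congrArg some (comp_vertex _ _ _))
  lu_ne a u hu h := by
    obtain ⟨v, -, rfl⟩ := Finset.mem_image.1 hu
    exact pathMul_of_ne fun h' => h (congrArg vertex h')
  ru_ne a u hu h := by
    obtain ⟨v, -, rfl⟩ := Finset.mem_image.1 hu
    exact pathMul_of_ne fun h' => h (congrArg vertex h'.symm)

theorem pmul_of_eq [Fintype V] {a b : GPath ends} (h : a.tgt = b.src) :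
    pmul a b = some (comp a b h) := pathMul_of_eq h

theorem pmul_of_ne [Fintype V] {a b : GPath ends} (h : a.tgt ≠ b.src) :
    pmul a b = none := pathMul_of_ne h

/-- The matrix unit at `(row, col)` with entry `fst ⊗ snd`. -/
@[ext]
structure MIdx {V E : Type*} (ends : E → Sym2 V) where
  row : DEdge ends
  col : DEdge ends
  fst : GPath ends
  snd : GPath ends

open Classical in
instance [Fintype V] [Finite E] : PMon (MIdx ends) where
  pmul x y :=
    -- The second legs are multiplied in the opposite order, as in matrices over `B ⊗ B^op`.
    if h : x.col = y.row ∧ x.fst.tgt = y.fst.src ∧ y.snd.tgt = x.snd.src then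
      some ⟨x.row, y.col, comp x.fst y.fst h.2.1, comp y.snd x.snd h.2.2⟩ else none
  pmul_assoc x y z := by
    by_cases h1 : x.col = y.row ∧ x.fst.tgt = y.fst.src ∧ y.snd.tgt = x.snd.src <;>
      by_cases h2 : y.col = z.row ∧ y.fst.tgt = z.fst.src ∧ z.snd.tgt = y.snd.src
    · simp only [h1, h2, and_self, dite_true, Option.bind_some, tgt_comp, src_comp]
      congr 2
      · exact comp_assoc _ _ _ _ _ _ _
      · exact (comp_assoc _ _ _ _ _ _ _).symm
    · rw [dif_pos h1, dif_neg h2]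
      simp only [Option.bind_some, tgt_comp, Option.bind_none, src_comp]
      exact dif_neg h2
    · rw [dif_neg h1, dif_pos h2]
      simp only [Option.bind_some, tgt_comp, Option.bind_none, src_comp]
      symm
      exact dif_neg h1
    · rw [dif_neg h1, dif_neg h2]; rfl
  units := Finset.univ.image fun q : DEdge ends × V × V =>
    ⟨q.1, q.1, vertex q.2.1, vertex q.2.2⟩
  lu x := ⟨x.row, x.row, vertex x.fst.src, vertex x.snd.tgt⟩
  ru x := ⟨x.col, x.col, vertex x.fst.tgt, vertex x.snd.src⟩
  lu_mem x := Finset.mem_image.2 ⟨(x.row, x.fst.src, x.snd.tgt), Finset.mem_univ _, rfl⟩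
  ru_mem x := Finset.mem_image.2 ⟨(x.col, x.fst.tgt, x.snd.src), Finset.mem_univ _, rfl⟩
  lu_mul x := by
    rw [dif_pos ⟨rfl, tgt_vertex _, (src_vertex _).symm⟩]
    simp only [vertex_comp, comp_vertex]
  mul_ru x := by
    rw [dif_pos ⟨rfl, (src_vertex _).symm, tgt_vertex _⟩]
    simp only [vertex_comp, comp_vertex]
  lu_ne x u hu h := by
    obtain ⟨q, -, rfl⟩ := Finset.mem_image.1 hu
    refine dif_neg fun h' => h ?_
    obtain ⟨h1, h2, h3⟩ := h'
    simp only [tgt_vertex, src_vertex] at h1 h2 h3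
    rw [h1, h2, h3]
  ru_ne x u hu h := by
    obtain ⟨q, -, rfl⟩ := Finset.mem_image.1 hu
    refine dif_neg fun h' => h ?_
    obtain ⟨h1, h2, h3⟩ := h'
    simp only [tgt_vertex, src_vertex] at h1 h2 h3
    rw [h1, h2, h3]

theorem MIdx.pmul_of [Fintype V] [Finite E] {x y : MIdx ends} (h1 : x.col = y.row)
    (h2 : x.fst.tgt = y.fst.src) (h3 : y.snd.tgt = x.snd.src) :
    pmul x y = some ⟨x.row, y.col, comp x.fst y.fst h2, comp y.snd x.snd h3⟩ :=
  dif_pos ⟨h1, h2, h3⟩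

theorem MIdx.pmul_of_not [Fintype V] [Finite E] {x y : MIdx ends}
    (h : ¬(x.col = y.row ∧ x.fst.tgt = y.fst.src ∧ y.snd.tgt = x.snd.src)) :
    pmul x y = none := dif_neg h

/-- Positive real numbers. -/
abbrev PosReal := {r : ℝ // 0 < r}

/-- The weight `r ^ |γ|` on paths. -/
def pw (ends : E → Sym2 V) (r : PosReal) : Weight (GPath ends) :=
  ⟨fun γ => r.1 ^ γ.len, fun _ => pow_pos r.2 _⟩

theorem pw_apply (r : PosReal) (γ : GPath ends) : pw ends r γ = r.1 ^ γ.len := rfl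

/-- The weight `R ^ |a| c ^ |b| + c ^ |a| R ^ |b|` on matrix units with entry `a ⊗ b`. -/
def mw (ends : E → Sym2 V) (R c : PosReal) : Weight (MIdx ends) :=
  ⟨fun x => R.1 ^ x.fst.len * c.1 ^ x.snd.len + c.1 ^ x.fst.len * R.1 ^ x.snd.len, fun x => by
    have := R.2
    have := c.2
    positivity⟩

theorem mw_apply (R c : PosReal) (x : MIdx ends) : mw ends R c x =
    R.1 ^ x.fst.len * c.1 ^ x.snd.len + c.1 ^ x.fst.len * R.1 ^ x.snd.len := rfl

/-- The Banach algebra `B_r`. -/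
abbrev PA (ends : E → Sym2 V) (r : PosReal) := WL1 (pw ends r)

/-- Matrices over the completed tensor square of `B`. -/
abbrev MA (ends : E → Sym2 V) (R c : PosReal) := WL1 (mw ends R c)

open WL1

/-! ### Words in a representation of the path algebra -/

/-- The value of a path at a family of projections and a tuple of elements of a ring. -/
def wordIn {B : Type*} [Monoid B] (p : V → B) (y : DEdge ends → B) (γ : GPath ends) : B :=
  p γ.src * (γ.edges.map y).prod

/-- The relations between the projections and the generators. -/
structure IsRep {B : Type*} [Ring B] (p : V → B) (y : DEdge ends → B) : Prop where
  idem : ∀ v, p v * p v = p v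
  orth : ∀ v w, v ≠ w → p v * p w = 0
  left : ∀ e, p e.src * y e = y e
  right : ∀ e, y e * p e.tgt = y e

namespace IsRep

variable {B : Type*} [Ring B] {p : V → B} {y : DEdge ends → B} (h : IsRep p y)

theorem word_vertex (v : V) : wordIn p y (vertex v) = p v := mul_one _

include h

theorem word_cons (f : DEdge ends) (γ : GPath ends) (h') :
    wordIn p y (cons f γ h') = y f * wordIn p y γ := by
  simp only [wordIn, cons, List.map_cons, List.prod_cons]
  rw [← mul_assoc, h.left, ← mul_assoc, ← h', h.right]

theorem word_single (f : DEdge ends) : wordIn p y (single f) = y f := by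
  rw [single_eq_cons, h.word_cons, word_vertex, h.right]

theorem src_mul_word (γ : GPath ends) : p γ.src * wordIn p y γ = wordIn p y γ := by
  rw [wordIn, ← mul_assoc, h.idem]

theorem ne_mul_word {v : V} {γ : GPath ends} (hv : v ≠ γ.src) : p v * wordIn p y γ = 0 := by
  rw [wordIn, ← mul_assoc, h.orth _ _ hv, zero_mul]

theorem word_mul_tgt (γ : GPath ends) : wordIn p y γ * p γ.tgt = wordIn p y γ := by
  induction γ using GPath.induction with
  | hv v => rw [word_vertex, tgt_vertex, h.idem]
  | hc f γ h' ih => rw [h.word_cons, tgt_cons, mul_assoc, ih]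

theorem word_comp (a b : GPath ends) (h') :
    wordIn p y (comp a b h') = wordIn p y a * wordIn p y b := by
  induction a using GPath.induction with
  | hv v =>
    rw [vertex_comp, word_vertex]
    have : v = b.src := h'
    rw [this, h.src_mul_word]
  | hc f a h1 ih => rw [cons_comp, h.word_cons, ih, h.word_cons, mul_assoc]

theorem word_mul_word_of_ne {a b : GPath ends} (h' : a.tgt ≠ b.src) :
    wordIn p y a * wordIn p y b = 0 := by
  rw [← h.word_mul_tgt, mul_assoc, h.ne_mul_word h', mul_zero]

end IsRep

section Eval

variable {B : Type*} [NormedRing B] {p : V → B} {y : DEdge ends → B}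

theorem norm_wordIn_le {s : ℝ} (hp : ∀ v, ‖p v‖ ≤ 1) (hy : ∀ e, ‖y e‖ ≤ s)
    (γ : GPath ends) : ‖wordIn p y γ‖ ≤ s ^ γ.len := by
  obtain ⟨v, l, hl⟩ := γ
  simp only [wordIn, len]
  -- The prefix `X` absorbs the identity of `B`, whose norm need not be at most `1`.
  suffices ∀ (X : B) (l : List (DEdge ends)),
      ‖X * (l.map y).prod‖ ≤ ‖X‖ * s ^ l.length by
    refine (this (p v) l).trans ?_
    cases l with
    | nil => simpa using hp v
    | cons e l =>
      have : 0 ≤ s := (norm_nonneg _).trans (hy e)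
      exact mul_le_of_le_one_left (by positivity) (hp v)
  intro X l
  induction l generalizing X with
  | nil => simp
  | cons e l ih =>
    have hs : 0 ≤ s := (norm_nonneg _).trans (hy e)
    rw [List.map_cons, List.prod_cons, ← mul_assoc, List.length_cons, pow_succ']
    refine (ih _).trans ?_
    rw [← mul_assoc]
    gcongr
    exact (norm_mul_le _ _).trans (by gcongr; exact hy e)

theorem evalA_bdd {s : PosReal} (hp : ∀ v, ‖p v‖ ≤ 1) (hy : ∀ e, ‖y e‖ ≤ s.1) :
    Bdd (pw ends s) (wordIn p y) := ⟨1, fun γ => by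
  rw [one_mul]; exact norm_wordIn_le hp hy γ⟩

variable [NormedAlgebra ℂ B] [CompleteSpace B]

variable (p y) in
/-- The evaluation of series at a tuple. -/
def evalA (s : PosReal) : PA ends s →L[ℂ] B := lift (wordIn p y)

theorem evalA_mon {s : PosReal} (hp : ∀ v, ‖p v‖ ≤ 1) (hy : ∀ e, ‖y e‖ ≤ s.1)
    (γ : GPath ends) : evalA p y s (mon γ) = wordIn p y γ := lift_mon (evalA_bdd hp hy) γ

theorem norm_evalA_le {s : PosReal} (hp : ∀ v, ‖p v‖ ≤ 1) (hy : ∀ e, ‖y e‖ ≤ s.1)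
    (u : PA ends s) : ‖evalA p y s u‖ ≤ ‖u‖ := by
  refine (norm_lift_le (C := 1) (fun γ => ?_) u).trans_eq (one_mul _)
  rw [one_mul]; exact norm_wordIn_le hp hy γ

end Eval

variable [Fintype V]

instance (r : PosReal) : SubMul (pw ends r) where
  le a b c h := by
    by_cases h1 : a.tgt = b.src
    · rw [pmul_of_eq h1, Option.some.injEq] at h
      rw [← h, pw_apply, pw_apply, pw_apply, len_comp, pow_add]
    · rw [pmul_of_ne h1] at h; cases h

instance [Finite E] (R c : PosReal) : SubMul (mw ends R c) where
  le x y z h := by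
    by_cases h1 : x.col = y.row ∧ x.fst.tgt = y.fst.src ∧ y.snd.tgt = x.snd.src
    · rw [MIdx.pmul_of h1.1 h1.2.1 h1.2.2, Option.some.injEq] at h
      rw [← h, mw_apply, mw_apply, mw_apply]
      simp only [len_comp, pow_add]
      have hR := R.2
      have hc := c.2
      -- The product of the two weights is the weight of the product plus two mixed terms, which are
      -- nonnegative.
      have h1 : 0 ≤ R.1 ^ x.fst.len * c.1 ^ x.snd.len * (c.1 ^ y.fst.len * R.1 ^ y.snd.len) := by
        positivity
      have h2 : 0 ≤ c.1 ^ x.fst.len * R.1 ^ x.snd.len * (R.1 ^ y.fst.len * c.1 ^ y.snd.len) := by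
        positivity
      nlinarith [h1, h2]
    · rw [MIdx.pmul_of_not h1] at h; cases h

open WL1

namespace PA

variable {r : PosReal}

/-- The projection `p_v`. -/
def pv (r : PosReal) (v : V) : PA ends r := mon (vertex v)

/-- The generator `z_e`. -/
def z (r : PosReal) (e : DEdge ends) : PA ends r := mon (single e)

theorem mon_mul_mon_of_eq {a b : GPath ends} (h : a.tgt = b.src) :
    (mon a * mon b : PA ends r) = mon (comp a b h) := by
  rw [mon_mul_mon, pmul_of_eq h, omon_some]

theorem mon_mul_mon_of_ne {a b : GPath ends} (h : a.tgt ≠ b.src) :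
    (mon a * mon b : PA ends r) = 0 := by
  rw [mon_mul_mon, pmul_of_ne h, omon_none]

theorem mon_cons (f : DEdge ends) (γ : GPath ends) (h) :
    (mon (cons f γ h) : PA ends r) = z r f * mon γ := by
  rw [z, mon_mul_mon_of_eq (by simpa using h), single_comp]

end PA

theorem PA.pv_mul_mon {r : PosReal} {v : V} {a : GPath ends} (h : v = a.src) :
    PA.pv r v * mon a = (mon a : PA ends r) :=
  (PA.mon_mul_mon_of_eq (a := vertex v) h).trans (congrArg mon (vertex_comp v a h))

theorem PA.pv_mul_mon_of_ne {r : PosReal} {v : V} {a : GPath ends} (h : v ≠ a.src) :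
    PA.pv r v * mon a = (0 : PA ends r) := PA.mon_mul_mon_of_ne h

theorem PA.mon_mul_pv {r : PosReal} {v : V} {a : GPath ends} (h : a.tgt = v) :
    mon a * PA.pv r v = (mon a : PA ends r) :=
  (PA.mon_mul_mon_of_eq (b := vertex v) h).trans (congrArg mon (comp_vertex v a h))

theorem PA.mon_mul_pv_of_ne {r : PosReal} {v : V} {a : GPath ends} (h : a.tgt ≠ v) :
    mon a * PA.pv r v = (0 : PA ends r) := PA.mon_mul_mon_of_ne h

theorem PA.isRep (r : PosReal) : IsRep (PA.pv r) (PA.z r : DEdge ends → PA ends r) where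
  idem _ := PA.pv_mul_mon rfl
  orth _ _ h := PA.pv_mul_mon_of_ne h
  left _ := PA.pv_mul_mon rfl
  right _ := PA.mon_mul_pv rfl

theorem PA.word_z (r : PosReal) (γ : GPath ends) : wordIn (PA.pv r) (PA.z r) γ = mon γ := by
  induction γ using GPath.induction with
  | hv v => exact IsRep.word_vertex v
  | hc f γ h ih => rw [(PA.isRep r).word_cons, ih, PA.mon_cons]

section Eval

variable {B : Type*} [NormedRing B] [NormedAlgebra ℂ B] [CompleteSpace B]
  {p : V → B} {y : DEdge ends → B}

theorem evalA_mul {s : PosReal} (h : IsRep p y) (hp : ∀ v, ‖p v‖ ≤ 1) (hy : ∀ e, ‖y e‖ ≤ s.1)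
    (u v : PA ends s) : evalA p y s (u * v) = evalA p y s u * evalA p y s v := by
  refine ext_apply₂
    (S := (ContinuousLinearMap.compL ℂ (PA ends s) (PA ends s) B (evalA p y s)).comp
      (ContinuousLinearMap.mul ℂ (PA ends s)))
    (T := ((ContinuousLinearMap.compL ℂ (PA ends s) B B).flip (evalA p y s)).comp
      ((ContinuousLinearMap.mul ℂ B).comp (evalA p y s))) (fun a b => ?_) u v
  change evalA p y s (mon a * mon b) = evalA p y s (mon a) * evalA p y s (mon b)
  rw [evalA_mon hp hy, evalA_mon hp hy]
  by_cases h' : a.tgt = b.src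
  · rw [PA.mon_mul_mon_of_eq h', evalA_mon hp hy, h.word_comp]
  · rw [PA.mon_mul_mon_of_ne h', map_zero, h.word_mul_word_of_ne h']

end Eval
end Algebras
end
end FreeGraph

namespace FreeGraph
noncomputable section

open PMon (pmul)
open GPath WL1

/-! ### Derivations between algebras of different radii. -/

section Calculus

variable {V E : Type*} {ends : E → Sym2 V}

/-- A Cauchy estimate on monomials: differentiation costs a factor `1 / (r - c)` when the radius
drops from `r` to `c`. -/
theorem mul_pow_pred_mul_sub_le {c r : ℝ} (hc : 0 ≤ c) (hcr : c ≤ r) (n : ℕ) :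
    n * c ^ (n - 1) * (r - c) ≤ r ^ n := by
  induction n with
  | zero => simp
  | succ n ih =>
    have h1 : (n : ℝ) * c ^ n = c * (n * c ^ (n - 1)) := by
      cases n with
      | zero => simp
      | succ n => simp only [Nat.add_sub_cancel]; ring
    have h2 : c ^ n ≤ r ^ n := by gcongr
    simp only [Nat.add_sub_cancel, Nat.cast_succ]
    calc (n + 1 : ℝ) * c ^ n * (r - c) = c * (n * c ^ (n - 1) * (r - c)) + c ^ n * (r - c) := by
          rw [add_mul, h1]; ring
      _ ≤ c * r ^ n + r ^ n * (r - c) := by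
          have : 0 ≤ r - c := sub_nonneg.2 hcr
          gcongr
      _ = r ^ (n + 1) := by ring

theorem mw_self_apply (c : PosReal) (x : MIdx ends) :
    mw ends c c x = 2 * c.1 ^ x.fst.len * c.1 ^ x.snd.len := by
  rw [mw_apply]; ring

/-- The matrix with the entry `u ⊗ v` at `(e, f)`. -/
def elemM (c : PosReal) (e f : DEdge ends) : PA ends c →L[ℂ] PA ends c →L[ℂ] MA ends c c :=
  lift fun a => lift fun b => mon ⟨e, f, a, b⟩

theorem norm_mk_mon_mon (c : PosReal) (e f : DEdge ends) (a b : GPath ends) :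
    ‖(mon ⟨e, f, a, b⟩ : MA ends c c)‖ ≤ 2 * c.1 ^ a.len * pw ends c b := by
  rw [norm_mon, mw_self_apply, pw_apply]

theorem norm_mk_mon (c : PosReal) (e f : DEdge ends) (a : GPath ends) :
    ‖(lift fun b => mon ⟨e, f, a, b⟩ : PA ends c →L[ℂ] MA ends c c)‖ ≤ 2 * pw ends c a := by
  have := c.2
  exact ContinuousLinearMap.opNorm_le_bound _ (by rw [pw_apply]; positivity) fun u =>
    norm_lift_le (norm_mk_mon_mon c e f a) u

theorem mk_mon (c : PosReal) (e f : DEdge ends) (a b : GPath ends) :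
    elemM c e f (mon a) (mon b) = mon ⟨e, f, a, b⟩ := by
  rw [elemM, lift_mon ⟨2, norm_mk_mon c e f⟩, lift_mon ⟨_, norm_mk_mon_mon c e f a⟩]

/-- The inclusion of matrix algebras for different radii. -/
def resM (ends : E → Sym2 V) (R c : PosReal) : MA ends R c →L[ℂ] MA ends c c := lift mon

section ResM

variable {R c : PosReal} (hc : c.1 ≤ R.1)

include hc

theorem resM_bound (x : MIdx ends) : ‖(mon x : MA ends c c)‖ ≤ 1 * mw ends R c x := by
  rw [norm_mon, one_mul, mw_apply, mw_apply]
  have := c.2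
  gcongr

theorem resM_mon (x : MIdx ends) : resM ends R c (mon x) = mon x :=
  lift_mon ⟨1, resM_bound hc⟩ x

theorem norm_resM_le (X : MA ends R c) : ‖resM ends R c X‖ ≤ ‖X‖ :=
  (norm_lift_le (resM_bound hc) X).trans_eq (one_mul _)

end ResM

variable [Fintype V]

/-! ### Restriction to smaller radii, elementary matrices -/

theorem PA.norm_pv_le (r : PosReal) (v : V) : ‖(PA.pv r v : PA ends r)‖ ≤ 1 := by
  rw [PA.pv, norm_mon, pw_apply, len_vertex, pow_zero]

theorem PA.norm_z (r : PosReal) (e : DEdge ends) : ‖PA.z r e‖ = r.1 := by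
  rw [PA.z, norm_mon, pw_apply, len_single, pow_one]

/-- The inclusion of `B_R` into `B_r` for `r ≤ R`. -/
def res (R r : PosReal) : PA ends R →L[ℂ] PA ends r := evalA (PA.pv r) (PA.z r) R

section Res

variable {R r : PosReal} (hr : r.1 ≤ R.1)

include hr

theorem res_mon (γ : GPath ends) : res R r (mon γ) = mon γ := by
  rw [res, evalA_mon (PA.norm_pv_le r) (fun e => (PA.norm_z r e).trans_le hr), PA.word_z]

theorem res_mul (u v : PA ends R) : res R r (u * v) = res R r u * res R r v :=
  evalA_mul (PA.isRep r) (PA.norm_pv_le r) (fun e => (PA.norm_z r e).trans_le hr) u v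

theorem norm_res_le (u : PA ends R) : ‖res R r u‖ ≤ ‖u‖ :=
  norm_evalA_le (PA.norm_pv_le r) (fun e => (PA.norm_z r e).trans_le hr) u

theorem res_isRep {y : DEdge ends → PA ends R} (h : IsRep (PA.pv R) y) :
    IsRep (PA.pv r) fun e => res R r (y e) where
  idem := (PA.isRep (ends := ends) r).idem
  orth := (PA.isRep (ends := ends) r).orth
  left e := by
    conv_rhs => rw [← h.left e, res_mul hr, PA.pv, res_mon hr]
    rfl
  right e := by
    conv_rhs => rw [← h.right e, res_mul hr, PA.pv, res_mon hr]
    rfl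

theorem res_word {y : DEdge ends → PA ends R} (h : IsRep (PA.pv R) y) (γ : GPath ends) :
    res R r (wordIn (PA.pv R) y γ) = wordIn (PA.pv r) (fun e => res R r (y e)) γ := by
  induction γ using GPath.induction with
  | hv v => rw [IsRep.word_vertex, IsRep.word_vertex, PA.pv, res_mon hr, PA.pv]
  | hc f γ h' ih => rw [h.word_cons, (res_isRep hr h).word_cons, res_mul hr, ih]

end Res

section MatrixUnits

variable [Finite E]

theorem mk_mul_mk (c : PosReal) (e f g : DEdge ends) (u v u' v' : PA ends c) :
    elemM c e f u v * elemM c f g u' v' = elemM c e g (u * u') (v' * v) := by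
  have h1 : ∀ (a b : GPath ends) (u' v' : PA ends c),
      elemM c e f (mon a) (mon b) * elemM c f g u' v' = elemM c e g (mon a * u') (v' * mon b) := by
    intro a b u' v'
    refine ext_apply₂
      (S := (ContinuousLinearMap.compL ℂ (PA ends c) (MA ends c c) (MA ends c c)
        (ContinuousLinearMap.mul ℂ _ (elemM c e f (mon a) (mon b)))).comp (elemM c f g))
      (T := (elemM c e g).bilinearComp (ContinuousLinearMap.mul ℂ _ (mon a))
        ((ContinuousLinearMap.mul ℂ _).flip (mon b))) (fun a' b' => ?_) u' v'
    change elemM c e f (mon a) (mon b) * elemM c f g (mon a') (mon b') =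
      elemM c e g (mon a * mon a') (mon b' * mon b)
    rw [mk_mon, mk_mon, mon_mul_mon]
    by_cases ha : a.tgt = a'.src
    · by_cases hb : b'.tgt = b.src
      · rw [MIdx.pmul_of rfl ha hb, PA.mon_mul_mon_of_eq ha, PA.mon_mul_mon_of_eq hb, mk_mon,
          omon_some]
      · rw [MIdx.pmul_of_not (fun h => hb h.2.2), PA.mon_mul_mon_of_ne hb, map_zero, omon_none]
    · rw [MIdx.pmul_of_not (fun h => ha h.2.1), PA.mon_mul_mon_of_ne ha, map_zero, omon_none]
      rfl
  exact ext_apply₂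
    (S := (ContinuousLinearMap.compL ℂ (PA ends c) (MA ends c c) (MA ends c c)
      ((ContinuousLinearMap.mul ℂ _).flip (elemM c f g u' v'))).comp (elemM c e f))
    (T := (elemM c e g).bilinearComp ((ContinuousLinearMap.mul ℂ _).flip u')
      (ContinuousLinearMap.mul ℂ _ v')) (fun a b => h1 a b u' v') u v

theorem mk_mul_mk_ne (c : PosReal) (e f g : DEdge ends) {f' : DEdge ends} (hf : f ≠ f')
    (u v u' v' : PA ends c) : elemM c e f u v * elemM c f' g u' v' = 0 := by
  have h1 : ∀ (a b : GPath ends) (u' v' : PA ends c),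
      elemM c e f (mon a) (mon b) * elemM c f' g u' v' = 0 := by
    intro a b u' v'
    refine ext_apply₂
      (S := (ContinuousLinearMap.compL ℂ (PA ends c) (MA ends c c) (MA ends c c)
        (ContinuousLinearMap.mul ℂ _ (elemM c e f (mon a) (mon b)))).comp (elemM c f' g))
      (T := 0) (fun a' b' => ?_) u' v'
    change elemM c e f (mon a) (mon b) * elemM c f' g (mon a') (mon b') = 0
    rw [mk_mon, mk_mon, mon_mul_mon, MIdx.pmul_of_not (fun h => hf h.1), omon_none]
  exact ext_apply₂
    (S := (ContinuousLinearMap.compL ℂ (PA ends c) (MA ends c c) (MA ends c c)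
      ((ContinuousLinearMap.mul ℂ _).flip (elemM c f' g u' v'))).comp (elemM c e f))
    (T := 0) (fun a b => h1 a b u' v') u v

/-- Multiplication by `u` on the first tensor factor. -/
def iota₁ (c : PosReal) (u : PA ends c) : MA ends c c := ∑ f, elemM c f f u 1

/-- Multiplication by `v` on the second tensor factor. -/
def iota₂ (c : PosReal) (v : PA ends c) : MA ends c c := ∑ f, elemM c f f 1 v

theorem iota₁_mul_mk (c : PosReal) (e f : DEdge ends) (u a b : PA ends c) :
    iota₁ c u * elemM c e f a b = elemM c e f (u * a) b := by
  rw [iota₁, Finset.sum_mul, Finset.sum_eq_single_of_mem e (Finset.mem_univ _), mk_mul_mk, mul_one]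
  exact fun g _ hg => mk_mul_mk_ne _ _ _ _ hg _ _ _ _

/-- Since the second leg carries the opposite product, multiplication from the left puts `v` on the
right of `b`. Both module actions in the Leibniz rule of the Jacobian thus become left
multiplications in the matrix algebra, and right multiplications stay free for the chain rule. -/
theorem iota₂_mul_mk (c : PosReal) (e f : DEdge ends) (v a b : PA ends c) :
    iota₂ c v * elemM c e f a b = elemM c e f a (b * v) := by
  rw [iota₂, Finset.sum_mul, Finset.sum_eq_single_of_mem e (Finset.mem_univ _), mk_mul_mk, one_mul]
  exact fun g _ hg => mk_mul_mk_ne _ _ _ _ hg _ _ _ _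

theorem iota₁_mul_iota₁ (c : PosReal) (u v : PA ends c) :
    iota₁ c u * iota₁ c v = iota₁ c (u * v) := by
  conv_lhs => rw [iota₁.eq_1 c v, Finset.mul_sum]
  simp only [iota₁_mul_mk]
  rfl

theorem resM_mul {R c : PosReal} (hc : c.1 ≤ R.1) (X Y : MA ends R c) : resM ends R c (X * Y) = resM ends R c X * resM ends R c Y := by
  refine ext_apply₂
    (S := (ContinuousLinearMap.compL ℂ (MA ends R c) (MA ends R c) (MA ends c c)
      (resM ends R c)).comp (ContinuousLinearMap.mul ℂ _))
    (T := (ContinuousLinearMap.mul ℂ (MA ends c c)).bilinearComp (resM ends R c) (resM ends R c))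
    (fun x y => ?_) X Y
  change resM ends R c (mon x * mon y) = resM ends R c (mon x) * resM ends R c (mon y)
  rw [resM_mon hc, resM_mon hc, mon_mul_mon, mon_mul_mon]
  cases pmul x y with
  | none => exact map_zero _
  | some q => exact resM_mon hc q

end MatrixUnits

/-! ### Derivations -/

/-- A derivation `D` from `B_R` into a bimodule with actions `ll` and `rr`. -/
structure IsDer {R : PosReal} {X : Type*} [AddCommGroup X] (D : PA ends R → X)
    (ll rr : PA ends R → X →+ X) : Prop where
  vertex : ∀ v, D (PA.pv R v) = 0
  leibniz : ∀ u v, D (u * v) = rr v (D u) + ll u (D v)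
  mul_left : ∀ u v x, ll (u * v) x = ll u (ll v x)

theorem IsDer.word {R : PosReal} {X : Type*} [AddCommGroup X] {D : PA ends R → X}
    {ll rr : PA ends R → X →+ X} (hD : IsDer D ll rr) {y : DEdge ends → PA ends R}
    (hy : IsRep (PA.pv R) y) (γ : GPath ends) :
    D (wordIn (PA.pv R) y γ) = splitSum γ fun a f b =>
      ll (wordIn (PA.pv R) y a) (rr (wordIn (PA.pv R) y b) (D (y f))) := by
  induction γ using GPath.induction with
  | hv v => rw [IsRep.word_vertex, hD.vertex, splitSum_vertex]
  | hc f γ h ih =>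
    -- The action `ll` need not be unital on the bimodule, so the projection at the source is
    -- inserted first; it supplies the empty left factor of the first summand.
    have h1 : D (y f * wordIn (PA.pv R) y γ) =
        ll (PA.pv R f.src) (D (y f * wordIn (PA.pv R) y γ)) := by
      conv_lhs => rw [← hy.left f, mul_assoc, hD.leibniz, hD.vertex, map_zero, zero_add]
    rw [hy.word_cons, h1, hD.leibniz, map_add, ← hD.mul_left, hy.left, splitSum_cons, ih,
      map_splitSum]
    congr 1
    · rw [IsRep.word_vertex]
    · refine splitSum_congr fun a g b h1 _ _ _ _ => ?_
      rw [consD_eq (h.trans h1.symm), hy.word_cons, hD.mul_left]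

/-- The common core of the Leibniz rules of `der` and `jacC`: the distinguished edge of a product
lies in one of the two factors. If the paths cannot be composed, `hr'` and `hl'` make both sides
zero. -/
theorem splitSum_leibniz {X : Type*} [AddCommMonoid X] {a b : GPath ends}
    {F : GPath ends → DEdge ends → GPath ends → X} {l r : X →+ X}
    (hr : ∀ a₁ f a₂ h, F a₁ f (comp a₂ b h) = r (F a₁ f a₂))
    (hl : ∀ b₁ f b₂ h, F (comp a b₁ h) f b₂ = l (F b₁ f b₂))
    (hr' : ∀ a₁ f a₂, a₂.tgt ≠ b.src → r (F a₁ f a₂) = 0)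
    (hl' : ∀ b₁ f b₂, a.tgt ≠ b₁.src → l (F b₁ f b₂) = 0) :
    (pmul a b).elim 0 (fun γ => splitSum γ F) = r (splitSum a F) + l (splitSum b F) := by
  rw [map_splitSum, map_splitSum]
  by_cases h : a.tgt = b.src
  · rw [pmul_of_eq h]
    refine (splitSum_comp a b h F).trans ?_
    congr 1
    · refine splitSum_congr fun a₁ f a₂ _ _ _ h4 _ => ?_
      rw [compD_eq (h4.trans h), hr]
    · refine splitSum_congr fun b₁ f b₂ h1 _ _ _ _ => ?_
      rw [compD_eq (h.trans h1.symm), hl]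
  · rw [pmul_of_ne h, splitSum_eq_zero, splitSum_eq_zero, add_zero]
    · rfl
    · exact fun b₁ f b₂ h1 _ _ _ _ => hl' _ _ _ fun h' => h (h'.trans h1)
    · exact fun a₁ f a₂ _ _ _ h4 _ => hr' _ _ _ fun h' => h (h4.symm.trans h')

/-- The derivation `d_h` with `d_h z_f = h_f`, from `B_R` to `B_r`. -/
def der (R : PosReal) {r : PosReal} (h : DEdge ends → PA ends r) : PA ends R →L[ℂ] PA ends r :=
  lift fun γ => splitSum γ fun a f b => mon a * h f * mon b

section Der

variable {R r : PosReal} (hr : r.1 < R.1)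

include hr

theorem der_bound {h : DEdge ends → PA ends r} {H : ℝ} (hH : ∀ e, ‖h e‖ ≤ H) (h0 : 0 ≤ H)
    (γ : GPath ends) :
    ‖splitSum γ fun a f b => mon a * h f * mon b‖ ≤ H / (R.1 - r.1) * pw ends R γ := by
  have hr0 := r.2
  have hpos : 0 < R.1 - r.1 := sub_pos.2 hr
  have h1 := norm_splitSum_le γ (F := fun a f b => mon a * h f * mon b)
    (B := fun i j => r.1 ^ i * H * r.1 ^ j) (fun a f b _ _ _ => by
      refine (norm_mul_le _ _).trans ?_
      rw [norm_mon, pw_apply]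
      gcongr
      refine (norm_mul_le _ _).trans ?_
      rw [norm_mon, pw_apply]
      gcongr
      exact hH f)
  refine h1.trans ?_
  have h2 : ∀ i ∈ Finset.range γ.len, r.1 ^ i * H * r.1 ^ (γ.len - (i + 1)) =
      H * r.1 ^ (γ.len - 1) := fun i hi => by
    rw [Finset.mem_range] at hi
    rw [mul_comm (r.1 ^ i), mul_assoc, ← pow_add]
    congr 2
    omega
  rw [Finset.sum_congr rfl h2, Finset.sum_const, Finset.card_range, nsmul_eq_mul, pw_apply,
    div_mul_eq_mul_div, le_div_iff₀ hpos]
  have := mul_pow_pred_mul_sub_le hr0.le hr.le γ.len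
  calc _ = H * (γ.len * r.1 ^ (γ.len - 1) * (R.1 - r.1)) := by ring
    _ ≤ _ := by gcongr

variable [Finite E]

theorem der_bdd (h : DEdge ends → PA ends r) :
    Bdd (pw ends R) fun γ => splitSum γ fun a f b => mon a * h f * mon b :=
  ⟨_, der_bound hr (norm_le_pi_norm h) (norm_nonneg h)⟩

theorem der_mon (h : DEdge ends → PA ends r) (γ : GPath ends) :
    der R h (mon γ) = splitSum γ fun a f b => mon a * h f * mon b := lift_mon (der_bdd hr h) γ

theorem norm_der_le (h : DEdge ends → PA ends r) (u : PA ends R) :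
    ‖der R h u‖ ≤ ‖h‖ / (R.1 - r.1) * ‖u‖ :=
  norm_lift_le (der_bound hr (norm_le_pi_norm h) (norm_nonneg h)) u

theorem der_add (h h' : DEdge ends → PA ends r) (u : PA ends R) :
    der R (h + h') u = der R h u + der R h' u :=
  ext_apply (S := der R (h + h')) (T := der R h + der R h') (fun γ => by
    rw [add_apply, der_mon hr, der_mon hr, der_mon hr, ← splitSum_add]
    exact splitSum_congr fun a f b _ _ _ _ _ => by rw [Pi.add_apply, mul_add, add_mul]) u

theorem der_smul (t : ℂ) (h : DEdge ends → PA ends r) (u : PA ends R) :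
    der R (t • h) u = t • der R h u :=
  ext_apply (S := der R (t • h)) (T := t • der R h) (fun γ => by
    rw [smul_apply, der_mon hr, der_mon hr]
    rw [show t • splitSum γ (fun a f b => mon a * h f * mon b) =
      splitSum γ fun a f b => t • (mon a * h f * mon b) from Finset.smul_sum]
    exact splitSum_congr fun a f b _ _ _ _ _ => by
      rw [Pi.smul_apply, mul_smul_comm, smul_mul_assoc]) u

theorem der_mul (h : DEdge ends → PA ends r) (u v : PA ends R) :
    der R h (u * v) = der R h u * res R r v + res R r u * der R h v := by
  refine ext_apply₂
    (S := (ContinuousLinearMap.compL ℂ (PA ends R) (PA ends R) (PA ends r) (der R h)).comp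
      (ContinuousLinearMap.mul ℂ _))
    (T := (ContinuousLinearMap.mul ℂ (PA ends r)).bilinearComp (der R h) (res R r) +
      (ContinuousLinearMap.mul ℂ (PA ends r)).bilinearComp (res R r) (der R h))
    (fun a b => ?_) u v
  change der R h (mon a * mon b) = der R h (mon a) * res R r (mon b) +
    res R r (mon a) * der R h (mon b)
  rw [res_mon hr.le, res_mon hr.le, mon_mul_mon, der_mon hr, der_mon hr]
  have h1 : der R h (omon (pmul a b)) = (pmul a b).elim 0 fun γ =>
      splitSum γ fun a f b => mon a * h f * mon b := by
    cases pmul a b with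
    | none => exact map_zero _
    | some γ => exact der_mon hr h γ
  rw [h1]
  refine splitSum_leibniz (r := AddMonoidHom.mulRight (mon b)) (l := AddMonoidHom.mulLeft (mon a))
    (fun a₁ f a₂ h' => ?_) (fun b₁ f b₂ h' => ?_) (fun a₁ f a₂ h' => ?_) (fun b₁ f b₂ h' => ?_)
  · change mon a₁ * h f * mon (comp a₂ b h') = mon a₁ * h f * mon a₂ * mon b
    rw [← PA.mon_mul_mon_of_eq h', mul_assoc _ (mon a₂)]
  · change mon (comp a b₁ h') * h f * mon b₂ = mon a * (mon b₁ * h f * mon b₂)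
    rw [← PA.mon_mul_mon_of_eq h', mul_assoc, mul_assoc, mul_assoc]
  · change mon a₁ * h f * mon a₂ * mon b = 0
    rw [mul_assoc _ (mon a₂), PA.mon_mul_mon_of_ne h', mul_zero]
  · change mon a * (mon b₁ * h f * mon b₂) = 0
    rw [← mul_assoc, ← mul_assoc, PA.mon_mul_mon_of_ne h', zero_mul, zero_mul]

theorem der_vertex (h : DEdge ends → PA ends r) (v : V) : der R h (PA.pv R v) = 0 := by
  rw [PA.pv, der_mon hr, splitSum_vertex]

theorem der_z (h : DEdge ends → PA ends r) (e : DEdge ends) :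
    der R h (PA.z R e) = PA.pv r e.src * h e * PA.pv r e.tgt := by
  rw [PA.z, der_mon hr, single_eq_cons, splitSum_cons, splitSum_vertex, add_zero]
  rfl

theorem der_isDer (h : DEdge ends → PA ends r) :
    IsDer (der R h) (fun u => AddMonoidHom.mulLeft (res R r u))
      (fun v => AddMonoidHom.mulRight (res R r v)) where
  vertex := der_vertex hr h
  leibniz := der_mul hr h
  mul_left u v x := by
    change res R r (u * v) * x = res R r u * (res R r v * x)
    rw [res_mul hr.le, mul_assoc]

end Der

end Calculus
end
end FreeGraph

namespace FreeGraph
noncomputable section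

open PMon (pmul)
open GPath WL1

/-! ### The Jacobian and its derivative -/

section Jacobian

variable {V E : Type*} {ends : E → Sym2 V}

/-- The row `e` of the Jacobian, as a map from `B_r` into the matrix algebra. -/
def jac' (r R c : PosReal) (e : DEdge ends) : PA ends r →L[ℂ] MA ends R c :=
  lift fun γ => splitSum γ fun a f b => mon ⟨e, f, a, b⟩

theorem norm_jac'_mon_le (R c : PosReal) (e : DEdge ends) (γ : GPath ends) :
    ‖splitSum γ fun a f b => (mon ⟨e, f, a, b⟩ : MA ends R c)‖ ≤
      ∑ i ∈ Finset.range γ.len, (R.1 ^ i * c.1 ^ (γ.len - (i + 1)) +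
        c.1 ^ i * R.1 ^ (γ.len - (i + 1))) :=
  norm_splitSum_le γ (B := fun i j => R.1 ^ i * c.1 ^ j + c.1 ^ i * R.1 ^ j)
    fun a f b _ _ _ => by rw [norm_mon, mw_apply]

/-- With equal radii on both legs every factorization has the weight `2 c ^ (n - 1)`, so the number
`n` of factorizations must be paid for by a larger radius in the source. -/
theorem jac'_bound_self {r c : PosReal} (h : c.1 < r.1) (e : DEdge ends) (γ : GPath ends) :
    ‖splitSum γ fun a f b => (mon ⟨e, f, a, b⟩ : MA ends c c)‖ ≤
      2 / (r.1 - c.1) * pw ends r γ := by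
  have hpos : 0 < r.1 - c.1 := sub_pos.2 h
  refine (norm_jac'_mon_le c c e γ).trans ?_
  have h2 : ∀ i ∈ Finset.range γ.len, c.1 ^ i * c.1 ^ (γ.len - (i + 1)) +
        c.1 ^ i * c.1 ^ (γ.len - (i + 1)) = 2 * c.1 ^ (γ.len - 1) := fun i hi => by
    rw [Finset.mem_range] at hi
    rw [← pow_add, ← two_mul]
    congr 2
    omega
  rw [Finset.sum_congr rfl h2, Finset.sum_const, Finset.card_range, nsmul_eq_mul, pw_apply,
    div_mul_eq_mul_div, le_div_iff₀ hpos]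
  have := mul_pow_pred_mul_sub_le c.2.le h.le γ.len
  linarith

/-- For `c = R / 2` the weights of the factorizations form two geometric series of ratio `1/2`,
whose sum is at most `4 R ^ (n - 1)` whatever the length `n`. Hence the Jacobian loses no radius
here, and the fixed point iteration can stay in the single space `B_R`. -/
theorem jac'_bound_half {R c : PosReal} (h : R.1 = 2 * c.1) (e : DEdge ends) (γ : GPath ends) :
    ‖splitSum γ fun a f b => (mon ⟨e, f, a, b⟩ : MA ends R c)‖ ≤ 4 / R.1 * pw ends R γ := by
  refine (norm_jac'_mon_le R c e γ).trans ?_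
  have hR := R.2
  have hc := c.2
  have hcR : c.1 = R.1 * (1 / 2) := by rw [h]; ring
  rcases Nat.eq_zero_or_pos γ.len with h0 | h0
  · rw [h0, Finset.range_zero, Finset.sum_empty, pw_apply]
    positivity
  obtain ⟨n, hn⟩ : ∃ n, γ.len = n + 1 := ⟨γ.len - 1, by omega⟩
  have h2 : ∀ i ∈ Finset.range (n + 1), R.1 ^ i * c.1 ^ (n + 1 - (i + 1)) +
      c.1 ^ i * R.1 ^ (n + 1 - (i + 1)) = R.1 ^ n * ((1 / 2) ^ (n + 1 - 1 - i) + (1 / 2) ^ i) := by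
    intro i hi
    rw [Finset.mem_range] at hi
    obtain ⟨j, rfl⟩ : ∃ j, n = i + j := ⟨n - i, by omega⟩
    have e1 : i + j + 1 - (i + 1) = j := by omega
    have e2 : i + j + 1 - 1 - i = j := by omega
    rw [e1, e2, hcR, mul_pow, mul_pow, pow_add]
    ring
  rw [hn, Finset.sum_congr rfl h2, ← Finset.mul_sum, Finset.sum_add_distrib,
    Finset.sum_range_reflect (fun i => (1 / 2 : ℝ) ^ i) (n + 1), pw_apply, hn]
  have := sum_geometric_two_le (n + 1)
  calc _ ≤ R.1 ^ n * (2 + 2) := by gcongr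
    _ = _ := by field_simp; ring

/-- The row `e` of the Jacobian, from `B_R` into the matrix algebra of the same radius. -/
abbrev jacR (R c : PosReal) (e : DEdge ends) : PA ends R →L[ℂ] MA ends R c := jac' R R c e

/-- The row `e` of the Jacobian, from `B_r` into the matrix algebra of radius `c < r`. -/
abbrev jacC (r c : PosReal) (e : DEdge ends) : PA ends r →L[ℂ] MA ends c c := jac' r c c e

theorem jacR_mon {R c : PosReal} (h : R.1 = 2 * c.1) (e : DEdge ends) (γ : GPath ends) :
    jacR R c e (mon γ) = splitSum γ fun a f b => mon ⟨e, f, a, b⟩ :=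
  lift_mon ⟨_, jac'_bound_half h e⟩ γ

theorem norm_jacR_le {R c : PosReal} (h : R.1 = 2 * c.1) (e : DEdge ends) (u : PA ends R) :
    ‖jacR R c e u‖ ≤ 4 / R.1 * ‖u‖ := norm_lift_le (jac'_bound_half h e) u

theorem jacC_mon {r c : PosReal} (h : c.1 < r.1) (e : DEdge ends) (γ : GPath ends) :
    jacC r c e (mon γ) = splitSum γ fun a f b => elemM c e f (mon a) (mon b) := by
  rw [jacC, jac', lift_mon ⟨_, jac'_bound_self h e⟩]
  simp only [mk_mon]

theorem norm_mk_le (c : PosReal) (e f : DEdge ends) (u v : PA ends c) :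
    ‖elemM c e f u v‖ ≤ 2 * ‖u‖ * ‖v‖ := by
  have h1 : ‖elemM c e f u‖ ≤ 2 * ‖u‖ := norm_lift_le (norm_mk_mon c e f) u
  exact (ContinuousLinearMap.le_opNorm _ _).trans (by gcongr)

variable [Fintype V]

theorem jacC_res {R r c : PosReal} (h : R.1 = 2 * c.1) (hc : c.1 < r.1) (hr : r.1 < R.1)
    (e : DEdge ends) (u : PA ends R) :
    jacC r c e (res R r u) = resM ends R c (jacR R c e u) :=
  ext_apply (S := (jacC r c e).comp (res R r)) (T := (resM ends R c).comp (jacR R c e)) (fun γ => by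
    change jacC r c e (res R r (mon γ)) = resM ends R c (jacR R c e (mon γ))
    rw [res_mon hr.le, jacC_mon hc, jacR_mon h, map_splitSum]
    exact splitSum_congr fun a f b _ _ _ _ _ => by
      rw [mk_mon, resM_mon (hc.trans hr).le]) u

variable [Finite E]

section C

variable {r c : PosReal} (hc : c.1 < r.1)

include hc

theorem jacC_mul (e : DEdge ends) (u v : PA ends r) :
    jacC r c e (u * v) = iota₂ c (res r c v) * jacC r c e u +
      iota₁ c (res r c u) * jacC r c e v := by
  have hι₁ : ∀ u : PA ends c, iota₁ c u = (∑ f, (elemM c f f).flip 1) u := fun u => by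
    rw [iota₁, sum_apply]; rfl
  have hι₂ : ∀ u : PA ends c, iota₂ c u = (∑ f, elemM c f f 1) u := fun u => by
    rw [iota₂, sum_apply]
  rw [hι₁, hι₂]
  refine ext_apply₂
    (S := (ContinuousLinearMap.compL ℂ (PA ends r) (PA ends r) (MA ends c c) (jacC r c e)).comp
      (ContinuousLinearMap.mul ℂ _))
    (T := (ContinuousLinearMap.mul ℂ (MA ends c c)).flip.bilinearComp (jacC r c e)
        ((∑ f, elemM c f f 1).comp (res r c)) +
      (ContinuousLinearMap.mul ℂ (MA ends c c)).bilinearComp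
        ((∑ f, (elemM c f f).flip 1).comp (res r c)) (jacC r c e))
    (fun a b => ?_) u v
  change jacC r c e (mon a * mon b) = (∑ f, elemM c f f 1) (res r c (mon b)) * jacC r c e (mon a) +
    (∑ f, (elemM c f f).flip 1) (res r c (mon a)) * jacC r c e (mon b)
  rw [← hι₁, ← hι₂, res_mon hc.le, res_mon hc.le, mon_mul_mon, jacC_mon hc, jacC_mon hc]
  have h1 : jacC r c e (omon (pmul a b)) = (pmul a b).elim 0 fun γ =>
      splitSum γ fun a f b => elemM c e f (mon a) (mon b) := by
    cases pmul a b with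
    | none => exact map_zero _
    | some γ => exact jacC_mon hc e γ
  rw [h1]
  refine splitSum_leibniz (r := AddMonoidHom.mulLeft (iota₂ c (mon b)))
    (l := AddMonoidHom.mulLeft (iota₁ c (mon a)))
    (fun a₁ f a₂ h' => ?_) (fun b₁ f b₂ h' => ?_) (fun a₁ f a₂ h' => ?_) (fun b₁ f b₂ h' => ?_)
  · change _ = iota₂ c (mon b) * elemM c e f (mon a₁) (mon a₂)
    rw [iota₂_mul_mk, PA.mon_mul_mon_of_eq h']
  · change _ = iota₁ c (mon a) * elemM c e f (mon b₁) (mon b₂)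
    rw [iota₁_mul_mk, PA.mon_mul_mon_of_eq h']
  · change iota₂ c (mon b) * elemM c e f (mon a₁) (mon a₂) = 0
    rw [iota₂_mul_mk, PA.mon_mul_mon_of_ne h', map_zero]
  · change iota₁ c (mon a) * elemM c e f (mon b₁) (mon b₂) = 0
    rw [iota₁_mul_mk, PA.mon_mul_mon_of_ne h', map_zero]
    rfl

theorem jacC_vertex (e : DEdge ends) (v : V) : jacC r c e (PA.pv r v) = 0 := by
  rw [PA.pv, jacC_mon hc, splitSum_vertex]

theorem jacC_z (e f : DEdge ends) :
    jacC r c e (PA.z r f) = elemM c e f (PA.pv c f.src) (PA.pv c f.tgt) := by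
  rw [PA.z, jacC_mon hc, single_eq_cons, splitSum_cons, splitSum_vertex, add_zero]
  rfl

theorem jacC_isDer (e : DEdge ends) :
    IsDer (jacC r c e) (fun u => AddMonoidHom.mulLeft (iota₁ c (res r c u)))
      (fun v => AddMonoidHom.mulLeft (iota₂ c (res r c v))) where
  vertex := jacC_vertex hc e
  leibniz := jacC_mul hc e
  mul_left u v x := by
    change iota₁ c (res r c (u * v)) * x = iota₁ c (res r c u) * (iota₁ c (res r c v) * x)
    rw [res_mul hc.le, ← mul_assoc, iota₁_mul_iota₁]

theorem mk_one_mul_jacC (e f : DEdge ends) (u : PA ends r) :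
    elemM c e f 1 1 * jacC r c f u = jacC r c e u :=
  ext_apply (S := (ContinuousLinearMap.mul ℂ _ (elemM c e f 1 1)).comp (jacC r c f))
    (T := jacC r c e) (fun γ => by
      change elemM c e f 1 1 * jacC r c f (mon γ) = _
      rw [jacC_mon hc, jacC_mon hc, mul_splitSum]
      exact splitSum_congr fun a g b _ _ _ _ _ => by rw [mk_mul_mk, one_mul, mul_one]) u

theorem mk_one_mul_jacC_ne (e f : DEdge ends) {f' : DEdge ends} (hf : f ≠ f') (u : PA ends r) :
    elemM c e f 1 1 * jacC r c f' u = 0 :=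
  ext_apply (S := (ContinuousLinearMap.mul ℂ _ (elemM c e f 1 1)).comp (jacC r c f'))
    (T := 0) (fun γ => by
      change elemM c e f 1 1 * jacC r c f' (mon γ) = 0
      rw [jacC_mon hc, mul_splitSum]
      exact splitSum_eq_zero fun a g b _ _ _ _ _ => mk_mul_mk_ne _ _ _ _ hf _ _ _ _) u

end C

/-- The Jacobian of a tuple. -/
def jacT (r c : PosReal) (h : DEdge ends → PA ends r) : MA ends c c := ∑ e, jacC r c e (h e)

/-- The Jacobian of a tuple, in the matrix algebra of the same radius. -/
def jacM (R c : PosReal) (f : DEdge ends → PA ends R) : MA ends R c := ∑ e, jacR R c e (f e)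

/-- A matrix unit on the left extracts row `f` and moves it to row `e`. In this form the Jacobian of
a letter `z_f + f_f` acquires the right factor `1 + 𝒥f`. -/
theorem jacC_eq_mk_mul_jacT {r c : PosReal} (hc : c.1 < r.1) (e f : DEdge ends)
    (h : DEdge ends → PA ends r) : jacC r c e (h f) = elemM c e f 1 1 * jacT r c h := by
  rw [jacT, Finset.mul_sum, Finset.sum_eq_single_of_mem f (Finset.mem_univ _), mk_one_mul_jacC hc]
  exact fun g _ hg => mk_one_mul_jacC_ne hc _ _ hg.symm _

theorem resM_jacM {R r c : PosReal} (h : R.1 = 2 * c.1) (hc : c.1 < r.1) (hr : r.1 < R.1)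
    (f : DEdge ends → PA ends R) : resM ends R c (jacM R c f) = jacT r c fun e => res R r (f e) := by
  rw [jacM, jacT, map_sum]
  exact Finset.sum_congr rfl fun e _ => (jacC_res h hc hr e _).symm

/-- The chain rule for the Jacobian. -/
theorem jacC_word {r c : PosReal} (hc : c.1 < r.1) {f : DEdge ends → PA ends r}
    (hy : IsRep (PA.pv r) fun e => PA.z r e + f e) (e : DEdge ends) (γ : GPath ends) :
    jacC r c e (wordIn (PA.pv r) (fun e => PA.z r e + f e) γ) =
      (splitSum γ fun a g b =>
        elemM c e g (res r c (wordIn (PA.pv r) (fun e => PA.z r e + f e) a))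
          (res r c (wordIn (PA.pv r) (fun e => PA.z r e + f e) b))) * (1 + jacT r c f) := by
  rw [(jacC_isDer hc e).word hy, splitSum_mul]
  refine splitSum_congr fun a g b _ h2 h3 _ _ => ?_
  set A := wordIn (PA.pv r) (fun e => PA.z r e + f e) a with hA
  set B := wordIn (PA.pv r) (fun e => PA.z r e + f e) b with hB
  -- The projections in `∂_g z_g = p_{s(g)} ⊗ p_{t(g)}` are absorbed by the neighbouring words.
  have h4 : A * PA.pv r g.src = A := by rw [← h2]; exact hy.word_mul_tgt a
  have h5 : PA.pv r g.tgt * B = B := by rw [h3]; exact hy.src_mul_word b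
  have h6 : ∀ v, PA.pv c v = res r c (PA.pv r v : PA ends r) := fun v => (res_mon hc.le _).symm
  change iota₁ c (res r c A) * (iota₂ c (res r c B) * jacC r c e (PA.z r g + f g)) = _
  rw [map_add, jacC_z hc, jacC_eq_mk_mul_jacT hc, mul_add, mul_add, iota₂_mul_mk, iota₁_mul_mk,
    ← mul_assoc (iota₂ c _), iota₂_mul_mk, ← mul_assoc, iota₁_mul_mk, mul_one, one_mul, h6, h6,
    ← res_mul hc.le, ← res_mul hc.le, h4, h5, mul_add, mul_one]

/-! ### The derivative of a matrix -/

theorem res_der {R r c : PosReal} (hc : c.1 < r.1) (hr : r.1 < R.1) (h : DEdge ends → PA ends r)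
    (u : PA ends R) : res r c (der R h u) = der R (fun e => res r c (h e)) u :=
  ext_apply (S := (res r c).comp (der R h)) (T := der R fun e => res r c (h e)) (fun γ => by
    change res r c (der R h (mon γ)) = _
    rw [der_mon hr, der_mon (hc.trans hr), map_splitSum]
    exact splitSum_congr fun a f b _ _ _ _ _ => by
      rw [res_mul hc.le, res_mul hc.le, res_mon hc.le, res_mon hc.le]) u

/-- The derivation `d_h ⊗ 1 + 1 ⊗ d_h` on matrices. -/
def derM (R c : PosReal) (h : DEdge ends → PA ends c) : MA ends R c →L[ℂ] MA ends c c :=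
  lift fun x => elemM c x.row x.col (der R h (mon x.fst)) (mon x.snd) +
    elemM c x.row x.col (mon x.fst) (der R h (mon x.snd))

section DerM

variable {R c : PosReal} (hc : c.1 < R.1) (h : DEdge ends → PA ends c)

include hc

theorem derM_bound (x : MIdx ends) :
    ‖elemM c x.row x.col (der R h (mon x.fst)) (mon x.snd) +
      elemM c x.row x.col (mon x.fst) (der R h (mon x.snd))‖ ≤
      2 * (‖h‖ / (R.1 - c.1)) * mw ends R c x := by
  have h1 := norm_der_le hc h (mon x.fst)
  have h2 := norm_der_le hc h (mon x.snd)
  rw [norm_mon, pw_apply] at h1 h2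
  have := c.2
  refine (norm_add_le _ _).trans ((add_le_add (norm_mk_le _ _ _ _ _)
    (norm_mk_le _ _ _ _ _)).trans ?_)
  rw [norm_mon, norm_mon, pw_apply, pw_apply, mw_apply]
  calc _ ≤ 2 * (‖h‖ / (R.1 - c.1) * R.1 ^ x.fst.len) * c.1 ^ x.snd.len +
        2 * c.1 ^ x.fst.len * (‖h‖ / (R.1 - c.1) * R.1 ^ x.snd.len) := by gcongr
    _ = _ := by ring

theorem derM_mon (x : MIdx ends) : derM R c h (mon x) =
    elemM c x.row x.col (der R h (mon x.fst)) (mon x.snd) +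
      elemM c x.row x.col (mon x.fst) (der R h (mon x.snd)) :=
  lift_mon ⟨_, derM_bound hc h⟩ x

theorem derM_mul (X Y : MA ends R c) : derM R c h (X * Y) =
    derM R c h X * resM ends R c Y + resM ends R c X * derM R c h Y := by
  refine ext_apply₂
    (S := (ContinuousLinearMap.compL ℂ (MA ends R c) (MA ends R c) (MA ends c c)
      (derM R c h)).comp (ContinuousLinearMap.mul ℂ _))
    (T := (ContinuousLinearMap.mul ℂ (MA ends c c)).bilinearComp (derM R c h) (resM ends R c) +
      (ContinuousLinearMap.mul ℂ (MA ends c c)).bilinearComp (resM ends R c) (derM R c h))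
    (fun x y => ?_) X Y
  change derM R c h (mon x * mon y) = derM R c h (mon x) * resM ends R c (mon y) +
    resM ends R c (mon x) * derM R c h (mon y)
  rw [resM_mon hc.le, resM_mon hc.le, derM_mon hc, derM_mon hc, mon_mul_mon]
  obtain ⟨e, f, a, b⟩ := x
  obtain ⟨f', g, a', b'⟩ := y
  simp only [← mk_mon]
  by_cases hf : f = f'
  · subst hf
    have h3 : derM R c h (omon (pmul ⟨e, f, a, b⟩ ⟨f, g, a', b'⟩)) =
        elemM c e g (der R h (mon a * mon a')) (mon b' * mon b) +
          elemM c e g (mon a * mon a') (der R h (mon b' * mon b)) := by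
      by_cases ha : a.tgt = a'.src
      · by_cases hb : b'.tgt = b.src
        · rw [MIdx.pmul_of rfl ha hb, omon_some, derM_mon hc, PA.mon_mul_mon_of_eq ha,
            PA.mon_mul_mon_of_eq hb, PA.mon_mul_mon_of_eq ha, PA.mon_mul_mon_of_eq hb]
        · rw [MIdx.pmul_of_not (fun h => hb h.2.2), PA.mon_mul_mon_of_ne hb,
            PA.mon_mul_mon_of_ne hb, omon_none, map_zero, map_zero, map_zero, map_zero, add_zero]
      · rw [MIdx.pmul_of_not (fun h => ha h.2.1), PA.mon_mul_mon_of_ne ha,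
          PA.mon_mul_mon_of_ne ha, omon_none, map_zero, map_zero, map_zero]
        simp
    rw [h3, der_mul hc, der_mul hc, res_mon hc.le, res_mon hc.le, res_mon hc.le, res_mon hc.le,
      add_mul, mul_add, mk_mul_mk, mk_mul_mk, mk_mul_mk, mk_mul_mk]
    simp only [map_add, add_apply]
    abel
  · rw [MIdx.pmul_of_not (fun h => hf h.1), omon_none, map_zero, add_mul, mul_add,
      mk_mul_mk_ne _ _ _ _ hf, mk_mul_mk_ne _ _ _ _ hf, mk_mul_mk_ne _ _ _ _ hf,
      mk_mul_mk_ne _ _ _ _ hf]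
    simp

end DerM

/-- The derivative of the Jacobian of `d_h u`: second derivatives commute. -/
theorem jacC_der {R r c : PosReal} (h2 : R.1 = 2 * c.1) (hc : c.1 < r.1) (hr : r.1 < R.1)
    (h : DEdge ends → PA ends r) (e : DEdge ends) (u : PA ends R) :
    jacC r c e (der R h u) = resM ends R c (jacR R c e u) * jacT r c h +
      derM R c (fun e => res r c (h e)) (jacR R c e u) := by
  have hcR := hc.trans hr
  refine ext_apply (S := (jacC r c e).comp (der R h))
    (T := ((ContinuousLinearMap.mul ℂ _).flip (jacT r c h)).comp
        ((resM ends R c).comp (jacR R c e)) +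
      (derM R c fun e => res r c (h e)).comp (jacR R c e)) (fun γ => ?_) u
  change jacC r c e (der R h (mon γ)) = resM ends R c (jacR R c e (mon γ)) * jacT r c h +
    derM R c (fun e => res r c (h e)) (jacR R c e (mon γ))
  -- An edge `f` of `γ` is replaced by `h f`; the Jacobian then acts on the left of it, on `h f`
  -- itself, or on the right of it.
  have e1 : jacC r c e (der R h (mon γ)) =
      splitSum γ (fun a f b => splitSum a fun a₁ f₁ a₂ =>
        elemM c e f₁ (mon a₁) (mon a₂ * res r c (h f) * mon b)) +
      (splitSum γ (fun a f b => elemM c e f (mon a) (mon b)) * jacT r c h +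
      splitSum γ (fun a f b => splitSum b fun b₁ f₁ b₂ =>
        elemM c e f₁ (mon a * res r c (h f) * mon b₁) (mon b₂))) := by
    rw [der_mon hr, map_splitSum, splitSum_mul, ← splitSum_add, ← splitSum_add]
    refine splitSum_congr fun a f b _ _ _ _ _ => ?_
    rw [jacC_mul hc, jacC_mul hc, res_mul hc.le, res_mon hc.le, res_mon hc.le, jacC_mon hc,
      jacC_mon hc, mul_add, add_assoc, mul_splitSum, mul_splitSum, mul_splitSum]
    congr 1
    · exact splitSum_congr fun a₁ f₁ a₂ _ _ _ _ _ => by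
        rw [iota₂_mul_mk, iota₂_mul_mk]
    · congr 1
      · rw [jacC_eq_mk_mul_jacT hc, ← mul_assoc (iota₁ c _), iota₁_mul_mk, ← mul_assoc,
          iota₂_mul_mk, mul_one, one_mul]
      · exact splitSum_congr fun b₁ f₁ b₂ _ _ _ _ _ => by rw [iota₁_mul_mk]
  -- Here the Jacobian chooses its edge first and `d_h` acts on one of the two legs;
  -- `splitSum_splitSum` matches these terms with the outer two of `e1`.
  have e2 : derM R c (fun e => res r c (h e)) (jacR R c e (mon γ)) =
      splitSum γ (fun a f b => splitSum a fun a₁ f₁ a₂ =>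
        elemM c e f (mon a₁ * res r c (h f₁) * mon a₂) (mon b)) +
      splitSum γ (fun a f b => splitSum b fun b₁ f₁ b₂ =>
        elemM c e f (mon a) (mon b₁ * res r c (h f₁) * mon b₂)) := by
    rw [jacR_mon h2, map_splitSum, ← splitSum_add]
    refine splitSum_congr fun a f b _ _ _ _ _ => ?_
    rw [derM_mon hcR, der_mon hcR, der_mon hcR]
    change (elemM c e f).flip (mon b) (splitSum a _) + elemM c e f (mon a) (splitSum b _) = _
    rw [map_splitSum, map_splitSum]
    rfl
  rw [e1, e2, ← jacC_res h2 hc hr, res_mon hr.le, jacC_mon hc, splitSum_splitSum,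
    ← splitSum_splitSum γ fun a f b f₁ b₂ => elemM c e f₁ (mon a * res r c (h f) * mon b) (mon b₂)]
  abel

end Jacobian
end
end FreeGraph

namespace FreeGraph
noncomputable section

open PMon (pmul)
open GPath WL1

/-! ### Tracial laws that satisfy the quadratic Schwinger–Dyson equation -/

section PathLaw

variable {V E : Type*} {ends : E → Sym2 V} [Fintype V]

open Classical in
/-- A tracial functional on `B_c` with the Schwinger–Dyson equation of the quadratic potential. -/
structure PathLaw (wt : DEdge ends → ℝ) (c : PosReal) (φ : PA ends c →L[ℂ] ℂ) : Prop where
  bound : ∀ γ, ‖φ (mon γ)‖ ≤ c.1 ^ γ.len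
  tracial : ∀ u v, φ (u * v) = φ (v * u)
  wt_op : ∀ e, wt e.op = wt e
  sd : ∀ e γ, (wt e : ℂ) * φ (PA.z c e.op * mon γ) =
    splitSum γ fun a f b => if f = e then φ (mon a) * φ (mon b) else 0

open Classical in
/-- The functional `(φ ⊗ φ) ∘ Tr`. -/
def trM {c : PosReal} (φ : PA ends c →L[ℂ] ℂ) : MA ends c c →L[ℂ] ℂ :=
  lift fun x => if x.row = x.col then φ (mon x.fst) * φ (mon x.snd) else 0

open Classical in
/-- The map `(id ⊗ φ + φ ⊗ id) ∘ Tr`. -/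
def ptr {R c : PosReal} (φ : PA ends c →L[ℂ] ℂ) : MA ends R c →L[ℂ] PA ends R :=
  lift fun x => if x.row = x.col then φ (mon x.snd) • mon x.fst + φ (mon x.fst) • mon x.snd else 0

/-- The quadratic potential. -/
def quad [Finite E] (wt : DEdge ends → ℝ) (R : PosReal) : PA ends R :=
  ∑ e, ((1 / 2 * wt e : ℝ) : ℂ) • (PA.z R e.op * PA.z R e)

theorem sum_comp_op [Finite E] {X : Type*} [AddCommMonoid X] (F : DEdge ends → X) :
    ∑ e : DEdge ends, F e.op = ∑ e, F e :=
  Equiv.sum_comp (Function.Involutive.toPerm DEdge.op DEdge.op_op) F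

namespace PathLaw

variable {wt : DEdge ends → ℝ} {R r c : PosReal} {φ : PA ends c →L[ℂ] ℂ} (hφ : PathLaw wt c φ)

include hφ

open Classical in
theorem trM_bound (x : MIdx ends) :
    ‖if x.row = x.col then φ (mon x.fst) * φ (mon x.snd) else 0‖ ≤ 1 * mw ends c c x := by
  have h0 := c.2
  rw [mw_self_apply]
  split_ifs
  · rw [norm_mul]
    have := mul_le_mul (hφ.bound x.fst) (hφ.bound x.snd) (norm_nonneg _) (by positivity)
    have h1 : 0 ≤ c.1 ^ x.fst.len * c.1 ^ x.snd.len := by positivity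
    linarith
  · rw [norm_zero]; positivity

open Classical in
theorem trM_mon (x : MIdx ends) :
    trM φ (mon x) = if x.row = x.col then φ (mon x.fst) * φ (mon x.snd) else 0 :=
  lift_mon ⟨1, hφ.trM_bound⟩ x

open Classical in
theorem trM_mk (e f : DEdge ends) (u v : PA ends c) :
    trM φ (elemM c e f u v) = if e = f then φ u * φ v else 0 := by
  by_cases h : e = f
  · rw [if_pos h]
    refine ext_apply₂ (S := (ContinuousLinearMap.compL ℂ (PA ends c) (MA ends c c) ℂ (trM φ)).comp
        (elemM c e f))
      (T := (ContinuousLinearMap.mul ℂ ℂ).bilinearComp φ φ) (fun a b => ?_) u v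
    change trM φ (elemM c e f (mon a) (mon b)) = φ (mon a) * φ (mon b)
    rw [mk_mon, hφ.trM_mon, if_pos h]
  · rw [if_neg h]
    refine ext_apply₂ (S := (ContinuousLinearMap.compL ℂ (PA ends c) (MA ends c c) ℂ (trM φ)).comp
        (elemM c e f)) (T := 0) (fun a b => ?_) u v
    change trM φ (elemM c e f (mon a) (mon b)) = 0
    rw [mk_mon, hφ.trM_mon, if_neg h]

-- The two summands of the partial trace have norms at most `R ^ |a| c ^ |b|` and `c ^ |a| R ^ |b|`,
-- which is where the weight `mw` comes from: the partial trace lands in radius `R` with norm at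
-- most one.
open Classical in
theorem ptr_bound (x : MIdx ends) :
    ‖(if x.row = x.col then φ (mon x.snd) • mon x.fst + φ (mon x.fst) • mon x.snd else 0 :
      PA ends R)‖ ≤ 1 * mw ends R c x := by
  have h0 := c.2
  have h1 := R.2
  rw [one_mul]
  split_ifs
  · refine (norm_add_le _ _).trans ?_
    rw [norm_smul, norm_smul, norm_mon, norm_mon, pw_apply, pw_apply, mw_apply, mul_comm]
    gcongr
    · exact hφ.bound _
    · exact hφ.bound _
  · rw [norm_zero]; exact ((mw ends R c).pos x).le

open Classical in
theorem ptr_mon (x : MIdx ends) : (ptr φ (mon x : MA ends R c) : PA ends R) =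
    if x.row = x.col then φ (mon x.snd) • mon x.fst + φ (mon x.fst) • mon x.snd else 0 :=
  lift_mon ⟨1, hφ.ptr_bound⟩ x

theorem norm_ptr_le (X : MA ends R c) : ‖(ptr φ X : PA ends R)‖ ≤ ‖X‖ :=
  (norm_lift_le (hφ.ptr_bound) X).trans_eq (one_mul _)

variable [Finite E]

/-- Cyclicity of the matrix trace combined with traciality of `φ` on each leg; the opposite product
on the second leg does no harm. -/
theorem trM_mul_comm (X Y : MA ends c c) : trM φ (X * Y) = trM φ (Y * X) := by
  refine ext_apply₂ (S := (ContinuousLinearMap.compL ℂ (MA ends c c) (MA ends c c) ℂ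
      (trM φ)).comp (ContinuousLinearMap.mul ℂ _))
    (T := (ContinuousLinearMap.compL ℂ (MA ends c c) (MA ends c c) ℂ
      (trM φ)).comp (ContinuousLinearMap.mul ℂ _).flip) (fun x y => ?_) X Y
  change trM φ (mon x * mon y) = trM φ (mon y * mon x)
  obtain ⟨e, f, a, b⟩ := x
  obtain ⟨f', g, a', b'⟩ := y
  simp only [← mk_mon]
  by_cases h1 : f = f' <;> by_cases h2 : g = e
  · subst h1 h2
    rw [mk_mul_mk, mk_mul_mk, hφ.trM_mk, hφ.trM_mk, if_pos rfl, if_pos rfl,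
      hφ.tracial (mon a), hφ.tracial (mon b)]
  · subst h1
    rw [mk_mul_mk, mk_mul_mk_ne _ _ _ _ h2, hφ.trM_mk, if_neg (Ne.symm h2), map_zero]
  · subst h2
    rw [mk_mul_mk, mk_mul_mk_ne _ _ _ _ h1, hφ.trM_mk, if_neg (Ne.symm h1), map_zero]
  · rw [mk_mul_mk_ne _ _ _ _ h1, mk_mul_mk_ne _ _ _ _ h2]

/-- The partial trace leaves each leg free once; `d_h` acts on the free leg and `φ` evaluates both,
which is `φ ⊗ φ` after `d_h ⊗ 1 + 1 ⊗ d_h`. -/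
theorem phi_der_ptr (hc : c.1 < R.1) (h : DEdge ends → PA ends c) (X : MA ends R c) :
    φ (der R h (ptr φ X)) = trM φ (derM R c h X) := by
  classical
  refine ext_apply (S := φ.comp ((der R h).comp (ptr φ))) (T := (trM φ).comp (derM R c h))
    (fun x => ?_) X
  change φ (der R h (ptr φ (mon x))) = trM φ (derM R c h (mon x))
  rw [hφ.ptr_mon, derM_mon hc, map_add, hφ.trM_mk, hφ.trM_mk]
  split_ifs
  · simp only [map_add, map_smul, smul_eq_mul]
    ring
  · simp

theorem trM_jacC (hc : c.1 < r.1) (e : DEdge ends) (u : PA ends r) :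
    trM φ (jacC r c e u) = wt e * φ (PA.z c e.op * res r c u) := by
  classical
  refine ext_apply (S := (trM φ).comp (jacC r c e))
    (T := (wt e : ℂ) • φ.comp ((ContinuousLinearMap.mul ℂ _ (PA.z c e.op)).comp (res r c)))
    (fun γ => ?_) u
  change trM φ (jacC r c e (mon γ)) = wt e * φ (PA.z c e.op * res r c (mon γ))
  rw [res_mon hc.le, hφ.sd, jacC_mon hc, map_splitSum]
  exact splitSum_congr fun a f b _ _ _ _ _ => by rw [hφ.trM_mk]; simp only [eq_comm]

/-- Under `φ` the two letters of `z_{e^op} z_e` contribute equally after reindexing by `op`, which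
cancels the factor `1/2`. -/
theorem phi_der_quad (hc : c.1 < R.1) (h : DEdge ends → PA ends c) :
    φ (der R h (quad wt R)) = ∑ e, wt e * φ (PA.z c e.op * h e) := by
  have hz : ∀ e : DEdge ends, res R c (PA.z R e) = PA.z c e := fun e => res_mon hc.le _
  have h1 : ∀ e : DEdge ends, φ (PA.z c e.op * (PA.pv c e.src * h e * PA.pv c e.tgt)) =
      φ (PA.z c e.op * h e) := fun e => by
    have h3 := (PA.isRep (ends := ends) c).left e.op
    have h4 := (PA.isRep (ends := ends) c).right e.op
    rw [DEdge.src_op] at h3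
    rw [DEdge.tgt_op] at h4
    rw [← mul_assoc, hφ.tracial, ← mul_assoc, ← mul_assoc, h3, h4]
  have h2 : ∀ e : DEdge ends, φ (der R h (((1 / 2 * wt e : ℝ) : ℂ) • (PA.z R e.op * PA.z R e))) =
      (1 / 2 * wt e.op : ℂ) * φ (PA.z c e.op.op * h e.op) +
        (1 / 2 * wt e : ℂ) * φ (PA.z c e.op * h e) := fun e => by
    rw [map_smul, map_smul, der_mul hc, hz, hz, der_z hc, der_z hc, map_add, hφ.tracial,
      ← DEdge.op_op e]
    rw [DEdge.op_op e.op, h1 e.op, DEdge.op_op, h1 e, hφ.wt_op, smul_eq_mul]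
    push_cast
    ring
  rw [quad, map_sum, map_sum, Finset.sum_congr rfl fun e _ => h2 e, Finset.sum_add_distrib,
    sum_comp_op fun e => (1 / 2 * wt e : ℂ) * φ (PA.z c e.op * h e), ← Finset.sum_add_distrib]
  exact Finset.sum_congr rfl fun e _ => by ring

/-- The Schwinger–Dyson equation of `V_μ` in variational form, tested on a whole vector `h` of power
series. -/
theorem trM_jacT (hc : c.1 < r.1) (hr : r.1 < R.1) (h : DEdge ends → PA ends r) :
    trM φ (jacT r c h) = φ (der R (fun e => res r c (h e)) (quad wt R)) := by
  rw [hφ.phi_der_quad (hc.trans hr), jacT, map_sum]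
  exact Finset.sum_congr rfl fun e _ => hφ.trM_jacC hc e _

end PathLaw

/-! ### The logarithm -/

section Log

variable {A : Type*} [NormedRing A]

theorem norm_pow_sub_pow_le {M N : A} {m : ℝ} (hM : ‖M‖ ≤ m) (hN : ‖N‖ ≤ m) (k : ℕ) :
    ‖M ^ (k + 1) - N ^ (k + 1)‖ ≤ (k + 1) * m ^ k * ‖M - N‖ := by
  induction k with
  | zero => simp
  | succ k ih =>
    have h1 : M ^ (k + 2) - N ^ (k + 2) = (M ^ (k + 1) - N ^ (k + 1)) * M + N ^ (k + 1) * (M - N) := by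
      rw [pow_succ M, pow_succ N]; noncomm_ring
    have hm : 0 ≤ m := (norm_nonneg _).trans hM
    have h2 : ‖N ^ (k + 1)‖ ≤ m ^ (k + 1) :=
      (norm_pow_le' N (Nat.succ_pos k)).trans (by gcongr)
    rw [h1]
    refine (norm_add_le _ _).trans ?_
    calc _ ≤ (k + 1) * m ^ k * ‖M - N‖ * m + m ^ (k + 1) * ‖M - N‖ := by
          gcongr
          · exact (norm_mul_le _ _).trans (by gcongr)
          · exact (norm_mul_le _ _).trans (by gcongr)
      _ = _ := by push_cast; ring

theorem norm_log_term_le [NormedAlgebra ℂ A] (M : A) (k : ℕ) :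
    ‖((-1) ^ k / (k + 1) : ℂ) • M ^ (k + 1)‖ ≤ ‖M‖ * ‖M‖ ^ k := by
  rw [norm_smul, norm_div, norm_pow, norm_neg, norm_one, one_pow]
  have h1 : ‖(k + 1 : ℂ)‖ = k + 1 := by
    rw [← Nat.cast_succ, Complex.norm_natCast, Nat.cast_succ]
  rw [h1]
  have h2 : (1 : ℝ) / (k + 1) ≤ 1 := by
    rw [div_le_one (by positivity)]; linarith [Nat.cast_nonneg (α := ℝ) k]
  calc _ ≤ 1 * ‖M‖ ^ (k + 1) := by
        gcongr
        exact norm_pow_le' M (Nat.succ_pos k)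
    _ = _ := by rw [one_mul, pow_succ']

/-- The inverse of `1 + M`. -/
def invOne (M : A) : A := ∑' k : ℕ, (-M) ^ k

variable [CompleteSpace A]

theorem hasSum_invOne {M : A} (hM : ‖M‖ < 1) : HasSum (fun k : ℕ => (-M) ^ k) (invOne M) :=
  (summable_geometric_of_norm_lt_one (by rwa [norm_neg])).hasSum

theorem one_add_mul_invOne {M : A} (hM : ‖M‖ < 1) : (1 + M) * invOne M = 1 := by
  have := mul_neg_geom_series (-M) (by rwa [norm_neg])
  rwa [sub_neg_eq_add] at this

theorem invOne_mul_one_add {M : A} (hM : ‖M‖ < 1) : invOne M * (1 + M) = 1 := by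
  have := geom_series_mul_neg (-M) (by rwa [norm_neg])
  rwa [sub_neg_eq_add] at this

variable [NormedAlgebra ℂ A]

/-- The logarithm of `1 + M`. -/
def logOne (M : A) : A := ∑' k : ℕ, ((-1) ^ k / (k + 1) : ℂ) • M ^ (k + 1)

theorem hasSum_logOne {M : A} (hM : ‖M‖ < 1) :
    HasSum (fun k : ℕ => ((-1) ^ k / (k + 1) : ℂ) • M ^ (k + 1)) (logOne M) :=
  (Summable.of_norm_bounded ((summable_geometric_of_lt_one (norm_nonneg M) hM).mul_left ‖M‖)
    (norm_log_term_le M)).hasSum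

/-- The factor `k + 1` from the difference of powers cancels the coefficient `1 / (k + 1)`, so a
geometric series remains. -/
theorem norm_logOne_sub_le {M N : A} {m : ℝ} (hM : ‖M‖ ≤ m) (hN : ‖N‖ ≤ m) (hm : m < 1) :
    ‖logOne M - logOne N‖ ≤ ‖M - N‖ / (1 - m) := by
  have hm0 : 0 ≤ m := (norm_nonneg _).trans hM
  have h1 := (hasSum_logOne (hM.trans_lt hm)).sub (hasSum_logOne (hN.trans_lt hm))
  have h2 := (hasSum_geometric_of_lt_one hm0 hm).mul_left ‖M - N‖
  rw [← h1.tsum_eq, div_eq_mul_inv]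
  refine tsum_of_norm_bounded h2 fun k => ?_
  rw [← smul_sub, norm_smul, norm_div, norm_pow, norm_neg, norm_one, one_pow]
  have h3 : ‖(k + 1 : ℂ)‖ = k + 1 := by
    rw [← Nat.cast_succ, Complex.norm_natCast, Nat.cast_succ]
  rw [h3]
  have h4 : (0 : ℝ) < k + 1 := by positivity
  calc _ ≤ 1 / (k + 1 : ℝ) * ((k + 1) * m ^ k * ‖M - N‖) := by
        gcongr
        exact norm_pow_sub_pow_le hM hN k
    _ = _ := by field_simp

end Log

namespace PathLaw

variable {wt : DEdge ends → ℝ} {R r c : PosReal} {φ : PA ends c →L[ℂ] ℂ} (hφ : PathLaw wt c φ)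
  [Finite E]

include hφ

/-- Under the trace all `n + 1` terms of the Leibniz rule coincide. The spare factor `M ^ j` makes
the induction close. -/
theorem trM_derM_pow (hc : c.1 < R.1) (h : DEdge ends → PA ends c) (M : MA ends R c) (n j : ℕ) :
    trM φ (derM R c h (M ^ (n + 1)) * resM ends R c M ^ j) =
      (n + 1) * trM φ (derM R c h M * resM ends R c M ^ (n + j)) := by
  have hp : ∀ n, resM ends R c (M ^ (n + 1)) = resM ends R c M ^ (n + 1) := fun n => by
    induction n with
    | zero => simp
    | succ n ih => rw [pow_succ, resM_mul hc.le, ih, pow_succ _ (n + 1)]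
  induction n generalizing j with
  | zero => simp
  | succ n ih =>
    rw [pow_succ, derM_mul hc, add_mul, map_add, mul_assoc, ← pow_succ', ih, hp,
      hφ.trM_mul_comm (_ ^ (n + 1) * _), ← mul_assoc, hφ.trM_mul_comm _ (derM R c h M), ← pow_add]
    rw [show n + (j + 1) = n + 1 + j by ring, show j + (n + 1) = n + 1 + j by ring]
    push_cast
    ring

/-- Jacobi's formula for the derivative of `Tr log(1 + M)`, term by term in the power series. -/
theorem phi_der_ptr_log (hc : c.1 < R.1) (h : DEdge ends → PA ends c) {M : MA ends R c}
    (hM : ‖M‖ < 1) : φ (der R h (ptr φ (logOne M))) =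
      trM φ (derM R c h M * invOne (resM ends R c M)) := by
  rw [hφ.phi_der_ptr hc]
  have h1 := ((hasSum_logOne hM).mapL (derM R c h)).mapL (trM φ)
  have h2 := ((hasSum_invOne ((norm_resM_le hc.le M).trans_lt hM)).mapL
    (ContinuousLinearMap.mul ℂ _ (derM R c h M))).mapL (trM φ)
  refine h1.unique (Eq.mp (congrArg (HasSum · _) (funext fun k => ?_)) h2)
  symm
  have h3 := hφ.trM_derM_pow hc h M k 0
  rw [pow_zero, mul_one, add_zero] at h3
  rw [map_smul, map_smul, h3, ContinuousLinearMap.mul_apply', neg_pow (resM ends R c M), smul_eq_mul,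
    show ((-1 : MA ends c c) ^ k * resM ends R c M ^ k) =
      ((-1 : ℂ) ^ k) • resM ends R c M ^ k by
      rw [Algebra.smul_def, map_pow, map_neg, map_one], mul_smul_comm, map_smul, smul_eq_mul,
    ← mul_assoc]
  congr 1
  have : (k + 1 : ℂ) ≠ 0 := by exact_mod_cast Nat.succ_ne_zero k
  field_simp

end PathLaw
end PathLaw
end
end FreeGraph

namespace FreeGraph
noncomputable section

open PMon (pmul)
open GPath WL1

/-! ### Verification of the Schwinger–Dyson equation -/

section Verification

variable {V E : Type*} {ends : E → Sym2 V} [Fintype V]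

theorem res_res {R r c : PosReal} (hr : r.1 ≤ R.1) (hc : c.1 ≤ r.1) (u : PA ends R) :
    res r c (res R r u) = res R c u :=
  ext_apply (S := (res r c : PA ends r →L[ℂ] PA ends c).comp (res R r))
    (T := (res R c : PA ends R →L[ℂ] PA ends c)) (fun γ => by
    change res r c (res R r (mon γ)) = _
    rw [res_mon hr, res_mon hc, res_mon (hc.trans hr)]) u

open Classical in
/-- The cyclic derivative `𝒟_e`, from `B_S` to `B_s` for `s < S`. -/
def cycA (S s : PosReal) (e : DEdge ends) : PA ends S →L[ℂ] PA ends s :=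
  lift fun γ => splitSum γ fun a f b => if f = e.op then mon b * mon a else 0

open Classical in
theorem cycA_bound {S s : PosReal} (h : s.1 < S.1) (e : DEdge ends) (γ : GPath ends) :
    ‖(splitSum γ fun a f b => if f = e.op then mon b * mon a else 0 : PA ends s)‖ ≤
      1 / (S.1 - s.1) * pw ends S γ := by
  have hs := s.2
  have hpos : 0 < S.1 - s.1 := sub_pos.2 h
  refine (norm_splitSum_le γ (B := fun i j => s.1 ^ i * s.1 ^ j) fun a f b _ _ _ => ?_).trans ?_
  · split_ifs
    · refine (norm_mul_le _ _).trans ?_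
      rw [norm_mon, norm_mon, pw_apply, pw_apply, mul_comm]
    · rw [norm_zero]; positivity
  · have h2 : ∀ i ∈ Finset.range γ.len, s.1 ^ i * s.1 ^ (γ.len - (i + 1)) =
        s.1 ^ (γ.len - 1) := fun i hi => by
      rw [Finset.mem_range] at hi
      rw [← pow_add]
      congr 1
      omega
    rw [Finset.sum_congr rfl h2, Finset.sum_const, Finset.card_range, nsmul_eq_mul, pw_apply,
      div_mul_eq_mul_div, le_div_iff₀ hpos, one_mul]
    exact mul_pow_pred_mul_sub_le hs.le h.le γ.len

open Classical in
theorem cycA_mon {S s : PosReal} (h : s.1 < S.1) (e : DEdge ends) (γ : GPath ends) :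
    (cycA S s e (mon γ) : PA ends s) =
      splitSum γ fun a f b => if f = e.op then mon b * mon a else 0 :=
  lift_mon ⟨_, cycA_bound h e⟩ γ

variable [Finite E]

/-- The linearized change of variables is invertible for small perturbations. -/
theorem exists_add_der_eq {R r : PosReal} (hr : r.1 < R.1) {f : DEdge ends → PA ends R} {δ : ℝ}
    (hδ : 0 ≤ δ) (hf : ∀ e, ‖f e‖ ≤ δ) (hlt : δ < R.1 - r.1) (k : DEdge ends → PA ends r) :
    ∃ h : DEdge ends → PA ends r, ∀ e, h e + der R h (f e) = k e := by
  have hpos : 0 < R.1 - r.1 := sub_pos.2 hr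
  -- The map `h ↦ d_h f` has norm at most `δ / (R - r) < 1`, so `1 + T` is inverted by the Neumann
  -- series.
  let T : (DEdge ends → PA ends r) →L[ℂ] (DEdge ends → PA ends r) :=
    LinearMap.mkContinuous
      { toFun := fun h e => der R h (f e)
        map_add' := fun h h' => funext fun e => der_add hr h h' (f e)
        map_smul' := fun t h => funext fun e => der_smul hr t h (f e) } (δ / (R.1 - r.1))
      fun h => by
        refine (pi_norm_le_iff_of_nonneg (by positivity)).2 fun e => ?_
        refine (norm_der_le hr h (f e)).trans ?_
        calc ‖h‖ / (R.1 - r.1) * ‖f e‖ ≤ ‖h‖ / (R.1 - r.1) * δ := by gcongr; exact hf e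
          _ = _ := by ring
  have hT : ‖T‖ < 1 := (LinearMap.mkContinuous_norm_le _ (by positivity) _).trans_lt
    ((div_lt_one hpos).2 hlt)
  refine ⟨invOne T k, fun e => ?_⟩
  have h1 := congrArg (fun L : (DEdge ends → PA ends r) →L[ℂ] (DEdge ends → PA ends r) => L k e)
    (one_add_mul_invOne hT)
  exact h1

namespace PathLaw

variable {wt : DEdge ends → ℝ} {R r c : PosReal} {φ : PA ends c →L[ℂ] ℂ} (hφ : PathLaw wt c φ)
  {f : DEdge ends → PA ends R}

include hφ

/-- Only the letters `y e` are varied, and traciality rotates `a (d_h y_e) b` into `b a (d_h y_e)`;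
the words `b a` add up to `m σ ∂_e = 𝒟_{e^op}`. -/
theorem phi_der_evalA (hc : c.1 < r.1) (hr : r.1 < R.1) {y : DEdge ends → PA ends R}
    (hy : IsRep (PA.pv R) y) {S s : PosReal} (hys : ∀ e, ‖y e‖ ≤ s.1) (hsS : s.1 < S.1)
    {h : DEdge ends → PA ends r} {e : DEdge ends} (hk : ∀ g, g ≠ e → der R h (y g) = 0)
    (U : PA ends S) :
    φ (res r c (der R h (evalA (PA.pv R) y s (res S s U)))) =
      φ (res R c (evalA (PA.pv R) y s (cycA S s e.op U)) * res r c (der R h (y e))) := by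
  classical
  refine ext_apply
    (S := φ.comp ((res r c).comp ((der R h).comp ((evalA (PA.pv R) y s).comp (res S s)))))
    (T := φ.comp (((ContinuousLinearMap.mul ℂ _).flip (res r c (der R h (y e)))).comp
      ((res R c).comp ((evalA (PA.pv R) y s).comp (cycA S s e.op))))) (fun γ => ?_) U
  change φ (res r c (der R h (evalA (PA.pv R) y s (res S s (mon γ))))) =
    φ (res R c (evalA (PA.pv R) y s (cycA S s e.op (mon γ))) * res r c (der R h (y e)))
  rw [res_mon hsS.le, evalA_mon (PA.norm_pv_le R) hys, (der_isDer hr h).word hy, cycA_mon hsS,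
    map_splitSum, map_splitSum, map_splitSum, map_splitSum, splitSum_mul, map_splitSum]
  refine splitSum_congr fun a g b _ _ _ _ _ => ?_
  change φ (res r c (res R r (wordIn (PA.pv R) y a) *
    (der R h (y g) * res R r (wordIn (PA.pv R) y b)))) = _
  rw [DEdge.op_op]
  by_cases hg : g = e
  · subst hg
    rw [if_pos rfl, res_mul hc.le, res_mul hc.le, res_res hr.le hc.le, res_res hr.le hc.le,
      evalA_mul hy (PA.norm_pv_le R) hys,
      evalA_mon (PA.norm_pv_le R) hys, evalA_mon (PA.norm_pv_le R) hys,
      res_mul (hc.trans hr).le, hφ.tracial, mul_assoc, hφ.tracial]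
  · rw [if_neg hg, hk g hg]
    simp

/-- The hypothesis `hU` is the Monge–Ampère equation. It is tested on the `h` for which `d_h y` is
the word of `γ` at `e` and zero elsewhere; its right side becomes the trace of `𝒥h + d_h M (1 +
M)⁻¹`. By traciality this is the trace of `𝒥(d_h y)(1 + M)⁻¹`, and the chain rule cancels `1 + M`.
The radii `c < r < R` leave room for two successive derivatives. -/
theorem schwingerDyson_of_potential (h2 : R.1 = 2 * c.1) (hc : c.1 < r.1) (hr : r.1 < R.1)
    (hy : IsRep (PA.pv R) fun e => PA.z R e + f e) {δ : ℝ} (hδ : 0 ≤ δ) (hf : ∀ e, ‖f e‖ ≤ δ)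
    (hlt : δ < R.1 - r.1) (hM : ‖jacM R c f‖ < 1) {S s : PosReal}
    (hys : ∀ e, ‖PA.z R e + f e‖ ≤ s.1) (hsS : s.1 < S.1) {U : PA ends S}
    (hU : ∀ h : DEdge ends → PA ends c,
      φ (der R h (evalA (PA.pv R) (fun e => PA.z R e + f e) s (res S s U))) =
        φ (der R h (quad wt R + ptr φ (logOne (jacM R c f)))))
    {e : DEdge ends} {γ : GPath ends} (hγ : γ.src = e.src) (hγ' : γ.tgt = e.tgt)
    [DecidableEq (DEdge ends)] :
    φ (res R c (evalA (PA.pv R) (fun e => PA.z R e + f e) s (cycA S s e.op U)) *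
        res R c (wordIn (PA.pv R) (fun e => PA.z R e + f e) γ)) =
      splitSum γ fun a g b => if g = e then
        φ (res R c (wordIn (PA.pv R) (fun e => PA.z R e + f e) a)) *
          φ (res R c (wordIn (PA.pv R) (fun e => PA.z R e + f e) b)) else 0 := by
  have hcR := hc.trans hr
  set y : DEdge ends → PA ends R := fun e => PA.z R e + f e with hyd
  have hz := PA.isRep (ends := ends) R
  -- the direction of the variation
  let k : DEdge ends → PA ends r := Pi.single e (res R r (wordIn (PA.pv R) y γ))
  have hke : k e = res R r (wordIn (PA.pv R) y γ) := Pi.single_eq_same _ _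
  have hkn : ∀ g, g ≠ e → k g = 0 := fun g hg => Pi.single_eq_of_ne hg _
  -- As `y = z + f`, the wish `d_h y = k` reads `h + d_h f = k`.
  obtain ⟨h, hh⟩ := exists_add_der_eq hr hδ hf hlt k
  have hpr : ∀ v, res R r (PA.pv R v : PA ends R) = PA.pv r v := fun v => res_mon hr.le _
  have hfl : ∀ g, PA.pv R g.src * f g = f g := fun g => by
    have : PA.pv R g.src * (PA.z R g + f g) = PA.z R g + f g := hy.left g
    rw [mul_add, hz.left] at this
    exact add_left_cancel this
  have hfr : ∀ g, f g * PA.pv R g.tgt = f g := fun g => by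
    have : (PA.z R g + f g) * PA.pv R g.tgt = PA.z R g + f g := hy.right g
    rw [add_mul, hz.right] at this
    exact add_left_cancel this
  have hdl : ∀ g, PA.pv r g.src * der R h (f g) = der R h (f g) := fun g => by
    conv_rhs => rw [← hfl g, der_mul hr, der_vertex hr, zero_mul, zero_add, hpr]
  have hdr : ∀ g, der R h (f g) * PA.pv r g.tgt = der R h (f g) := fun g => by
    conv_rhs => rw [← hfr g, der_mul hr, der_vertex hr, mul_zero, add_zero, hpr]
  -- Here `γ` has to run from `s(e)` to `t(e)`: `d_h z_g` is only the corner of `h g`, so `k` must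
  -- lie in the corners.
  have hkl : ∀ g, PA.pv r g.src * k g = k g := fun g => by
    by_cases hg : g = e
    · subst hg
      rw [hke, ← hpr, ← res_mul hr.le, ← hγ, hy.src_mul_word]
    · rw [hkn g hg, mul_zero]
  have hkr : ∀ g, k g * PA.pv r g.tgt = k g := fun g => by
    by_cases hg : g = e
    · subst hg
      rw [hke, ← hpr, ← res_mul hr.le, ← hγ', hy.word_mul_tgt]
    · rw [hkn g hg, zero_mul]
  have hh' : ∀ g, h g = k g - der R h (f g) := fun g => by rw [← hh g, add_sub_cancel_right]
  have hyk : ∀ g, der R h (y g) = k g := fun g => by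
    rw [hyd]
    simp only
    rw [map_add, der_z hr, hh' g, mul_sub, hkl, hdl, sub_mul, hkr, hdr, sub_add_cancel]
  -- the left hand side
  have hL := hφ.phi_der_evalA hc hr hy hys hsS (h := h) (e := e)
    (fun g hg => (hyk g).trans (hkn g hg)) U
  rw [hyk e, hke, res_res hr.le hc.le, res_der hc hr, hU, map_add, map_add,
    ← hφ.trM_jacT hc hr, hφ.phi_der_ptr_log hcR _ hM] at hL
  rw [← hL]
  -- the right hand side
  set Mc := resM ends R c (jacM R c f) with hMc
  have hMc1 : ‖Mc‖ < 1 := (norm_resM_le hcR.le _).trans_lt hM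
  have hMT : Mc = jacT r c fun g => res R r (f g) := resM_jacM h2 hc hr f
  have hy' : IsRep (PA.pv r) fun g => PA.z r g + res R r (f g) := by
    have h3 := res_isRep hr.le hy
    convert h3 using 2 with g
    rw [hyd]
    simp only
    rw [map_add, PA.z, PA.z, res_mon hr.le]
  have hyy : (fun g => PA.z r g + res R r (f g)) = fun g => res R r (y g) := funext fun g => by
    rw [hyd]
    simp only
    rw [map_add, PA.z, PA.z, res_mon hr.le]
  have hw : ∀ a, res r c (wordIn (PA.pv r) (fun g => PA.z r g + res R r (f g)) a) =
      res R c (wordIn (PA.pv R) y a) := fun a => by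
    rw [hyy, ← res_word hr.le hy, res_res hr.le hc.le]
  have h3 := jacC_word hc hy' e γ
  rw [← hMT] at h3
  -- The word is the only entry of `k = h + d_h f`, and `jacC_der` gives `𝒥(d_h f) = M 𝒥h + d_h M`.
  have h4 : jacC r c e (wordIn (PA.pv r) (fun g => PA.z r g + res R r (f g)) γ) =
      (1 + Mc) * jacT r c h + derM R c (fun g => res r c (h g)) (jacM R c f) := by
    have h5 : jacC r c e (wordIn (PA.pv r) (fun g => PA.z r g + res R r (f g)) γ) = jacT r c k := by
      rw [jacT, Finset.sum_eq_single_of_mem e (Finset.mem_univ _), hke, hyy, res_word hr.le hy]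
      exact fun g _ hg => by rw [hkn g hg, map_zero]
    have h6 : jacT r c k = jacT r c h + ∑ g, jacC r c g (der R h (f g)) := by
      rw [jacT, jacT, ← Finset.sum_add_distrib]
      exact Finset.sum_congr rfl fun g _ => by rw [← hh g, map_add]
    rw [h5, h6, Finset.sum_congr rfl fun g _ => jacC_der h2 hc hr h g (f g),
      Finset.sum_add_distrib, ← Finset.sum_mul, add_mul, one_mul, add_assoc, hMc, jacM, map_sum,
      map_sum]
  rw [h4] at h3
  have h7 : (1 + Mc) * jacT r c h * invOne Mc +
      derM R c (fun g => res r c (h g)) (jacM R c f) * invOne Mc =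
      splitSum γ fun a g b => elemM c e g (res R c (wordIn (PA.pv R) y a))
        (res R c (wordIn (PA.pv R) y b)) := by
    rw [← add_mul, h3, mul_assoc, one_add_mul_invOne hMc1, mul_one]
    simp only [hw]
  have h8 := congrArg (trM φ) h7
  -- The trace moves `(1 + M)⁻¹` to the front of the first term, where it cancels `1 + M`.
  rw [map_add, hφ.trM_mul_comm ((1 + Mc) * _), ← mul_assoc, invOne_mul_one_add hMc1, one_mul,
    map_splitSum] at h8
  rw [h8]
  refine splitSum_congr fun a g b _ _ _ _ _ => ?_
  rw [hφ.trM_mk]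
  by_cases hg : e = g
  · rw [if_pos hg, if_pos hg.symm]
  · rw [if_neg hg, if_neg (Ne.symm hg)]

end PathLaw
end Verification
end
end FreeGraph

namespace FreeGraph
noncomputable section

open PMon (pmul)
open GPath WL1

/-! ### The fixed point equation for the transport potential -/

theorem WL1.norm_apply_le_of_mon {P : Type*} {w : Weight P} {X : Type*} [NormedAddCommGroup X]
    [NormedSpace ℂ X] [CompleteSpace X] {T : WL1 w →L[ℂ] X} {C : ℝ}
    (h : ∀ p, ‖T (mon p)‖ ≤ C * w p) (u : WL1 w) : ‖T u‖ ≤ C * ‖u‖ := by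
  have h1 : T = lift fun p => T (mon p) := clm_ext fun p =>
    (lift_mon (w := w) (f := fun p => T (mon p)) ⟨C, h⟩ p).symm
  rw [h1]
  exact norm_lift_le h u

section Paths

variable {V E : Type*} {ends : E → Sym2 V}

theorem splitSum_congr_comp {X : Type*} [AddCommMonoid X] {γ : GPath ends}
    {F G : GPath ends → DEdge ends → GPath ends → X}
    (h : ∀ a f b (ha : a.tgt = f.src) (hb : f.tgt = b.src), comp a (cons f b hb) ha = γ →
      F a f b = G a f b) : splitSum γ F = splitSum γ G := by
  refine Finset.sum_congr rfl fun i _ => h _ _ _ (src_getElem i.2).symm (tgt_getElem i.2) ?_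
  ext1
  · rfl
  · change γ.edges.take i ++ γ.edges[i] :: γ.edges.drop (i + 1) = γ.edges
    exact (congrArg _ (List.getElem_cons_drop i.2)).trans (List.take_append_drop _ _)

theorem splitSum_smul (γ : GPath ends) {X : Type*} [AddCommGroup X] [Module ℂ X]
    (wt : DEdge ends → ℂ) (x : X) :
    (splitSum γ fun _ f _ => wt f • x) = (γ.edges.map wt).sum • x := by
  induction γ using GPath.induction with
  | hv v => rw [splitSum_vertex]; exact (zero_smul _ _).symm
  | hc f γ h ih =>
    rw [splitSum_cons, ih]
    change _ = ((f :: γ.edges).map wt).sum • x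
    rw [List.map_cons, List.sum_cons, add_smul]

theorem len_mul_le_sum {wt : DEdge ends → ℝ} {m : ℝ} (h : ∀ e, m ≤ wt e) (γ : GPath ends) :
    γ.len * m ≤ (γ.edges.map wt).sum := by
  have := List.card_nsmul_le_sum (γ.edges.map wt) m (by simpa using fun e _ => h e)
  simpa [len] using this

end Paths

/-! ### The normalized cyclic gradient and its inverse modulo commutators. -/

section Gradient

variable {V E : Type*} {ends : E → Sym2 V} [Fintype V]

open Classical in
/-- The cyclic gradient composed with the inverse of the number operator. -/
def dcyc (R : PosReal) (e : DEdge ends) : PA ends R →L[ℂ] PA ends R :=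
  lift fun γ => (γ.len : ℂ)⁻¹ • splitSum γ fun a f b => if f = e.op then mon b * mon a else 0

/-- The number operator divided by the weighted number operator. -/
def Lam (wt : DEdge ends → ℝ) (R : PosReal) : PA ends R →L[ℂ] PA ends R :=
  lift fun γ => ((γ.len / (γ.edges.map wt).sum : ℝ) : ℂ) • mon γ

theorem Lam_bound {wt : DEdge ends → ℝ} {m : ℝ} (hm : 0 < m) (h : ∀ e, m ≤ wt e) (R : PosReal)
    (γ : GPath ends) :
    ‖((γ.len / (γ.edges.map wt).sum : ℝ) : ℂ) • (mon γ : PA ends R)‖ ≤ 1 / m * pw ends R γ := by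
  have h1 := len_mul_le_sum h γ
  have h2 : 0 ≤ γ.len * m := by positivity
  rw [norm_smul, norm_mon, Complex.norm_real,
    Real.norm_of_nonneg (div_nonneg (Nat.cast_nonneg _) (h2.trans h1))]
  refine mul_le_mul_of_nonneg_right ?_ ((pw ends R).pos γ).le
  -- At a vertex both length and weight sum vanish, and the quotient is zero by convention.
  rcases Nat.eq_zero_or_pos γ.len with h0 | h0
  · rw [h0, Nat.cast_zero, zero_div]; positivity
  · have h3 : (0 : ℝ) < γ.len := Nat.cast_pos.2 h0
    rw [div_le_div_iff₀ (lt_of_lt_of_le (by positivity) h1) hm, one_mul]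
    exact h1

theorem Lam_mon {wt : DEdge ends → ℝ} {m : ℝ} (hm : 0 < m) (h : ∀ e, m ≤ wt e) (R : PosReal)
    (γ : GPath ends) :
    Lam wt R (mon γ) = ((γ.len / (γ.edges.map wt).sum : ℝ) : ℂ) • mon γ :=
  lift_mon ⟨_, Lam_bound hm h R⟩ γ

theorem norm_Lam_le {wt : DEdge ends → ℝ} {m : ℝ} (hm : 0 < m) (h : ∀ e, m ≤ wt e) (R : PosReal)
    (u : PA ends R) : ‖Lam wt R u‖ ≤ 1 / m * ‖u‖ := norm_lift_le (Lam_bound hm h R) u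

variable [Finite E]

-- An edge `f` of `γ` contributes only to `e = f.op`, with norm at most `R ^ (n - 1)`. There are `n`
-- edges and the factor `n⁻¹` averages over them, so the bound for the full gradient contains
-- neither the length nor the number of edges of the graph.
open Classical in
theorem dcyc_bound (R : PosReal) (γ : GPath ends) :
    ∑ e : DEdge ends, ‖(γ.len : ℂ)⁻¹ • (splitSum γ fun a f b =>
      if f = e.op then mon b * mon a else 0 : PA ends R)‖ ≤ 1 / R.1 * pw ends R γ := by
  have hR := R.2
  rcases Nat.eq_zero_or_pos γ.len with h0 | h0
  · simp only [h0, Nat.cast_zero, inv_zero, zero_smul, norm_zero, Finset.sum_const_zero]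
    exact mul_nonneg (by positivity) ((pw ends R).pos γ).le
  have h3 : (0 : ℝ) < γ.len := Nat.cast_pos.2 h0
  have h1 := sum_norm_splitSum_le Finset.univ γ
    (F := fun (e : DEdge ends) a f b => if f = e.op then (mon b * mon a : PA ends R) else 0)
    (B := R.1 ^ (γ.len - 1)) (fun a f b hl => by
      rw [Finset.sum_eq_single_of_mem f.op (Finset.mem_univ _)]
      · rw [DEdge.op_op, if_pos rfl]
        refine (norm_mul_le _ _).trans_eq ?_
        rw [norm_mon, norm_mon, pw_apply, pw_apply, ← pow_add]
        congr 1
        omega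
      · intro e _ he
        rw [if_neg fun h => he (by rw [h, DEdge.op_op]), norm_zero])
  simp only [norm_smul, ← Finset.mul_sum]
  rw [norm_inv, Complex.norm_natCast]
  calc _ ≤ (γ.len : ℝ)⁻¹ * (γ.len * R.1 ^ (γ.len - 1)) := by gcongr
    _ = R.1 ^ (γ.len - 1) := by field_simp
    _ = _ := by
      obtain ⟨n, hn⟩ : ∃ n, γ.len = n + 1 := ⟨γ.len - 1, by omega⟩
      rw [pw_apply, hn, Nat.add_sub_cancel, pow_succ]
      field_simp

theorem sum_norm_dcyc_le (R : PosReal) (u : PA ends R) :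
    ∑ e : DEdge ends, ‖dcyc R e u‖ ≤ 1 / R.1 * ‖u‖ :=
  sum_norm_lift_le Finset.univ (dcyc_bound R) u

theorem norm_dcyc_le (R : PosReal) (e : DEdge ends) (u : PA ends R) :
    ‖dcyc R e u‖ ≤ 1 / R.1 * ‖u‖ :=
  (Finset.single_le_sum (f := fun e => ‖dcyc R e u‖) (fun _ _ => norm_nonneg _)
    (Finset.mem_univ e)).trans (sum_norm_dcyc_le R u)

open Classical in
theorem dcyc_mon (R : PosReal) (e : DEdge ends) (γ : GPath ends) :
    (dcyc R e (mon γ) : PA ends R) =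
      (γ.len : ℂ)⁻¹ • splitSum γ fun a f b => if f = e.op then mon b * mon a else 0 :=
  lift_mon ⟨_, fun γ => (Finset.single_le_sum (f := fun e => ‖(γ.len : ℂ)⁻¹ • (splitSum γ
    fun a f b => if f = DEdge.op e then mon b * mon a else 0 : PA ends R)‖)
    (fun _ _ => norm_nonneg _) (Finset.mem_univ e)).trans (dcyc_bound R γ)⟩ γ

theorem pv_mul_dcyc (R : PosReal) (e : DEdge ends) (u : PA ends R) :
    PA.pv R e.src * dcyc R e u = dcyc R e u := by
  classical
  refine ext_apply (S := (ContinuousLinearMap.mul ℂ _ (PA.pv R e.src)).comp (dcyc R e))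
    (T := dcyc R e) (fun γ => ?_) u
  change PA.pv R e.src * dcyc R e (mon γ) = dcyc R e (mon γ)
  rw [dcyc_mon, mul_smul_comm, mul_splitSum]
  congr 1
  refine splitSum_congr fun a f b _ _ h _ _ => ?_
  split_ifs with hf
  · subst hf
    rw [← mul_assoc, PA.pv_mul_mon (show e.src = b.src from h)]
  · rw [mul_zero]

theorem dcyc_mul_pv (R : PosReal) (e : DEdge ends) (u : PA ends R) :
    dcyc R e u * PA.pv R e.tgt = dcyc R e u := by
  classical
  refine ext_apply (S := ((ContinuousLinearMap.mul ℂ _).flip (PA.pv R e.tgt)).comp (dcyc R e))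
    (T := dcyc R e) (fun γ => ?_) u
  change dcyc R e (mon γ) * PA.pv R e.tgt = dcyc R e (mon γ)
  rw [dcyc_mon, smul_mul_assoc, splitSum_mul]
  congr 1
  refine splitSum_congr fun a f b _ h _ _ _ => ?_
  split_ifs with hf
  · subst hf
    rw [mul_assoc, PA.mon_mul_pv (show a.tgt = e.tgt from h)]
  · rw [zero_mul]

theorem isRep_add_dcyc (R : PosReal) (u : PA ends R) :
    IsRep (PA.pv R) fun e : DEdge ends => PA.z R e + dcyc R e u where
  idem := (PA.isRep (ends := ends) R).idem
  orth := (PA.isRep (ends := ends) R).orth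
  left e := by rw [mul_add, (PA.isRep R).left, pv_mul_dcyc]
  right e := by rw [add_mul, (PA.isRep R).right, dcyc_mul_pv]

/-- Cyclic functionals that vanish at the vertices do not see that `𝒟` is not injective. -/
theorem sum_cyclic_dcyc_Lam {wt : DEdge ends → ℝ} {m : ℝ} (hm : 0 < m) (h : ∀ e, m ≤ wt e)
    (h_op : ∀ e, wt e.op = wt e) {R : PosReal} {ψ : PA ends R →L[ℂ] ℂ} (hv : ∀ v, ψ (PA.pv R v) = 0)
    (hc : ∀ u v, ψ (u * v) = ψ (v * u)) (u : PA ends R) :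
    ∑ e : DEdge ends, (wt e : ℂ) * ψ (PA.z R e.op * dcyc R e (Lam wt R u)) = ψ u := by
  classical
  have h1 := ext_apply
    (S := ∑ e : DEdge ends, (wt e : ℂ) • ψ.comp ((ContinuousLinearMap.mul ℂ _ (PA.z R e.op)).comp
      ((dcyc R e).comp (Lam wt R)))) (T := ψ) (fun γ => ?_) u
  · rw [← h1, sum_apply]
    rfl
  rw [sum_apply]
  change ∑ e : DEdge ends, (wt e : ℂ) * ψ (PA.z R e.op * dcyc R e (Lam wt R (mon γ))) = ψ (mon γ)
  simp only [Lam_mon hm h, map_smul, mul_smul_comm, dcyc_mon, smul_eq_mul]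
  rcases Nat.eq_zero_or_pos γ.len with h0 | h0
  · have h2 : γ = vertex γ.src := by
      ext1
      · rfl
      · exact List.length_eq_zero_iff.1 h0
    have h3 : ψ (mon γ) = 0 := (congrArg (fun γ => ψ (mon γ)) h2).trans (hv _)
    rw [h3]
    simp [h0]
  have hn : (γ.len : ℂ) ≠ 0 := Nat.cast_ne_zero.2 h0.ne'
  have hs : ((γ.edges.map wt).sum : ℂ) ≠ 0 := by
    have := len_mul_le_sum h γ
    have h4 : (0 : ℝ) < γ.len * m := by positivity
    exact_mod_cast (h4.trans_le this).ne'
  -- If `γ = a f b`, then `ψ` cannot distinguish `f b a` from `γ`, so every edge contributes its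
  -- weight times `ψ(γ)`. This sum of weights cancels the denominator in `Lam`, and the lengths
  -- cancel between `Lam` and `dcyc`.
  have hsum : ∑ e : DEdge ends, (wt e : ℂ) * ψ (PA.z R e.op * splitSum γ fun a f b =>
      if f = e.op then mon b * mon a else 0) = ((γ.edges.map wt).sum : ℂ) * ψ (mon γ) := by
    simp only [mul_splitSum, map_splitSum, ← splitSum_sum]
    have h5 : ((γ.edges.map wt).sum : ℂ) = (γ.edges.map fun f => (wt f : ℂ)).sum := by
      exact (map_list_sum Complex.ofRealHom _).trans (by rw [List.map_map]; rfl)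
    rw [h5, ← smul_eq_mul, ← splitSum_smul]
    refine splitSum_congr_comp fun a f b ha hb hγ => ?_
    rw [Finset.sum_eq_single_of_mem f.op (Finset.mem_univ _)]
    · rw [DEdge.op_op, if_pos rfl, h_op, smul_eq_mul, ← mul_assoc, hc, ← PA.mon_cons f b hb,
        PA.mon_mul_mon_of_eq (show a.tgt = (cons f b hb).src from ha), hγ]
    · intro e _ he
      rw [if_neg fun h => he (by rw [h, DEdge.op_op]), mul_zero, map_zero, mul_zero]
  simp only [mul_left_comm (wt _ : ℂ), ← Finset.mul_sum]
  rw [hsum]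
  push_cast
  field_simp

end Gradient
end
end FreeGraph

namespace FreeGraph
noncomputable section

open PMon (pmul)
open GPath WL1

/-- Banach's theorem on the closed unit ball, which is mapped into itself since `q + (1 - q) = 1`.
Uniqueness is recorded because it gives selfadjointness later. -/
theorem exists_unique_fixed_of_contraction {X : Type*} [NormedAddCommGroup X] [CompleteSpace X]
    {F : X → X} {q : ℝ} (hq0 : 0 ≤ q) (hq : q < 1) (h0 : ‖F 0‖ ≤ 1 - q)
    (hL : ∀ u v, ‖u‖ ≤ 1 → ‖v‖ ≤ 1 → ‖F u - F v‖ ≤ q * ‖u - v‖) :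
    ∃ G, ‖G‖ ≤ 1 ∧ F G = G ∧ ∀ G', ‖G'‖ ≤ 1 → F G' = G' → G' = G := by
  have hmaps : Set.MapsTo F (Metric.closedBall 0 1) (Metric.closedBall 0 1) := fun u hu => by
    rw [mem_closedBall_zero_iff] at hu ⊢
    have h1 := hL u 0 hu (by simp)
    rw [sub_zero] at h1
    calc ‖F u‖ = ‖(F u - F 0) + F 0‖ := by rw [sub_add_cancel]
      _ ≤ q * ‖u‖ + (1 - q) := (norm_add_le _ _).trans (add_le_add h1 h0)
      _ ≤ q * 1 + (1 - q) := by gcongr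
      _ = 1 := by ring
  have hcon : ContractingWith ⟨q, hq0⟩ (hmaps.restrict F _ _) :=
    ⟨hq, LipschitzWith.of_dist_le_mul fun u v => by
      rw [Subtype.dist_eq, Subtype.dist_eq, dist_eq_norm, dist_eq_norm]
      exact hL _ _ (mem_closedBall_zero_iff.1 u.2) (mem_closedBall_zero_iff.1 v.2)⟩
  obtain ⟨G, hG, hfix, -⟩ := hcon.exists_fixedPoint' (Metric.isClosed_closedBall.isComplete) hmaps
    (x := 0) (by simp) (edist_ne_top _ _)
  have hG' := mem_closedBall_zero_iff.1 hG
  refine ⟨G, hG', hfix, fun G' h1 h2 => ?_⟩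
  have h3 := hL G' G h1 hG'
  rw [h2, hfix.eq] at h3
  have h4 := norm_nonneg (G' - G)
  exact sub_eq_zero.1 (norm_eq_zero.1 (by nlinarith))

/-- The letters are exchanged one at a time; each exchange costs `δ` and leaves `len - 1` letters of
norm at most `s`. -/
theorem norm_wordIn_sub_le {V E : Type*} {ends : E → Sym2 V} {B : Type*} [NormedRing B]
    {p : V → B} {y y' : DEdge ends → B} {s δ : ℝ} (hp : ∀ v, ‖p v‖ ≤ 1) (hrep : IsRep p y)
    (hrep' : IsRep p y') (hy : ∀ e, ‖y e‖ ≤ s) (hy' : ∀ e, ‖y' e‖ ≤ s)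
    (hδ : ∀ e, ‖y e - y' e‖ ≤ δ) (γ : GPath ends) :
    ‖wordIn p y γ - wordIn p y' γ‖ ≤ γ.len * s ^ (γ.len - 1) * δ := by
  induction γ using GPath.induction with
  | hv v => simp [IsRep.word_vertex]
  | hc f γ h ih =>
    have h1 : y f * wordIn p y γ - y' f * wordIn p y' γ =
        (y f - y' f) * wordIn p y γ + y' f * (wordIn p y γ - wordIn p y' γ) := by noncomm_ring
    have hs : 0 ≤ s := (norm_nonneg _).trans (hy f)
    have hδ0 : 0 ≤ δ := (norm_nonneg _).trans (hδ f)
    rw [hrep.word_cons, hrep'.word_cons, h1, len_cons, Nat.add_sub_cancel]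
    have h2 : s * (γ.len * s ^ (γ.len - 1)) = γ.len * s ^ γ.len := by
      rcases Nat.eq_zero_or_pos γ.len with h0 | h0
      · simp [h0]
      · rw [mul_left_comm, ← pow_succ', Nat.sub_add_cancel h0]
    calc _ ≤ ‖y f - y' f‖ * ‖wordIn p y γ‖ + ‖y' f‖ * ‖wordIn p y γ - wordIn p y' γ‖ :=
          (norm_add_le _ _).trans (add_le_add (norm_mul_le _ _) (norm_mul_le _ _))
      _ ≤ δ * s ^ γ.len + s * (γ.len * s ^ (γ.len - 1) * δ) := by
          gcongr
          · exact hδ f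
          · exact norm_wordIn_le hp hy γ
          · exact hy' f
      _ = δ * s ^ γ.len + s * (γ.len * s ^ (γ.len - 1)) * δ := by ring
      _ = _ := by rw [h2]; push_cast; ring

/-! ### Lipschitz estimates for the remainder and solution by contraction. -/

section FixedPoint

variable {V E : Type*} {ends : E → Sym2 V} [Fintype V]

theorem norm_evalA_res_sub_le {B : Type*} [NormedRing B] [NormedAlgebra ℂ B] [CompleteSpace B]
    {p : V → B} {y y' : DEdge ends → B} {S s : PosReal} {δ : ℝ} (hsS : s.1 < S.1)
    (hp : ∀ v, ‖p v‖ ≤ 1)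
    (hrep : IsRep p y) (hrep' : IsRep p y') (hy : ∀ e, ‖y e‖ ≤ s.1) (hy' : ∀ e, ‖y' e‖ ≤ s.1)
    (hδ0 : 0 ≤ δ) (hδ : ∀ e, ‖y e - y' e‖ ≤ δ) (u : PA ends S) :
    ‖evalA p y s (res S s u) - evalA p y' s (res S s u)‖ ≤ δ / (S.1 - s.1) * ‖u‖ := by
  refine norm_apply_le_of_mon (T := (evalA p y s).comp (res S s) - (evalA p y' s).comp (res S s))
    (fun γ => ?_) u
  change ‖evalA p y s (res S s (mon γ)) - evalA p y' s (res S s (mon γ))‖ ≤ _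
  rw [res_mon hsS.le, evalA_mon hp hy, evalA_mon hp hy']
  refine (norm_wordIn_sub_le hp hrep hrep' hy hy' hδ γ).trans ?_
  have hpos : 0 < S.1 - s.1 := sub_pos.2 hsS
  rw [pw_apply, div_mul_eq_mul_div, le_div_iff₀ hpos]
  have := mul_pow_pred_mul_sub_le s.2.le hsS.le γ.len
  calc _ = δ * (γ.len * s.1 ^ (γ.len - 1) * (S.1 - s.1)) := by ring
    _ ≤ _ := by gcongr

variable [Finite E]

/-- The transported generators `z + 𝒟 G`. -/
def shift (R : PosReal) (G : PA ends R) (e : DEdge ends) : PA ends R := PA.z R e + dcyc R e G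

/-- The remainder in the equation for the potential. -/
def remainder (wt : DEdge ends → ℝ) {R c : PosReal} (s : PosReal) {S : PosReal}
    (φ : PA ends c →L[ℂ] ℂ) (W : PA ends S) (G : PA ends R) : PA ends R :=
  ∑ e, ((1 / 2 * wt e : ℝ) : ℂ) • (dcyc R e.op G * dcyc R e G) +
    evalA (PA.pv R) (shift R G) s (res S s W) -
    ptr φ (logOne (jacM R c fun e => dcyc R e G))

theorem norm_jacM_dcyc_le {R c : PosReal} (h2 : R.1 = 2 * c.1) (G : PA ends R) :
    ‖jacM R c fun e => dcyc R e G‖ ≤ 4 / R.1 * (1 / R.1 * ‖G‖) := by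
  have hR := R.2
  rw [jacM]
  calc _ ≤ ∑ e, ‖jacR R c e (dcyc R e G)‖ := norm_sum_le _ _
    _ ≤ ∑ e, 4 / R.1 * ‖dcyc R e G‖ := Finset.sum_le_sum fun e _ => norm_jacR_le h2 e _
    _ = 4 / R.1 * ∑ e, ‖dcyc R e G‖ := by rw [Finset.mul_sum]
    _ ≤ _ := by gcongr; exact sum_norm_dcyc_le R G

theorem jacM_dcyc_sub (R c : PosReal) (G G' : PA ends R) :
    (jacM R c fun e => dcyc R e G) - (jacM R c fun e => dcyc R e G') =
      jacM R c fun e => dcyc R e (G - G') := by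
  simp only [jacM, map_sub, Finset.sum_sub_distrib]

variable {wt : DEdge ends → ℝ} {R c s S : PosReal} {φ : PA ends c →L[ℂ] ℂ}

theorem norm_shift_le (hs : s.1 = R.1 + 1 / R.1) {G : PA ends R} (hG : ‖G‖ ≤ 1) (e : DEdge ends) :
    ‖shift R G e‖ ≤ s.1 := by
  have hR := R.2
  rw [hs]
  refine (norm_add_le _ _).trans (add_le_add (PA.norm_z R e).le ?_)
  refine (norm_dcyc_le R e G).trans ?_
  calc 1 / R.1 * ‖G‖ ≤ 1 / R.1 * 1 := by gcongr
    _ = _ := mul_one _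

/-- In each product one factor is bounded uniformly by `1 / R`, and the factor with `G - G'` is
summed over the edges, so again the number of edges does not enter. -/
theorem norm_quadratic_sub_le (hw0 : ∀ e, 0 ≤ wt e) (hw1 : ∀ e, wt e ≤ 1) {G G' : PA ends R}
    (hG : ‖G‖ ≤ 1) (hG' : ‖G'‖ ≤ 1) :
    ‖(∑ e, ((1 / 2 * wt e : ℝ) : ℂ) • (dcyc R e.op G * dcyc R e G)) -
      ∑ e, ((1 / 2 * wt e : ℝ) : ℂ) • (dcyc R e.op G' * dcyc R e G')‖ ≤
      1 / R.1 * (1 / R.1 * ‖G - G'‖) := by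
  have hR := R.2
  have hb : ∀ G : PA ends R, ‖G‖ ≤ 1 → ∀ e, ‖dcyc R e G‖ ≤ 1 / R.1 := fun G hG e => by
    refine (norm_dcyc_le R e G).trans ?_
    calc 1 / R.1 * ‖G‖ ≤ 1 / R.1 * 1 := by gcongr
      _ = _ := mul_one _
  have h1 : ∀ e : DEdge ends, ‖((1 / 2 * wt e : ℝ) : ℂ) • (dcyc R e.op G * dcyc R e G) -
      ((1 / 2 * wt e : ℝ) : ℂ) • (dcyc R e.op G' * dcyc R e G')‖ ≤
      1 / 2 * (1 / R.1) * ‖dcyc R e.op (G - G')‖ + 1 / 2 * (1 / R.1) * ‖dcyc R e (G - G')‖ := by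
    intro e
    have h3 : dcyc R e.op G * dcyc R e G - dcyc R e.op G' * dcyc R e G' =
        dcyc R e.op (G - G') * dcyc R e G + dcyc R e.op G' * dcyc R e (G - G') := by
      rw [map_sub, map_sub]; noncomm_ring
    rw [← smul_sub, h3, norm_smul, Complex.norm_real,
      Real.norm_of_nonneg (mul_nonneg (by norm_num) (hw0 e))]
    calc _ ≤ 1 / 2 * 1 * (‖dcyc R e.op (G - G')‖ * (1 / R.1) + 1 / R.1 * ‖dcyc R e (G - G')‖) := by
          gcongr
          · exact hw1 e
          · refine (norm_add_le _ _).trans (add_le_add ?_ ?_)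
            · refine (norm_mul_le _ _).trans ?_
              gcongr
              exact hb G hG e
            · refine (norm_mul_le _ _).trans ?_
              gcongr
              exact hb G' hG' e.op
      _ = _ := by ring
  rw [← Finset.sum_sub_distrib]
  calc _ ≤ ∑ e : DEdge ends, (1 / 2 * (1 / R.1) * ‖dcyc R e.op (G - G')‖ +
        1 / 2 * (1 / R.1) * ‖dcyc R e (G - G')‖) := norm_sum_le_of_le _ fun e _ => h1 e
    _ = 1 / R.1 * ∑ e : DEdge ends, ‖dcyc R e (G - G')‖ := by
      rw [Finset.sum_add_distrib, ← Finset.mul_sum, ← Finset.mul_sum,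
        sum_comp_op fun e => ‖dcyc R e (G - G')‖]
      ring
    _ ≤ _ := by gcongr; exact sum_norm_dcyc_le R _

/-- For `R > 4` the quadratic term contributes at most `1 / (4R)`, the potential `W` at most `1 /
R`, and the logarithm at most `(16/3) / R² ≤ (4/3) / R`; the total is below `3 / R`. -/
theorem norm_remainder_sub_le (hφ : PathLaw wt c φ) (h2 : R.1 = 2 * c.1) (hR4 : 4 < R.1)
    (hw0 : ∀ e, 0 ≤ wt e)
    (hw1 : ∀ e, wt e ≤ 1) (hs : s.1 = R.1 + 1 / R.1) (hsS : s.1 < S.1) {W : PA ends S}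
    (hW : ‖W‖ ≤ S.1 - s.1) {G G' : PA ends R} (hG : ‖G‖ ≤ 1) (hG' : ‖G'‖ ≤ 1) :
    ‖remainder wt s φ W G - remainder wt s φ W G'‖ ≤ 3 / R.1 * ‖G - G'‖ := by
  have hR := R.2
  have hpos : 0 < S.1 - s.1 := sub_pos.2 hsS
  have hd := norm_nonneg (G - G')
  have h1 := norm_quadratic_sub_le hw0 hw1 hG hG'
  have h3 : ‖evalA (PA.pv R) (shift R G) s (res S s W) -
      evalA (PA.pv R) (shift R G') s (res S s W)‖ ≤ 1 / R.1 * ‖G - G'‖ := by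
    refine (norm_evalA_res_sub_le (δ := 1 / R.1 * ‖G - G'‖) hsS (PA.norm_pv_le R)
      (isRep_add_dcyc R G) (isRep_add_dcyc R G') (norm_shift_le hs hG) (norm_shift_le hs hG')
      (by positivity) (fun e => ?_) W).trans ?_
    · change ‖PA.z R e + dcyc R e G - (PA.z R e + dcyc R e G')‖ ≤ _
      rw [add_sub_add_left_eq_sub, ← map_sub]
      exact norm_dcyc_le R e _
    · rw [div_mul_eq_mul_div, div_le_iff₀ hpos]
      gcongr
  -- The bound `4 / R²` is at most `1/4`, well inside the disc of convergence of the logarithm.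
  have hm : ∀ G : PA ends R, ‖G‖ ≤ 1 → ‖jacM R c fun e => dcyc R e G‖ ≤ 1 / 4 := fun G hG => by
    refine (norm_jacM_dcyc_le h2 G).trans ?_
    calc 4 / R.1 * (1 / R.1 * ‖G‖) ≤ 4 / 4 * (1 / 4 * 1) := by gcongr
      _ = _ := by norm_num
  have h4 : ‖(ptr φ (logOne (jacM R c fun e => dcyc R e G)) : PA ends R) -
      ptr φ (logOne (jacM R c fun e => dcyc R e G'))‖ ≤ 4 / R.1 * (1 / R.1 * ‖G - G'‖) / (3 / 4) := by
    rw [← map_sub]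
    refine (hφ.norm_ptr_le _).trans ((norm_logOne_sub_le (hm G hG) (hm G' hG')
      (by norm_num)).trans ?_)
    rw [jacM_dcyc_sub, show (1 - 1 / 4 : ℝ) = 3 / 4 by norm_num]
    gcongr
    exact norm_jacM_dcyc_le h2 _
  have h5 : remainder wt s φ W G - remainder wt s φ W G' =
      ((∑ e, ((1 / 2 * wt e : ℝ) : ℂ) • (dcyc R e.op G * dcyc R e G)) -
        ∑ e, ((1 / 2 * wt e : ℝ) : ℂ) • (dcyc R e.op G' * dcyc R e G')) +
      (evalA (PA.pv R) (shift R G) s (res S s W) - evalA (PA.pv R) (shift R G') s (res S s W)) -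
      (ptr φ (logOne (jacM R c fun e => dcyc R e G)) -
        ptr φ (logOne (jacM R c fun e => dcyc R e G'))) := by
    rw [remainder, remainder]; abel
  rw [h5]
  refine (norm_sub_le _ _).trans ((add_le_add ((norm_add_le _ _).trans (add_le_add h1 h3))
    h4).trans ?_)
  have h6 : 1 / R.1 ≤ 1 / 4 := by gcongr
  have h7 : 0 ≤ 1 / R.1 * ‖G - G'‖ := by positivity
  have h8 := mul_le_mul_of_nonneg_right h6 h7
  rw [show 4 / R.1 * (1 / R.1 * ‖G - G'‖) = 4 * (1 / R.1 * (1 / R.1 * ‖G - G'‖)) by ring,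
    show 3 / R.1 * ‖G - G'‖ = 3 * (1 / R.1 * ‖G - G'‖) by ring]
  linarith

theorem norm_remainder_zero_le (hs : s.1 = R.1 + 1 / R.1)
    (hsS : s.1 < S.1) (W : PA ends S) : ‖remainder wt s φ W (0 : PA ends R)‖ ≤ ‖W‖ := by
  have h1 : jacM R c (fun e : DEdge ends => dcyc R e (0 : PA ends R)) = 0 := by
    simp [jacM]
  have h2 : logOne (0 : MA ends R c) = 0 := by simp [logOne]
  rw [remainder, h1, h2]
  simp only [map_zero, mul_zero, smul_zero, Finset.sum_const_zero, zero_add, sub_zero]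
  exact (norm_evalA_le (PA.norm_pv_le R) (norm_shift_le hs (by simp)) _).trans
    (norm_res_le hsS.le W)

/-- Weights of at least `4 / R` give `Lam` norm at most `R / 4`. With the Lipschitz constant `3 / R`
of the remainder this yields `q = 3/4`, and `‖W‖ ≤ 1 / R` yields the initial bound `1/4 = 1 - q`. -/
theorem exists_potential (hφ : PathLaw wt c φ) (h2 : R.1 = 2 * c.1) (hR4 : 4 < R.1)
    (hw0 : ∀ e, 4 / R.1 ≤ wt e) (hw1 : ∀ e, wt e ≤ 1) (hs : s.1 = R.1 + 1 / R.1) (hsS : s.1 < S.1)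
    {W : PA ends S} (hW : ‖W‖ ≤ S.1 - s.1) (hW' : ‖W‖ ≤ 1 / R.1) :
    ∃ G : PA ends R, ‖G‖ ≤ 1 ∧ -Lam wt R (remainder wt s φ W G) = G ∧
      ∀ G', ‖G'‖ ≤ 1 → -Lam wt R (remainder wt s φ W G') = G' → G' = G := by
  have hR := R.2
  have hm : 0 < 4 / R.1 := by positivity
  refine exists_unique_fixed_of_contraction (F := fun G => -Lam wt R (remainder wt s φ W G))
    (q := 3 / 4) (by norm_num) (by norm_num) ?_ fun G G' hG hG' => ?_
  · rw [norm_neg]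
    refine (norm_Lam_le hm hw0 R _).trans ?_
    calc 1 / (4 / R.1) * ‖remainder wt s φ W (0 : PA ends R)‖ ≤ 1 / (4 / R.1) * (1 / R.1) := by
          gcongr
          exact (norm_remainder_zero_le hs hsS W).trans hW'
      _ = 1 - 3 / 4 := by field_simp; norm_num
  · rw [neg_sub_neg, ← map_sub, norm_sub_rev G G']
    refine (norm_Lam_le hm hw0 R _).trans ?_
    calc _ ≤ 1 / (4 / R.1) * (3 / R.1 * ‖G' - G‖) := by
          gcongr
          exact norm_remainder_sub_le hφ h2 hR4 (fun e => hm.le.trans (hw0 e)) hw1 hs hsS hW hG' hG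
      _ = _ := by field_simp

end FixedPoint
end
end FreeGraph

namespace FreeGraph
noncomputable section

open PMon (pmul)
open GPath WL1

/-! ### The fixed point solves the Schwinger–Dyson equation. -/

section Solution

variable {V E : Type*} {ends : E → Sym2 V} [Fintype V] [Finite E]
variable {wt : DEdge ends → ℝ} {R c s S : PosReal} {φ : PA ends c →L[ℂ] ℂ}

theorem evalA_res_z {B : Type*} [NormedRing B] [NormedAlgebra ℂ B] [CompleteSpace B]
    {p : V → B} {y : DEdge ends → B} (hsS : s.1 ≤ S.1) (hp : ∀ v, ‖p v‖ ≤ 1) (hrep : IsRep p y)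
    (hy : ∀ e, ‖y e‖ ≤ s.1) (e : DEdge ends) : evalA p y s (res S s (PA.z S e)) = y e := by
  rw [PA.z, res_mon hsS, evalA_mon hp hy, hrep.word_single]

theorem evalA_res_quad {B : Type*} [NormedRing B] [NormedAlgebra ℂ B] [CompleteSpace B]
    {p : V → B} {y : DEdge ends → B} (hsS : s.1 ≤ S.1) (hp : ∀ v, ‖p v‖ ≤ 1) (hrep : IsRep p y)
    (hy : ∀ e, ‖y e‖ ≤ s.1) : evalA p y s (res S s (quad wt S)) =
      ∑ e, ((1 / 2 * wt e : ℝ) : ℂ) • (y e.op * y e) := by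
  simp only [quad, map_sum, map_smul, res_mul hsS, evalA_mul hrep hp hy,
    evalA_res_z hsS hp hrep hy]

/-- The two mixed terms agree under a cyclic functional after exchanging `e` and `e.op`, which
removes the factor `1/2`. -/
theorem sum_shift_mul_shift (hop : ∀ e, wt e.op = wt e) {ψ : PA ends R →L[ℂ] ℂ}
    (hψ : ∀ u v, ψ (u * v) = ψ (v * u)) (G : PA ends R) :
    ψ (∑ e, ((1 / 2 * wt e : ℝ) : ℂ) • (shift R G e.op * shift R G e)) =
      ψ (quad wt R) + (∑ e, (wt e : ℂ) * ψ (PA.z R e.op * dcyc R e G)) +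
        ψ (∑ e, ((1 / 2 * wt e : ℝ) : ℂ) • (dcyc R e.op G * dcyc R e G)) := by
  have h1 : ∀ e : DEdge ends, ψ (((1 / 2 * wt e : ℝ) : ℂ) • (shift R G e.op * shift R G e)) =
      ψ (((1 / 2 * wt e : ℝ) : ℂ) • (PA.z R e.op * PA.z R e)) +
        ((1 / 2 * wt e : ℝ) : ℂ) * ψ (PA.z R e.op * dcyc R e G) +
        ((1 / 2 * wt e.op : ℝ) : ℂ) * ψ (PA.z R e.op.op * dcyc R e.op G) +
        ψ (((1 / 2 * wt e : ℝ) : ℂ) • (dcyc R e.op G * dcyc R e G)) := fun e => by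
    rw [shift, shift, DEdge.op_op, hψ (PA.z R e), hop]
    simp only [map_smul, add_mul, mul_add, map_add, smul_eq_mul]
    ring
  rw [map_sum, Finset.sum_congr rfl fun e _ => h1 e, Finset.sum_add_distrib,
    Finset.sum_add_distrib, Finset.sum_add_distrib, ← map_sum, ← map_sum,
    sum_comp_op fun e => ((1 / 2 * wt e : ℝ) : ℂ) * ψ (PA.z R e.op * dcyc R e G), ← quad,
    add_assoc (ψ (quad wt R)), ← Finset.sum_add_distrib]
  congr 2
  exact Finset.sum_congr rfl fun e _ => by push_cast; ring

/-- The transported tuple satisfies the Schwinger–Dyson equation. -/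
theorem PathLaw.schwingerDyson_shift (hφ : PathLaw wt c φ) (h2 : R.1 = 2 * c.1) (hR4 : 4 < R.1)
    (hw0 : ∀ e, 4 / R.1 ≤ wt e) (hs : s.1 = R.1 + 1 / R.1) (hsS : s.1 < S.1)
    {W : PA ends S} {G : PA ends R} (hG : ‖G‖ ≤ 1) (hfix : -Lam wt R (remainder wt s φ W G) = G)
    {e : DEdge ends} {γ : GPath ends} (hγ : γ.src = e.src) (hγ' : γ.tgt = e.tgt)
    [DecidableEq (DEdge ends)] :
    φ (res R c (evalA (PA.pv R) (shift R G) s (cycA S s e.op (quad wt S + W))) *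
        res R c (wordIn (PA.pv R) (shift R G) γ)) =
      splitSum γ fun a g b => if g = e then
        φ (res R c (wordIn (PA.pv R) (shift R G) a)) *
          φ (res R c (wordIn (PA.pv R) (shift R G) b)) else 0 := by
  have hR := R.2
  have hc := c.2
  have hcR : c.1 < R.1 := by linarith
  have hf : ∀ e : DEdge ends, ‖dcyc R e G‖ ≤ 1 / R.1 := fun e => by
    refine (norm_dcyc_le R e G).trans ?_
    calc 1 / R.1 * ‖G‖ ≤ 1 / R.1 * 1 := by gcongr
      _ = _ := mul_one _
  have hM : ‖jacM R c fun e => dcyc R e G‖ < 1 := by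
    refine (norm_jacM_dcyc_le h2 G).trans_lt ?_
    calc 4 / R.1 * (1 / R.1 * ‖G‖) ≤ 4 / 4 * (1 / 4 * 1) := by gcongr
      _ < 1 := by norm_num
  -- The radius `3R/4` lies between `c = R/2` and `R`, and `1 / R < R / 4` is the smallness needed
  -- to solve for the variation.
  refine hφ.schwingerDyson_of_potential (r := ⟨3 / 4 * R.1, by positivity⟩)
    (f := fun e => dcyc R e G) (δ := 1 / R.1) h2 ?_ ?_
    (isRep_add_dcyc R G) (by positivity) hf ?_ hM (norm_shift_le hs hG) hsS (fun h => ?_) hγ hγ'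
  · change c.1 < 3 / 4 * R.1; linarith
  · change 3 / 4 * R.1 < R.1; linarith
  · change 1 / R.1 < R.1 - 3 / 4 * R.1
    rw [div_lt_iff₀ hR]
    nlinarith
  · change φ (der R h (evalA (PA.pv R) (shift R G) s (res S s (quad wt S + W)))) = _
    -- This functional is tracial and vanishes at the vertices, as `sum_cyclic_dcyc_Lam` requires.
    let ψ : PA ends R →L[ℂ] ℂ := φ.comp (der R h)
    have hψ : ∀ u v, ψ (u * v) = ψ (v * u) := fun u v => by
      change φ (der R h (u * v)) = φ (der R h (v * u))
      rw [der_mul hcR, der_mul hcR, map_add, map_add, hφ.tracial, add_comm, hφ.tracial]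
    have hv : ∀ v, ψ (PA.pv R v) = 0 := fun v => by
      change φ (der R h (PA.pv R v)) = 0
      rw [der_vertex hcR, map_zero]
    have h3 := sum_cyclic_dcyc_Lam (m := 4 / R.1) (by positivity) hw0 hφ.wt_op hv hψ
      (-remainder wt s φ W G)
    rw [map_neg, hfix, map_neg] at h3
    change ψ _ = ψ _
    rw [map_add, map_add, evalA_res_quad hsS.le (y := shift R G) (PA.norm_pv_le R)
      (isRep_add_dcyc R G) (norm_shift_le hs hG), map_add]
    refine (congrArg (· + _) (sum_shift_mul_shift hφ.wt_op hψ G)).trans ?_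
    -- The linear term equals `-ψ(remainder)`; it cancels the quadratic term and `W`, and leaves the
    -- logarithm.
    rw [h3, remainder, map_sub, map_add, map_add]
    ring

end Solution

/-! ### Selfadjoint potentials -/

theorem WL1.starMap_mul_of_hom {P : Type*} {w : Weight P} [PMon P] [SubMul w] {ι : WInv w}
    (h : ∀ a b, pmul (ι.map a) (ι.map b) = (pmul a b).map ι.map) (u v : WL1 w) :
    starMap ι (u * v) = starMap ι u * starMap ι v := by
  have h1 : ∀ (a : P) (v : WL1 w), starMap ι (mon a * v) = mon (ι.map a) * starMap ι v :=
    fun a v => starMap_comp (S := mulL w (mon a)) (T := mulL w (mon (ι.map a))) (fun b => by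
      change starMap ι (mon a * mon b) = mon (ι.map a) * mon (ι.map b)
      rw [mon_mul_mon, mon_mul_mon, h]
      cases pmul a b with
      | none => exact map_zero (starHom ι)
      | some c => exact starMap_mon c) v
  exact starMap_comp (S := (mulL w).flip v) (T := (mulL w).flip (starMap ι v))
    (fun a => h1 a v) u

section Star

variable {V E : Type*} {ends : E → Sym2 V}

/-- The involution on `B_r`. -/
def revInv (ends : E → Sym2 V) (r : PosReal) : WInv (pw ends r) where
  map := rev
  invol := rev_rev
  weight_eq γ := by rw [pw_apply, pw_apply, len_rev]

/-- The entrywise involution on matrices. -/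
def revInvM (ends : E → Sym2 V) (R c : PosReal) : WInv (mw ends R c) where
  map x := ⟨x.row.op, x.col.op, x.snd.rev, x.fst.rev⟩
  invol x := by simp only [rev_rev, DEdge.op_op]
  weight_eq x := by simp only [mw_apply, len_rev]; ring

/-- The adjoint on `B_r`. -/
abbrev starA {r : PosReal} (u : PA ends r) : PA ends r := starMap (revInv ends r) u

/-- The entrywise adjoint. -/
abbrev starM {R c : PosReal} (X : MA ends R c) : MA ends R c := starMap (revInvM ends R c) X

theorem starA_mon {r : PosReal} (γ : GPath ends) : starA (mon γ : PA ends r) = mon γ.rev :=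
  starMap_mon γ

variable [Fintype V]

theorem starA_mul {r : PosReal} (u v : PA ends r) : starA (u * v) = starA v * starA u :=
  starMap_mul (fun a b => by
    change pmul b.rev a.rev = _
    by_cases h : a.tgt = b.src
    · rw [pmul_of_eq h, pmul_of_eq (show b.rev.tgt = a.rev.src by rw [tgt_rev, src_rev, h])]
      exact congrArg some (rev_comp a b h).symm
    · rw [pmul_of_ne h, pmul_of_ne fun h' => h (by rw [tgt_rev, src_rev] at h'; exact h'.symm)]
      rfl) u v

theorem starA_sum {ι : Type*} {r : PosReal} (t : Finset ι) (f : ι → PA ends r) :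
    starA (∑ i ∈ t, f i) = ∑ i ∈ t, starA (f i) := map_sum (starHom (revInv ends r)) f t

theorem starA_splitSum {r : PosReal} (γ : GPath ends)
    (F : GPath ends → DEdge ends → GPath ends → PA ends r) :
    starA (splitSum γ F) = splitSum γ fun a f b => starA (F a f b) :=
  map_splitSum (starHom (revInv ends r)) γ F

theorem starA_smul {r : PosReal} (t : ℝ) (u : PA ends r) :
    starA ((t : ℂ) • u) = (t : ℂ) • starA u := by
  rw [starA, starMap_smul]
  congr 1
  exact Complex.conj_ofReal t

variable [Finite E]

/-- Path reversal reverses the products in both legs, and the exchange of the legs, which carry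
opposite products, undoes this. So `starM` is multiplicative rather than antimultiplicative and
commutes with power series in one matrix. -/
theorem starM_mul {R c : PosReal} (X Y : MA ends R c) : starM (X * Y) = starM X * starM Y :=
  starMap_mul_of_hom (fun x y => by
    obtain ⟨e, f, a, b⟩ := x
    obtain ⟨f', g, a', b'⟩ := y
    change pmul (⟨e.op, f.op, b.rev, a.rev⟩ : MIdx ends) ⟨f'.op, g.op, b'.rev, a'.rev⟩ = _
    by_cases h : f = f' ∧ a.tgt = a'.src ∧ b'.tgt = b.src
    · rw [MIdx.pmul_of (x := ⟨e, f, a, b⟩) (y := ⟨f', g, a', b'⟩) h.1 h.2.1 h.2.2,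
        MIdx.pmul_of (congrArg DEdge.op h.1) (by simpa using h.2.2.symm) (by simpa using h.2.1.symm)]
      simp only [Option.map_some, revInvM, rev_comp]
    · rw [MIdx.pmul_of_not (x := ⟨e, f, a, b⟩) (y := ⟨f', g, a', b'⟩) h, MIdx.pmul_of_not]
      · rfl
      · rintro ⟨h1, h2, h3⟩
        simp only [tgt_rev, src_rev] at h2 h3
        exact h ⟨DEdge.op_injective h1, h3.symm, h2.symm⟩) X Y

theorem starM_logOne {R c : PosReal} {M : MA ends R c} (hM : ‖M‖ < 1) :
    starM (logOne M) = logOne (starM M) := by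
  have h1 := (hasSum_logOne hM).map (starHom (revInvM ends R c)) continuous_starMap
  have h2 := hasSum_logOne (M := starM M) (by rwa [norm_starMap])
  refine h1.unique ?_
  refine Eq.mp (congrArg (HasSum · _) (funext fun k => ?_)) h2
  have hp : ∀ n, starM (M ^ (n + 1)) = starM M ^ (n + 1) := fun n => by
    induction n with
    | zero => simp
    | succ n ih => rw [pow_succ, starM_mul, ih, pow_succ _ (n + 1)]
  change _ = starM (((-1) ^ k / (k + 1) : ℂ) • M ^ (k + 1))
  refine Eq.symm ((starMap_smul _ _).trans ?_)
  refine congrArg₂ (· • ·) ?_ (hp k)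
  simp

theorem starA_dcyc {R : PosReal} (e : DEdge ends) (u : PA ends R) :
    starA (dcyc R e u) = dcyc R e.op (starA u) := by
  classical
  refine starMap_comp (fun γ => ?_) u
  change starA (dcyc R e (mon γ)) = dcyc R e.op (mon γ.rev)
  rw [dcyc_mon, dcyc_mon, len_rev, splitSum_rev, starA, starMap_smul, ← starA, starA_splitSum]
  congr 1
  · simp
  · refine splitSum_congr fun a f b _ _ _ _ _ => ?_
    by_cases h : f = e.op
    · rw [if_pos h, if_pos (congrArg DEdge.op h), starA_mul, starA_mon, starA_mon]
    · rw [if_neg h, if_neg fun h' => h (DEdge.op_injective h')]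
      exact map_zero (starHom (revInv ends R))

theorem starA_Lam {wt : DEdge ends → ℝ} {m : ℝ} (hm : 0 < m) (h : ∀ e, m ≤ wt e)
    (hop : ∀ e, wt e.op = wt e) {R : PosReal} (u : PA ends R) :
    starA (Lam wt R u) = Lam wt R (starA u) := by
  refine starMap_comp (fun γ => ?_) u
  change starA (Lam wt R (mon γ)) = Lam wt R (mon γ.rev)
  have h1 : (γ.rev.edges.map wt).sum = (γ.edges.map wt).sum := by
    change (((γ.edges.map DEdge.op).reverse).map wt).sum = _
    rw [List.map_reverse, List.sum_reverse, List.map_map]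
    exact congrArg (fun f => (γ.edges.map f).sum) (funext hop)
  rw [Lam_mon hm h, Lam_mon hm h, h1, len_rev, starA_smul, starA_mon]

theorem starA_wordIn {r : PosReal} {y : DEdge ends → PA ends r} (hy : IsRep (PA.pv r) y)
    (hy' : IsRep (PA.pv r) fun e => starA (y e.op)) (γ : GPath ends) :
    starA (wordIn (PA.pv r) y γ) = wordIn (PA.pv r) (fun e => starA (y e.op)) γ.rev := by
  induction γ using GPath.induction with
  | hv v => rw [IsRep.word_vertex, rev_vertex, IsRep.word_vertex, PA.pv, starA_mon, rev_vertex]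
  | hc f γ h ih =>
    rw [hy.word_cons, starA_mul, ih, rev_cons, hy'.word_comp, hy'.word_single, DEdge.op_op]

theorem starA_evalA_res {R s S : PosReal} (hsS : s.1 ≤ S.1) {y : DEdge ends → PA ends R}
    (hy : IsRep (PA.pv R) y) (hy' : IsRep (PA.pv R) fun e => starA (y e.op))
    (hn : ∀ e, ‖y e‖ ≤ s.1) (u : PA ends S) :
    starA (evalA (PA.pv R) y s (res S s u)) =
      evalA (PA.pv R) (fun e => starA (y e.op)) s (res S s (starA u)) := by
  refine starMap_comp (S := (evalA (PA.pv R) y s).comp (res S s))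
    (T := (evalA (PA.pv R) (fun e => starA (y e.op)) s).comp (res S s)) (fun γ => ?_) u
  change starA (evalA (PA.pv R) y s (res S s (mon γ))) =
    evalA (PA.pv R) (fun e => starA (y e.op)) s (res S s (mon γ.rev))
  rw [res_mon hsS, res_mon hsS, evalA_mon (PA.norm_pv_le R) hn, evalA_mon (PA.norm_pv_le R)
    (fun e => (norm_starMap _).trans_le (hn e.op)), starA_wordIn hy hy']

theorem starA_shift {R : PosReal} (G : PA ends R) (e : DEdge ends) :
    starA (shift R G e.op) = shift R (starA G) e := by
  rw [shift, shift, starA, starMap_add, ← starA, ← starA, starA_dcyc, PA.z, starA_mon, rev_single,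
    DEdge.op_op, PA.z]

theorem starM_jacR {R c : PosReal} (h2 : R.1 = 2 * c.1) (e : DEdge ends) (u : PA ends R) :
    starM (jacR R c e u) = jacR R c e.op (starA u) := by
  refine starMap_comp (fun γ => ?_) u
  change starM (jacR R c e (mon γ)) = jacR R c e.op (mon γ.rev)
  rw [jacR_mon h2, jacR_mon h2, splitSum_rev]
  refine (map_splitSum (starHom (revInvM ends R c)) _ _).trans ?_
  exact splitSum_congr fun a f b _ _ _ _ _ => starMap_mon _

theorem starM_jacM {R c : PosReal} (h2 : R.1 = 2 * c.1) (G : PA ends R) :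
    starM (jacM R c fun e => dcyc R e G) = jacM R c fun e => dcyc R e (starA G) := by
  rw [jacM, jacM, ← sum_comp_op fun e => jacR R c e (dcyc R e (starA G))]
  refine (map_sum (starHom (revInvM ends R c)) _ _).trans (Finset.sum_congr rfl fun e _ => ?_)
  exact (starM_jacR h2 e _).trans (by rw [starA_dcyc])

variable {wt : DEdge ends → ℝ} {R c s S : PosReal} {φ : PA ends c →L[ℂ] ℂ}

/-- The exchange of the legs in `starM` merely swaps the two summands of the partial trace. -/
theorem starA_ptr (hφ : PathLaw wt c φ) (hst : ∀ γ, φ (mon γ.rev) = star (φ (mon γ)))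
    (X : MA ends R c) : starA (ptr φ X : PA ends R) = ptr φ (starM X) := by
  classical
  refine starMap_comp (fun x => ?_) X
  change starA (ptr φ (mon x) : PA ends R) =
    ptr φ (mon (⟨x.row.op, x.col.op, x.snd.rev, x.fst.rev⟩ : MIdx ends))
  rw [hφ.ptr_mon, hφ.ptr_mon]
  by_cases h : x.row = x.col
  · rw [if_pos h, if_pos (congrArg DEdge.op h), starA, starMap_add, starMap_smul, starMap_smul,
      ← starA, ← starA, starA_mon, starA_mon, add_comm, hst, hst]
  · rw [if_neg h, if_neg fun h' => h (DEdge.op_injective h')]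
    exact map_zero (starHom (revInv ends R))

theorem starA_remainder (hφ : PathLaw wt c φ) (hst : ∀ γ, φ (mon γ.rev) = star (φ (mon γ)))
    (h2 : R.1 = 2 * c.1) (hR4 : 4 < R.1) (hs : s.1 = R.1 + 1 / R.1) (hsS : s.1 < S.1)
    {W : PA ends S} {G : PA ends R} (hG : ‖G‖ ≤ 1) :
    starA (remainder wt s φ W G) = remainder wt s φ (starA W) (starA G) := by
  have hR := R.2
  have hM : ‖jacM R c fun e => dcyc R e G‖ < 1 := by
    refine (norm_jacM_dcyc_le h2 G).trans_lt ?_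
    calc 4 / R.1 * (1 / R.1 * ‖G‖) ≤ 4 / 4 * (1 / 4 * 1) := by gcongr
      _ < 1 := by norm_num
  have hsh : (fun e => starA (shift R G e.op)) = shift R (starA G) := funext (starA_shift G)
  rw [remainder, remainder]
  refine (map_sub (starHom (revInv ends R)) _ _).trans ?_
  rw [map_add]
  congr 1
  · congr 1
    · refine (starA_sum _ _).trans (Finset.sum_congr rfl fun e _ => ?_)
      rw [starA_smul, starA_mul, starA_dcyc, starA_dcyc, DEdge.op_op]
    · have h3 := starA_evalA_res hsS.le (isRep_add_dcyc R G) (y := shift R G)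
        (by rw [hsh]; exact isRep_add_dcyc R _) (norm_shift_le hs hG) W
      rw [hsh] at h3
      exact h3
  · refine (starA_ptr hφ hst _).trans ?_
    rw [starM_logOne hM, starM_jacM h2]

/-- The adjoint of `G` lies in the unit ball and solves the equation for `W^* = W`, so uniqueness
identifies it with `G`. -/
theorem starA_potential (hφ : PathLaw wt c φ) (hst : ∀ γ, φ (mon γ.rev) = star (φ (mon γ)))
    (h2 : R.1 = 2 * c.1) (hR4 : 4 < R.1) (hw0 : ∀ e, 4 / R.1 ≤ wt e) (hs : s.1 = R.1 + 1 / R.1)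
    (hsS : s.1 < S.1) {W : PA ends S} (hW : starA W = W) {G : PA ends R} (hG : ‖G‖ ≤ 1)
    (hfix : -Lam wt R (remainder wt s φ W G) = G)
    (huniq : ∀ G', ‖G'‖ ≤ 1 → -Lam wt R (remainder wt s φ W G') = G' → G' = G) :
    starA G = G := by
  have hR := R.2
  refine huniq _ ((norm_starMap G).trans_le hG) ?_
  conv_rhs => rw [← hfix]
  have h3 := starA_remainder hφ hst h2 hR4 hs hsS (W := W) hG
  rw [hW] at h3
  rw [← h3, ← starA_Lam (m := 4 / R.1) (by positivity) hw0 hφ.wt_op]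
  exact (map_neg (starHom (revInv ends R)) _).symm

end Star
end
end FreeGraph

namespace FreeGraph
noncomputable section

open GPath WL1

/-! ### The operators on the Fock space -/

section Operators

variable {V E : Type*} {ends : E → Sym2 V}

open Classical in
/-- The basis vector of a path. -/
def bv (γ : GPath ends) : Fock ends := lp.single 2 γ (1 : ℂ)

theorem bv_apply_self (γ : GPath ends) : bv γ γ = 1 := by
  classical
  unfold bv
  rw [lp.single_apply, Pi.single_eq_same]

theorem bv_apply_ne {γ a : GPath ends} (h : a ≠ γ) : bv γ a = 0 := by
  classical
  unfold bv
  rw [lp.single_apply, Pi.single_eq_of_ne h]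

theorem inner_bv (γ : GPath ends) (ξ : Fock ends) : inner ℂ (bv γ) ξ = ξ γ := by
  classical
  unfold bv
  rw [lp.inner_single_left]
  simp

theorem norm_bv (γ : GPath ends) : ‖bv γ‖ = 1 := by
  classical
  unfold bv
  rw [lp.norm_single (by norm_num)]
  simp

theorem vac_eq (v : V) : (vac v : Fock ends) = bv (vertex v) := rfl

theorem pullback_apply {f : GPath ends → Option (GPath ends)} (hf) (ξ : Fock ends)
    (γ : GPath ends) : pullback f hf ξ γ = (f γ).elim 0 ξ := rfl

theorem norm_pullback_le {f : GPath ends → Option (GPath ends)} (hf) : ‖pullback f hf‖ ≤ 1 :=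
  LinearMap.mkContinuous_norm_le _ zero_le_one _

theorem pullback_bv {f g : GPath ends → Option (GPath ends)} (hf)
    (hfg : ∀ a b, f a = some b ↔ g b = some a) (γ : GPath ends) :
    pullback f hf (bv γ) = (g γ).elim 0 bv := by
  ext a
  rw [pullback_apply]
  cases ha : f a with
  | none =>
    cases hg : g γ with
    | none => rfl
    | some b =>
      refine (bv_apply_ne fun h => ?_).symm
      subst h
      rw [(hfg a γ).2 hg] at ha
      exact Option.some_ne_none _ ha
  | some c =>
    change bv γ c = _
    have h1 := (hfg a c).1 ha
    by_cases hc : c = γ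
    · subst hc
      rw [h1]
      exact (bv_apply_self c).trans (bv_apply_self a).symm
    · rw [bv_apply_ne hc]
      cases hg : g γ with
      | none => rfl
      | some b =>
        refine (bv_apply_ne fun h => hc ?_).symm
        subst h
        rw [(hfg a γ).2 hg] at ha
        exact (Option.some_injective _ ha).symm

theorem adjoint_pullback {f g : GPath ends → Option (GPath ends)} (hf) (hg)
    (hfg : ∀ a b, f a = some b ↔ g b = some a) :
    ContinuousLinearMap.adjoint (pullback f hf) = pullback g hg := by
  ext ξ a
  rw [← inner_bv, ContinuousLinearMap.adjoint_inner_right, pullback_bv hf hfg, pullback_apply]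
  cases g a with
  | none => exact inner_zero_left _
  | some b => exact inner_bv b ξ

open Classical in
/-- The path `eγ`, if it exists. -/
def prepend (e : DEdge ends) (γ : GPath ends) : Option (GPath ends) :=
  if h : e.tgt = γ.src then some (cons e γ h) else none

/-- The path `γe`. -/
def snoc (γ : GPath ends) (e : DEdge ends) (h : γ.tgt = e.src) : GPath ends :=
  comp γ (single e) h

theorem src_snoc (γ : GPath ends) (e : DEdge ends) (h) : (snoc γ e h).src = γ.src := rfl

theorem len_snoc (γ : GPath ends) (e : DEdge ends) (h) : (snoc γ e h).len = γ.len + 1 :=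
  List.length_append

theorem snoc_vertex (e : DEdge ends) (v : V) (h) :
    snoc (vertex v) e h = cons e (vertex e.tgt) (src_vertex _).symm := vertex_comp _ _ _

theorem snoc_cons (g : DEdge ends) (γ : GPath ends) (h) (e : DEdge ends) (h' : γ.tgt = e.src) (h1) :
    snoc (cons g γ h) e h1 = cons g (snoc γ e h') (h.trans (src_snoc γ e h').symm) := rfl

open Classical in
/-- The path `γe`, if it exists. -/
def append (e : DEdge ends) (γ : GPath ends) : Option (GPath ends) :=
  if h : γ.tgt = e.src then some (snoc γ e h) else none

theorem prepend_of {e : DEdge ends} {γ : GPath ends} (h : e.tgt = γ.src) :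
    prepend e γ = some (cons e γ h) := dif_pos h

theorem prepend_of_ne {e : DEdge ends} {γ : GPath ends} (h : e.tgt ≠ γ.src) :
    prepend e γ = none := dif_neg h

theorem append_of {e : DEdge ends} {γ : GPath ends} (h : γ.tgt = e.src) :
    append e γ = some (snoc γ e h) := dif_pos h

theorem append_of_ne {e : DEdge ends} {γ : GPath ends} (h : γ.tgt ≠ e.src) :
    append e γ = none := dif_neg h

theorem removeFirst_vertex (e : DEdge ends) (v : V) : removeFirst e (vertex v) = none := by
  simp [removeFirst, vertex]

theorem removeFirst_cons (e : DEdge ends) (γ : GPath ends) (h) :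
    removeFirst e (cons e γ h) = some γ := by
  have h1 : (cons e γ h).drop 1 = γ := by
    ext1
    · exact h
    · rfl
  rw [removeFirst, h1, if_pos (show (cons e γ h).edges.head? = some e from rfl)]

theorem removeFirst_cons_ne {e f : DEdge ends} (hf : f ≠ e) (γ : GPath ends) (h) :
    removeFirst e (cons f γ h) = none := by
  rw [removeFirst, if_neg]
  exact fun h' => hf (Option.some_injective _ h')

theorem removeFirst_iff (e : DEdge ends) (a b : GPath ends) :
    removeFirst e a = some b ↔ prepend e b = some a := by
  constructor
  · intro h
    induction a using GPath.induction with
    | hv v => rw [removeFirst_vertex] at h; exact absurd h.symm (Option.some_ne_none _)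
    | hc f γ h' ih =>
      by_cases hf : f = e
      · subst hf
        rw [removeFirst_cons] at h
        rw [← Option.some_injective _ h, prepend_of h']
      · rw [removeFirst_cons_ne hf] at h
        exact absurd h.symm (Option.some_ne_none _)
  · intro h
    by_cases hb : e.tgt = b.src
    · rw [prepend_of hb] at h
      rw [← Option.some_injective _ h, removeFirst_cons]
    · rw [prepend_of_ne hb] at h
      exact absurd h.symm (Option.some_ne_none _)

theorem prepend_inj (e : DEdge ends) (a b c : GPath ends) (ha : prepend e a = some c)
    (hb : prepend e b = some c) : a = b :=
  Option.some_injective _ (((removeFirst_iff e c a).2 ha).symm.trans ((removeFirst_iff e c b).2 hb))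

theorem append_inj (e : DEdge ends) (a b c : GPath ends) (ha : append e a = some c)
    (hb : append e b = some c) : a = b := by
  by_cases h1 : a.tgt = e.src
  · by_cases h2 : b.tgt = e.src
    · rw [append_of h1] at ha
      rw [append_of h2] at hb
      have h := Option.some_injective _ (ha.trans hb.symm)
      ext1
      · exact (src_snoc a e h1).symm.trans ((congrArg GPath.src h).trans (src_snoc b e h2))
      · exact List.append_cancel_right (congrArg GPath.edges h)
    · rw [append_of_ne h2] at hb
      exact absurd hb.symm (Option.some_ne_none _)
  · rw [append_of_ne h1] at ha
    exact absurd ha.symm (Option.some_ne_none _)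

theorem adjoint_creation (e : DEdge ends) :
    ContinuousLinearMap.adjoint (creation e) = pullback (prepend e) (prepend_inj e) :=
  adjoint_pullback _ _ (removeFirst_iff e)

theorem beginsAt_iff (v : V) (a b : GPath ends) : beginsAt v a = some b ↔ beginsAt v b = some a := by
  unfold beginsAt
  constructor <;>
  · intro h
    split_ifs at h with h1
    obtain rfl := Option.some_injective _ h
    rw [if_pos h1]

theorem star_proj (v : V) : star (proj v : Op ends) = proj v :=
  adjoint_pullback _ _ (beginsAt_iff v)

theorem proj_apply_of (v : V) (ξ : Fock ends) {γ : GPath ends} (h : γ.src = v) :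
    (proj v : Op ends) ξ γ = ξ γ := by
  rw [proj, pullback_apply, beginsAt, if_pos h]; rfl

theorem proj_apply_of_ne (v : V) (ξ : Fock ends) {γ : GPath ends} (h : γ.src ≠ v) :
    (proj v : Op ends) ξ γ = 0 := by
  rw [proj, pullback_apply, beginsAt, if_neg h]; rfl

theorem creation_vertex (e : DEdge ends) (ξ : Fock ends) (v : V) :
    creation e ξ (vertex v) = 0 := by
  rw [creation, pullback_apply, removeFirst_vertex]; rfl

theorem creation_cons (e : DEdge ends) (ξ : Fock ends) (γ : GPath ends) (h) :
    creation e ξ (cons e γ h) = ξ γ := by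
  rw [creation, pullback_apply, removeFirst_cons]; rfl

theorem creation_cons_ne {e f : DEdge ends} (hf : f ≠ e) (ξ : Fock ends) (γ : GPath ends) (h) :
    creation e ξ (cons f γ h) = 0 := by
  rw [creation, pullback_apply, removeFirst_cons_ne hf]; rfl

theorem proj_idem (v : V) : (proj v * proj v : Op ends) = proj v := by
  ext ξ γ
  change (proj v : Op ends) (proj v ξ) γ = proj v ξ γ
  by_cases h : γ.src = v
  · rw [proj_apply_of v _ h]
  · rw [proj_apply_of_ne v _ h, proj_apply_of_ne v _ h]

theorem proj_orth (v w : V) (hvw : v ≠ w) : (proj v * proj w : Op ends) = 0 := by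
  ext ξ γ
  change (proj v : Op ends) (proj w ξ) γ = 0
  by_cases h : γ.src = v
  · rw [proj_apply_of v _ h, proj_apply_of_ne w _ (h.trans_ne hvw)]
  · rw [proj_apply_of_ne v _ h]

theorem proj_mul_creation (e : DEdge ends) : proj e.src * creation e = creation e := by
  ext ξ γ
  change (proj e.src : Op ends) (creation e ξ) γ = creation e ξ γ
  induction γ using GPath.induction with
  | hv v =>
    rw [creation_vertex]
    by_cases h : v = e.src
    · rw [proj_apply_of _ _ (show (vertex v).src = e.src from h), creation_vertex]
    · rw [proj_apply_of_ne _ _ (show (vertex v).src ≠ e.src from h)]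
  | hc f γ h _ =>
    by_cases hf : f = e
    · subst hf
      rw [proj_apply_of _ _ (src_cons f γ h)]
    · rw [creation_cons_ne hf]
      by_cases h' : f.src = e.src
      · rw [proj_apply_of _ _ ((src_cons f γ h).trans h'), creation_cons_ne hf]
      · rw [proj_apply_of_ne _ _ (show (cons f γ h).src ≠ e.src from h')]

theorem creation_mul_proj (e : DEdge ends) : creation e * proj e.tgt = creation e := by
  ext ξ γ
  change creation e ((proj e.tgt : Op ends) ξ) γ = creation e ξ γ
  induction γ using GPath.induction with
  | hv v => rw [creation_vertex, creation_vertex]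
  | hc f γ h _ =>
    by_cases hf : f = e
    · subst hf
      rw [creation_cons, creation_cons, proj_apply_of _ _ h.symm]
    · rw [creation_cons_ne hf, creation_cons_ne hf]

theorem norm_creation_le (e : DEdge ends) : ‖creation e‖ ≤ 1 := norm_pullback_le _

theorem norm_proj_le (v : V) : ‖(proj v : Op ends)‖ ≤ 1 := norm_pullback_le _

theorem star_gen (μ : V → ℝ) (e : DEdge ends) : star (gen μ e) = gen μ e.op := by
  rw [gen, gen, star_add, star_smul, star_smul, add_comm, DEdge.op_op, DEdge.src_op, DEdge.tgt_op]
  congr 1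
  · rw [← ContinuousLinearMap.star_eq_adjoint, star_star]
    congr 1
    exact Complex.conj_ofReal _
  · rw [ContinuousLinearMap.star_eq_adjoint]
    congr 1
    exact Complex.conj_ofReal _

theorem proj_mul_adjoint_creation (e : DEdge ends) :
    proj e.src * ContinuousLinearMap.adjoint (creation e.op) =
      ContinuousLinearMap.adjoint (creation e.op) := by
  rw [← ContinuousLinearMap.star_eq_adjoint]
  conv_rhs => rw [← creation_mul_proj e.op, star_mul, star_proj]
  rfl

theorem adjoint_creation_mul_proj (e : DEdge ends) :
    ContinuousLinearMap.adjoint (creation e.op) * proj e.tgt =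
      ContinuousLinearMap.adjoint (creation e.op) := by
  rw [← ContinuousLinearMap.star_eq_adjoint]
  conv_rhs => rw [← proj_mul_creation e.op, star_mul, star_proj]
  rfl

theorem isRep_gen (μ : V → ℝ) : IsRep (proj : V → Op ends) (gen μ) where
  idem := proj_idem
  orth := proj_orth
  left e := by
    rw [gen, mul_add, mul_smul_comm, mul_smul_comm, proj_mul_creation, proj_mul_adjoint_creation]
  right e := by
    rw [gen, add_mul, smul_mul_assoc, smul_mul_assoc, creation_mul_proj, adjoint_creation_mul_proj]

/-- From `a³ b ≤ 1` follows `a / b ≤ (ab)⁻²`; take fourth roots. This bounds both coefficients of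
`x_ε` by `1 / μ(ε)`. -/
theorem rpow_quarter_le {a b : ℝ} (ha : 0 < a) (hb : 0 < b) (ha1 : a ≤ 1) (hb1 : b ≤ 1) :
    (a / b) ^ (1 / 4 : ℝ) ≤ 1 / Real.sqrt (a * b) := by
  have h0 : 0 < a * b := mul_pos ha hb
  have h1 : a / b ≤ (1 / Real.sqrt (a * b)) ^ (4 : ℕ) := by
    rw [div_pow, one_pow, show (4 : ℕ) = 2 * 2 from rfl, pow_mul, Real.sq_sqrt h0.le,
      div_le_div_iff₀ hb (by positivity)]
    have h2 : a ^ 3 * b ≤ 1 := mul_le_one₀ (pow_le_one₀ ha.le ha1) hb.le hb1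
    nlinarith
  calc (a / b) ^ (1 / 4 : ℝ) ≤ ((1 / Real.sqrt (a * b)) ^ (4 : ℕ)) ^ (1 / 4 : ℝ) := by gcongr
    _ = _ := by
      rw [← Real.rpow_natCast, ← Real.rpow_mul (by positivity)]
      norm_num

theorem norm_gen_le {μ : V → ℝ} (hμ : ∀ v, 0 < μ v) (hμ1 : ∀ v, μ v ≤ 1) (e : DEdge ends) :
    ‖gen μ e‖ ≤ 2 / edgeWeight μ e := by
  have h1 := rpow_quarter_le (hμ e.src) (hμ e.tgt) (hμ1 _) (hμ1 _)
  have h2 := rpow_quarter_le (hμ e.tgt) (hμ e.src) (hμ1 _) (hμ1 _)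
  have p1 := hμ e.src
  have p2 := hμ e.tgt
  rw [mul_comm] at h2
  have h3 : ‖ContinuousLinearMap.adjoint (creation e.op)‖ ≤ 1 := by
    rw [LinearIsometryEquiv.norm_map]; exact norm_creation_le _
  have h4 := norm_creation_le e
  rw [gen, edgeWeight]
  refine (norm_add_le _ _).trans ?_
  rw [norm_smul, norm_smul, Complex.norm_real, Complex.norm_real,
    Real.norm_of_nonneg (by positivity), Real.norm_of_nonneg (by positivity)]
  calc _ ≤ 1 / Real.sqrt (μ e.src * μ e.tgt) * 1 + 1 / Real.sqrt (μ e.src * μ e.tgt) * 1 := by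
        gcongr
    _ = _ := by ring

/-! ### The right annihilation operators -/

/-- The right annihilation operator of an edge. -/
def rightAnn (e : DEdge ends) : Op ends := pullback (append e) (append_inj e)

theorem rightAnn_apply (e : DEdge ends) (ξ : Fock ends) {γ : GPath ends} (h : γ.tgt = e.src) :
    rightAnn e ξ γ = ξ (snoc γ e h) := by
  rw [rightAnn, pullback_apply, append_of h]; rfl

theorem rightAnn_apply_ne (e : DEdge ends) (ξ : Fock ends) {γ : GPath ends} (h : γ.tgt ≠ e.src) :
    rightAnn e ξ γ = 0 := by
  rw [rightAnn, pullback_apply, append_of_ne h]; rfl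

theorem rightAnn_vac (e : DEdge ends) (v : V) : rightAnn e (vac v) = 0 := by
  ext γ
  change rightAnn e (vac v) γ = 0
  by_cases h : γ.tgt = e.src
  · rw [rightAnn_apply e _ h, vac_eq]
    refine bv_apply_ne fun h' => ?_
    have := congrArg len h'
    rw [len_snoc, len_vertex] at this
    omega
  · rw [rightAnn_apply_ne e _ h]

theorem rightAnn_proj (e : DEdge ends) (v : V) :
    rightAnn e * proj v = proj v * rightAnn e := by
  ext ξ γ
  change rightAnn e ((proj v : Op ends) ξ) γ = (proj v : Op ends) (rightAnn e ξ) γ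
  by_cases h : γ.tgt = e.src <;> by_cases hv : γ.src = v
  · rw [rightAnn_apply e _ h, proj_apply_of v _ hv, rightAnn_apply e _ h,
      proj_apply_of v _ ((src_snoc _ _ h).trans hv)]
  · rw [rightAnn_apply e _ h, proj_apply_of_ne v _ hv,
      proj_apply_of_ne v _ ((src_snoc _ _ h).trans_ne hv)]
  · rw [rightAnn_apply_ne e _ h, proj_apply_of v _ hv, rightAnn_apply_ne e _ h]
  · rw [rightAnn_apply_ne e _ h, proj_apply_of_ne v _ hv]

/-- Both composites read off the coefficient of `f γ e`; operations at opposite ends of a path do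
not interfere. -/
theorem rightAnn_adjoint (e f : DEdge ends) :
    rightAnn e * ContinuousLinearMap.adjoint (creation f) =
      ContinuousLinearMap.adjoint (creation f) * rightAnn e := by
  rw [adjoint_creation]
  ext ξ γ
  change rightAnn e (pullback (prepend f) (prepend_inj f) ξ) γ =
    pullback (prepend f) (prepend_inj f) (rightAnn e ξ) γ
  rw [pullback_apply]
  by_cases hf : f.tgt = γ.src
  · rw [prepend_of hf]
    change _ = rightAnn e ξ (cons f γ hf)
    by_cases h : γ.tgt = e.src
    · rw [rightAnn_apply e _ h, rightAnn_apply e _ ((tgt_cons f γ hf).trans h), pullback_apply,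
        prepend_of (hf.trans (src_snoc _ _ h).symm)]
      rfl
    · rw [rightAnn_apply_ne e _ h, rightAnn_apply_ne e _ ((tgt_cons f γ hf).trans_ne h)]
  · rw [prepend_of_ne hf]
    change _ = (0 : ℂ)
    by_cases h : γ.tgt = e.src
    · rw [rightAnn_apply e _ h, pullback_apply, prepend_of_ne fun h' => hf (h'.trans (src_snoc _ _ h))]
      rfl
    · rw [rightAnn_apply_ne e _ h]

theorem rightAnn_creation_ne {e f : DEdge ends} (hef : f ≠ e) :
    rightAnn e * creation f = creation f * rightAnn e := by
  ext ξ γ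
  change rightAnn e (creation f ξ) γ = creation f (rightAnn e ξ) γ
  induction γ using GPath.induction with
  | hv v =>
    rw [creation_vertex]
    by_cases h : v = e.src
    · subst h
      rw [rightAnn_apply e _ (show (vertex e.src).tgt = e.src from rfl), snoc_vertex,
        creation_cons_ne hef.symm]
    · rw [rightAnn_apply_ne e _ (show (vertex v).tgt ≠ e.src from h)]
  | hc g γ h _ =>
    by_cases ht : γ.tgt = e.src
    · rw [rightAnn_apply e _ ((tgt_cons g γ h).trans ht), snoc_cons g γ h e ht]
      by_cases hg : g = f
      · subst hg
        rw [creation_cons, creation_cons, rightAnn_apply e _ ht]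
      · rw [creation_cons_ne hg, creation_cons_ne hg]
    · rw [rightAnn_apply_ne e _ ((tgt_cons g γ h).trans_ne ht)]
      by_cases hg : g = f
      · subst hg
        rw [creation_cons, rightAnn_apply_ne e _ ht]
      · rw [creation_cons_ne hg]

/-- The ends interfere only on the path that consists of `e` alone, where the edge just created is
the one annihilated. This rank one defect is the source of the free difference quotient. -/
theorem rightAnn_creation (e : DEdge ends) (ξ : Fock ends) :
    rightAnn e (creation e ξ) = creation e (rightAnn e ξ) + ξ (vertex e.tgt) • bv (vertex e.src) := by
  ext γ
  change rightAnn e (creation e ξ) γ =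
    creation e (rightAnn e ξ) γ + ξ (vertex e.tgt) * bv (vertex e.src) γ
  induction γ using GPath.induction with
  | hv v =>
    rw [creation_vertex, zero_add]
    by_cases h : v = e.src
    · subst h
      rw [rightAnn_apply e _ (show (vertex e.src).tgt = e.src from rfl), snoc_vertex,
        creation_cons, bv_apply_self, mul_one]
    · rw [rightAnn_apply_ne e _ (show (vertex v).tgt ≠ e.src from h),
        bv_apply_ne (fun h' => h (congrArg GPath.src h')), mul_zero]
  | hc g γ h _ =>
    rw [bv_apply_ne (fun h' => by simpa using congrArg len h'), mul_zero, add_zero]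
    by_cases ht : γ.tgt = e.src
    · rw [rightAnn_apply e _ ((tgt_cons g γ h).trans ht), snoc_cons g γ h e ht]
      by_cases hg : g = e
      · subst hg
        rw [creation_cons, creation_cons, rightAnn_apply _ _ ht]
      · rw [creation_cons_ne hg, creation_cons_ne hg]
    · rw [rightAnn_apply_ne e _ ((tgt_cons g γ h).trans_ne ht)]
      by_cases hg : g = e
      · subst hg
        rw [creation_cons, rightAnn_apply_ne _ _ ht]
      · rw [creation_cons_ne hg]

end Operators
end
end FreeGraph

namespace FreeGraph
noncomputable section

open GPath WL1

/-! ### The law of the generators -/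

section GraphLaw

variable {V E : Type*} {ends : E → Sym2 V}

theorem proj_vac (v : V) : (proj v : Op ends) (vac v) = vac v := by
  ext γ
  change (proj v : Op ends) (vac v) γ = vac v γ
  by_cases h : γ.src = v
  · rw [proj_apply_of v _ h]
  · rw [proj_apply_of_ne v _ h, vac_eq, bv_apply_ne]
    exact fun h' => h (by rw [h', src_vertex])

theorem proj_vac_ne {v w : V} (h : v ≠ w) : (proj v : Op ends) (vac w) = 0 := by
  rw [← proj_vac w]
  change (proj v * proj w : Op ends) (vac w) = 0
  rw [proj_orth v w h]
  rfl

theorem norm_vac (v : V) : ‖(vac v : Fock ends)‖ = 1 := norm_bv _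

theorem condExp_star (T : Op ends) (v : V) : condExp (star T) v = star (condExp T v) := by
  rw [condExp, condExp, ContinuousLinearMap.star_eq_adjoint,
    ContinuousLinearMap.adjoint_inner_right]
  exact (inner_conj_symm _ _).symm

theorem condExp_mul_proj_ne {T : Op ends} {v w : V} (h : w ≠ v) : condExp (T * proj w) v = 0 := by
  rw [condExp]
  change inner ℂ (vac v) (T ((proj w : Op ends) (vac v))) = 0
  rw [proj_vac_ne h, map_zero, inner_zero_right]

theorem condExp_proj_mul_ne {T : Op ends} {v w : V} (h : w ≠ v) : condExp (proj w * T) v = 0 := by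
  have h1 := condExp_star (star T * proj w) v
  rw [star_mul, star_star, star_proj, condExp_mul_proj_ne h, star_zero] at h1
  exact h1

variable [Fintype V]

/-- The trace as a continuous linear functional. -/
def traceL (ends : E → Sym2 V) (μ : V → ℝ) : Op ends →L[ℂ] ℂ :=
  ∑ v, (μ v : ℂ) • (innerSL ℂ (vac v)).comp (ContinuousLinearMap.apply ℂ (Fock ends) (vac v))

theorem traceL_apply (μ : V → ℝ) (T : Op ends) : traceL ends μ T = trace μ T := by
  rw [traceL, sum_apply]
  rfl

theorem norm_trace_le {μ : V → ℝ} (hμ : ∀ v, 0 < μ v) (hμ1 : ∑ v, μ v = 1) (T : Op ends) :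
    ‖trace μ T‖ ≤ ‖T‖ := by
  rw [trace]
  calc _ ≤ ∑ v, μ v * ‖T‖ := norm_sum_le_of_le _ fun v _ => by
        rw [norm_mul, Complex.norm_real, Real.norm_of_nonneg (hμ v).le]
        refine mul_le_mul_of_nonneg_left ?_ (hμ v).le
        refine (norm_inner_le_norm _ _).trans ?_
        rw [norm_vac, one_mul]
        refine (T.le_opNorm _).trans_eq ?_
        rw [norm_vac, mul_one]
    _ = ‖T‖ := by rw [← Finset.sum_mul, hμ1, one_mul]

theorem trace_star (μ : V → ℝ) (T : Op ends) : trace μ (star T) = star (trace μ T) := by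
  rw [trace, trace, star_sum]
  refine Finset.sum_congr rfl fun v _ => ?_
  rw [condExp_star, star_mul', RCLike.star_def, Complex.conj_ofReal]

variable {μ : V → ℝ}

theorem trace_word_of_ne {y : DEdge ends → Op ends} (hy : IsRep proj y) {γ : GPath ends}
    (h : γ.src ≠ γ.tgt) : trace μ (wordIn proj y γ) = 0 := by
  classical
  refine Finset.sum_eq_zero fun v _ => ?_
  by_cases hv : γ.tgt = v
  · rw [← hy.src_mul_word, condExp_proj_mul_ne (hv ▸ h), mul_zero]
  · rw [← hy.word_mul_tgt, condExp_mul_proj_ne hv, mul_zero]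

theorem trace_mul_word {y : DEdge ends → Op ends} (hy : IsRep proj y) (γ : GPath ends) (T : Op ends) :
    trace μ (T * wordIn proj y γ) = μ γ.tgt * condExp (T * wordIn proj y γ) γ.tgt := by
  classical
  rw [trace, Finset.sum_eq_single_of_mem γ.tgt (Finset.mem_univ _)]
  intro v _ hv
  rw [← hy.word_mul_tgt, ← mul_assoc, condExp_mul_proj_ne hv.symm, mul_zero]

theorem star_word {y : DEdge ends → Op ends} (hy : IsRep proj y) (hst : ∀ e, star (y e) = y e.op)
    (γ : GPath ends) : star (wordIn proj y γ) = wordIn proj y γ.rev := by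
  induction γ using GPath.induction with
  | hv v => rw [IsRep.word_vertex, rev_vertex, IsRep.word_vertex, star_proj]
  | hc f γ h ih => rw [hy.word_cons, star_mul, ih, rev_cons, hy.word_comp, hy.word_single, hst]

variable {c : PosReal}

/-- The law of the generators, on `B_c`. -/
def genLaw (ends : E → Sym2 V) (μ : V → ℝ) (c : PosReal) : PA ends c →L[ℂ] ℂ :=
  (traceL ends μ).comp (evalA proj (gen μ) c)

section Law

variable (hμ : ∀ v, 0 < μ v) (hμ1 : ∑ v, μ v = 1)
  (hc : ∀ e : DEdge ends, 2 / edgeWeight μ e ≤ c.1)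

include hμ hμ1

theorem le_one_of_sum (v : V) : μ v ≤ 1 :=
  hμ1 ▸ Finset.single_le_sum (f := μ) (fun v _ => (hμ v).le) (Finset.mem_univ v)

include hc

theorem norm_gen_le_radius (e : DEdge ends) : ‖gen μ e‖ ≤ c.1 :=
  (norm_gen_le hμ (le_one_of_sum hμ hμ1) e).trans (hc e)

theorem genLaw_apply (u : PA ends c) :
    genLaw ends μ c u = trace μ (evalA proj (gen μ) c u) := traceL_apply μ _

theorem genLaw_mon (γ : GPath ends) :
    genLaw ends μ c (mon γ) = trace μ (wordIn proj (gen μ) γ) := by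
  rw [genLaw_apply hμ hμ1 hc, evalA_mon norm_proj_le (norm_gen_le_radius hμ hμ1 hc)]

theorem genLaw_rev (γ : GPath ends) :
    genLaw ends μ c (mon γ.rev) = star (genLaw ends μ c (mon γ)) := by
  rw [genLaw_mon hμ hμ1 hc, genLaw_mon hμ hμ1 hc, ← star_word (isRep_gen μ) (star_gen μ), trace_star]

theorem genLaw_of_ne {γ : GPath ends} (h : γ.src ≠ γ.tgt) : genLaw ends μ c (mon γ) = 0 := by
  rw [genLaw_mon hμ hμ1 hc, trace_word_of_ne (isRep_gen μ) h]

theorem genLaw_mon_eq (γ : GPath ends) {v : V} (h : γ.tgt = v) :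
    condExp (wordIn proj (gen μ) γ) v = genLaw ends μ c (mon γ) / μ v := by
  have h1 := trace_mul_word (μ := μ) (isRep_gen μ) γ 1
  have h2 : (μ v : ℂ) ≠ 0 := by exact_mod_cast (hμ v).ne'
  rw [one_mul, ← genLaw_mon hμ hμ1 hc, h] at h1
  rw [h1]
  field_simp

open Classical in
/-- The right annihilation operator is almost a derivation on words. -/
theorem rightAnn_word (e : DEdge ends) (γ : GPath ends) :
    rightAnn e (wordIn proj (gen μ) γ (vac e.tgt)) =
      splitSum γ fun a f b => if f = e then
        ((((μ e.src / μ e.tgt) ^ (1 / 4 : ℝ) : ℝ) : ℂ) *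
          condExp (wordIn proj (gen μ) b) e.tgt) • wordIn proj (gen μ) a (vac e.src) else 0 := by
  induction γ using GPath.induction with
  | hv v =>
    rw [IsRep.word_vertex, splitSum_vertex]
    change (rightAnn e * proj v : Op ends) (vac e.tgt) = 0
    rw [rightAnn_proj]
    change (proj v : Op ends) (rightAnn e (vac e.tgt)) = 0
    rw [rightAnn_vac, map_zero]
  | hc f γ h ih =>
    -- Moving past `x_f` leaves a vacuum term only for `f = e`; its coefficient is the vacuum
    -- coefficient of the word to the right of `f`.
    have h1 : ∀ ξ, rightAnn e (gen μ f ξ) = gen μ f (rightAnn e ξ) + if f = e then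
        ((((μ e.src / μ e.tgt) ^ (1 / 4 : ℝ) : ℝ) : ℂ) * ξ (vertex e.tgt)) • bv (vertex e.src)
        else 0 := fun ξ => by
      have h2 : rightAnn e (ContinuousLinearMap.adjoint (creation f.op) ξ) =
          ContinuousLinearMap.adjoint (creation f.op) (rightAnn e ξ) :=
        congrArg (fun T : Op ends => T ξ) (rightAnn_adjoint e f.op)
      rw [gen, add_apply, add_apply, smul_apply, smul_apply, smul_apply, smul_apply, map_add,
        map_smul, map_smul, h2]
      split_ifs with hf
      · subst hf
        rw [rightAnn_creation, smul_add, smul_smul]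
        abel
      · have h3 : rightAnn e (creation f ξ) = creation f (rightAnn e ξ) :=
          congrArg (fun T : Op ends => T ξ) (rightAnn_creation_ne hf)
        rw [h3, add_zero]
    rw [(isRep_gen μ).word_cons, splitSum_cons]
    change rightAnn e (gen μ f (wordIn proj (gen μ) γ (vac e.tgt))) = _
    rw [h1, ih, map_splitSum, add_comm]
    congr 1
    · split_ifs with hf
      · rw [IsRep.word_vertex, hf, proj_vac, ← inner_bv]
        rfl
      · rfl
    · refine splitSum_congr fun a g b h1 _ _ _ _ => ?_
      split_ifs
      · rw [map_smul, consD_eq (h.trans h1.symm), (isRep_gen μ).word_cons]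
        rfl
      · exact map_zero _

/-- Since `x_{e^op} = x_e^*`, the generator moves to the other vacuum vector, where only its
creation part survives and gives a multiple of the path `e`. The coefficient at that path is read
off by the right annihilation operator. -/
theorem gen_op_vac (e : DEdge ends) (X : Op ends) :
    condExp (gen μ e.op * X) e.tgt = (((μ e.src / μ e.tgt) ^ (1 / 4 : ℝ) : ℝ) : ℂ) *
      rightAnn e (X (vac e.tgt)) (vertex e.src) := by
  rw [condExp, ← star_gen μ e, ContinuousLinearMap.star_eq_adjoint]
  change inner ℂ (vac e.tgt) (ContinuousLinearMap.adjoint (gen μ e) (X (vac e.tgt))) = _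
  rw [ContinuousLinearMap.adjoint_inner_right, rightAnn_apply e _
    (show (vertex e.src : GPath ends).tgt = e.src from rfl), snoc_vertex]
  have h1 : creation e (vac e.tgt) = bv (cons e (vertex e.tgt) (src_vertex _).symm) := by
    rw [creation, vac_eq, pullback_bv _ (removeFirst_iff e), prepend_of (src_vertex _).symm]
    rfl
  have h2 : ContinuousLinearMap.adjoint (creation e.op) (vac e.tgt) = 0 := by
    rw [adjoint_creation, vac_eq, pullback_bv _ fun a b => (removeFirst_iff e.op b a).symm,
      removeFirst_vertex]
    rfl
  rw [gen, add_apply, smul_apply, smul_apply, h1, h2, smul_zero, add_zero, inner_smul_left,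
    inner_bv, Complex.conj_ofReal]

theorem genLaw_sd [DecidableEq (DEdge ends)] (e : DEdge ends) (γ : GPath ends) :
    (edgeWeight μ e : ℂ) * genLaw ends μ c (PA.z c e.op * mon γ) =
      splitSum γ fun a f b => if f = e then
        genLaw ends μ c (mon a) * genLaw ends μ c (mon b) else 0 := by
  have hrep := isRep_gen (ends := ends) μ
  have p1 := hμ e.src
  have p2 := hμ e.tgt
  -- Unless `γ` runs from `s(e)` to `t(e)`, both sides vanish because the law kills paths that are
  -- not closed.
  by_cases hγ : e.src = γ.src
  swap
  · rw [PA.z, PA.mon_mul_mon_of_ne (show (single e.op).tgt ≠ γ.src from hγ), map_zero, mul_zero,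
      splitSum_eq_zero]
    intro a f b h1 h2 _ _ _
    split_ifs with hf
    · rw [genLaw_of_ne hμ hμ1 hc, zero_mul]
      rw [h1, h2, hf]
      exact fun h => hγ h.symm
    · rfl
  by_cases hγ' : γ.tgt = e.tgt
  swap
  · rw [PA.z, PA.mon_mul_mon_of_eq (show (single e.op).tgt = γ.src from hγ), genLaw_of_ne hμ hμ1 hc,
      mul_zero, splitSum_eq_zero]
    · intro a f b _ _ h3 h4 _
      split_ifs with hf
      · rw [genLaw_of_ne hμ hμ1 hc (γ := b), mul_zero]
        rw [h4, ← h3, hf]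
        exact fun h => hγ' h.symm
      · rfl
    · rw [src_comp, tgt_comp]
      exact fun h => hγ' h.symm
  have h1 : genLaw ends μ c (PA.z c e.op * mon γ) =
      μ e.tgt * condExp (gen μ e.op * wordIn proj (gen μ) γ) e.tgt := by
    rw [PA.z, PA.mon_mul_mon_of_eq (show (single e.op).tgt = γ.src from hγ), genLaw_mon hμ hμ1 hc,
      hrep.word_comp, hrep.word_single, trace_mul_word hrep, hγ']
  rw [h1, gen_op_vac hμ hμ1 hc, rightAnn_word hμ hμ1 hc]
  have h2 : ∀ ξ : Fock ends, ξ (vertex e.src) = innerSL ℂ (bv (vertex e.src)) ξ := fun ξ =>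
    (inner_bv _ ξ).symm
  -- The coefficient enters twice, once from the adjoint and once from the commutator; the exponent
  -- `1/4` makes the product with `μ(e)` exactly the vertex weight needed to normalize the left
  -- factor.
  have hα : (edgeWeight μ e : ℂ) * (((μ e.src / μ e.tgt) ^ (1 / 4 : ℝ) : ℝ) : ℂ) ^ 2 = μ e.src := by
    have h3 : ((μ e.src / μ e.tgt) ^ (1 / 4 : ℝ)) ^ 2 = Real.sqrt (μ e.src / μ e.tgt) := by
      rw [Real.sqrt_eq_rpow, ← Real.rpow_natCast, ← Real.rpow_mul (by positivity)]
      norm_num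
    rw [← Complex.ofReal_pow, h3, edgeWeight, ← Complex.ofReal_mul, ← Real.sqrt_mul (by positivity),
      show μ e.src * μ e.tgt * (μ e.src / μ e.tgt) = μ e.src ^ 2 by field_simp,
      Real.sqrt_sq p1.le]
  rw [h2, map_splitSum, mul_splitSum, mul_splitSum, mul_splitSum]
  refine splitSum_congr fun a f b _ h4 _ h6 _ => ?_
  by_cases hf : f = e
  · subst hf
    rw [if_pos rfl, if_pos rfl, map_smul, smul_eq_mul,
      genLaw_mon_eq hμ hμ1 hc b (h6.trans hγ')]
    have h7 : innerSL ℂ (bv (vertex f.src)) (wordIn proj (gen μ) a (vac f.src)) =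
        genLaw ends μ c (mon a) / μ f.src := genLaw_mon_eq hμ hμ1 hc a h4
    rw [h7]
    have q1 : (μ f.src : ℂ) ≠ 0 := by exact_mod_cast p1.ne'
    have q2 : (μ f.tgt : ℂ) ≠ 0 := by exact_mod_cast p2.ne'
    field_simp
    rw [← hα]
    ring
  · rw [if_neg hf, if_neg hf, map_zero, mul_zero, mul_zero, mul_zero]

/-- The adjoint of `genLaw_sd`: reversal exchanges the two factors of each factorization, and the
scalars commute. -/
theorem genLaw_sd_right [DecidableEq (DEdge ends)] (e : DEdge ends) (γ : GPath ends) :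
    (edgeWeight μ e : ℂ) * genLaw ends μ c (mon γ * PA.z c e.op) =
      splitSum γ fun a f b => if f = e then
        genLaw ends μ c (mon a) * genLaw ends μ c (mon b) else 0 := by
  have h1 : genLaw ends μ c (mon γ * PA.z c e.op) =
      star (genLaw ends μ c (PA.z c e.op.op * mon γ.rev)) := by
    rw [PA.z, PA.z]
    by_cases h : γ.tgt = e.tgt
    · rw [PA.mon_mul_mon_of_eq (show γ.tgt = (single e.op).src from h),
        PA.mon_mul_mon_of_eq (show (single e.op.op).tgt = γ.rev.src from h.symm),
        ← genLaw_rev hμ hμ1 hc, rev_comp]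
      congr 3
      · exact (rev_rev γ).symm
    · rw [PA.mon_mul_mon_of_ne (show γ.tgt ≠ (single e.op).src from h),
        PA.mon_mul_mon_of_ne (show (single e.op.op).tgt ≠ γ.rev.src from Ne.symm h), map_zero,
        star_zero]
  have h2 : edgeWeight μ e.op = edgeWeight μ e := congrArg Real.sqrt (mul_comm _ _)
  have h3 := congrArg star (genLaw_sd hμ hμ1 hc e.op γ.rev)
  rw [star_mul', ← h1, h2, RCLike.star_def, Complex.conj_ofReal, splitSum_rev] at h3
  rw [h3]
  refine (map_splitSum (starRingEnd ℂ) γ _).trans ?_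
  refine splitSum_congr fun a f b _ _ _ _ _ => ?_
  by_cases hf : f = e
  · rw [if_pos (congrArg DEdge.op hf), if_pos hf, map_mul]
    change star _ * star _ = _
    rw [genLaw_rev hμ hμ1 hc, genLaw_rev hμ hμ1 hc, star_star, star_star, mul_comm]
  · rw [if_neg fun h => hf (DEdge.op_injective h), if_neg hf, map_zero]

/-- The left and right Schwinger–Dyson equations have the same right side and a nonzero weight, so a
generator can be moved cyclically; words follow by induction on their length. -/
theorem genLaw_mul_comm (u v : PA ends c) :
    genLaw ends μ c (u * v) = genLaw ends μ c (v * u) := by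
  classical
  have hz : ∀ (e : DEdge ends) (v : PA ends c),
      genLaw ends μ c (PA.z c e * v) = genLaw ends μ c (v * PA.z c e) := fun e v =>
    ext_apply (S := (genLaw ends μ c).comp (ContinuousLinearMap.mul ℂ (PA ends c) (PA.z c e)))
      (T := (genLaw ends μ c).comp ((ContinuousLinearMap.mul ℂ (PA ends c)).flip (PA.z c e))) (fun γ => by
        change genLaw ends μ c (PA.z c e * mon γ) = genLaw ends μ c (mon γ * PA.z c e)
        have h1 := genLaw_sd hμ hμ1 hc e.op γ
        rw [← genLaw_sd_right hμ hμ1 hc e.op γ, DEdge.op_op] at h1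
        refine mul_left_cancel₀ ?_ h1
        have p1 := hμ e.src
        have p2 := hμ e.tgt
        have : 0 < edgeWeight μ e.op := Real.sqrt_pos.2 (mul_pos p2 p1)
        exact_mod_cast this.ne') v
  have hp : ∀ (w : V) (v : PA ends c),
      genLaw ends μ c (PA.pv c w * v) = genLaw ends μ c (v * PA.pv c w) := fun w v =>
    ext_apply (S := (genLaw ends μ c).comp (ContinuousLinearMap.mul ℂ (PA ends c) (PA.pv c w)))
      (T := (genLaw ends μ c).comp ((ContinuousLinearMap.mul ℂ (PA ends c)).flip (PA.pv c w))) (fun γ => by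
        change genLaw ends μ c (PA.pv c w * mon γ) = genLaw ends μ c (mon γ * PA.pv c w)
        by_cases h1 : w = γ.src <;> by_cases h2 : γ.tgt = w
        · rw [PA.pv_mul_mon h1, PA.mon_mul_pv h2]
        · rw [PA.pv_mul_mon h1, PA.mon_mul_pv_of_ne h2, map_zero, genLaw_of_ne hμ hμ1 hc]
          exact fun h => h2 (h.symm.trans h1.symm)
        · rw [PA.pv_mul_mon_of_ne h1, PA.mon_mul_pv h2, map_zero, genLaw_of_ne hμ hμ1 hc]
          exact fun h => h1 (h2.symm.trans h.symm)
        · rw [PA.pv_mul_mon_of_ne h1, PA.mon_mul_pv_of_ne h2]) v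
  have hm : ∀ (γ : GPath ends) (v : PA ends c),
      genLaw ends μ c (mon γ * v) = genLaw ends μ c (v * mon γ) := fun γ => by
    induction γ using GPath.induction with
    | hv w => exact hp w
    | hc f γ h ih =>
      intro v
      rw [PA.mon_cons, mul_assoc, hz, mul_assoc, ih, mul_assoc]
  exact ext_apply (S := (genLaw ends μ c).comp ((ContinuousLinearMap.mul ℂ (PA ends c)).flip v))
      (T := (genLaw ends μ c).comp (ContinuousLinearMap.mul ℂ (PA ends c) v)) (fun γ => hm γ v) u

theorem pathLaw_genLaw : PathLaw (edgeWeight μ) c (genLaw ends μ c) where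
  bound γ := by
    rw [genLaw_mon hμ hμ1 hc]
    exact (norm_trace_le hμ hμ1 _).trans
      (norm_wordIn_le norm_proj_le (norm_gen_le_radius hμ hμ1 hc) γ)
  tracial := genLaw_mul_comm hμ hμ1 hc
  wt_op e := congrArg Real.sqrt (mul_comm _ _)
  sd := by
    classical
    exact genLaw_sd hμ hμ1 hc

end Law
end GraphLaw
end
end FreeGraph

namespace FreeGraph
noncomputable section

open PMon (pmul)
open GPath WL1

/-! ### Coefficients -/

section Coefficients

variable {V E : Type*} {ends : E → Sym2 V}

open Classical in
theorem mono_apply (γ a : GPath ends) :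
    mono γ a = if a = γ then 1 else 0 := by
  rw [mono, Pi.single_apply]

/-- The coefficients of an element of `B_r`. -/
def toS {r : PosReal} (u : PA ends r) : Series ends := fun γ => coef γ u

/-- The element of `B_r` with given coefficients. -/
def toA (r : PosReal) (c : Series ends) (h : MemB r.1 c) : PA ends r :=
  ofCoef (pw ends r) c (by simpa only [MemB, pw_apply] using h)

theorem toS_toA {r : PosReal} {c : Series ends} (h : MemB r.1 c) : toS (toA r c h) = c :=
  funext fun γ => by rw [toS, toA, coef_ofCoef]

theorem memB_toS {r : PosReal} (u : PA ends r) : MemB r.1 (toS u) := (hasSum_norm u).summable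

theorem toS_add {r : PosReal} (u v : PA ends r) : toS (u + v) = toS u + toS v :=
  funext fun γ => map_add (coef γ) u v

theorem toS_smul {r : PosReal} (t : ℂ) (u : PA ends r) : toS (t • u) = t • toS u :=
  funext fun γ => map_smul (coef γ) t u

theorem toS_sum {ι : Type*} {r : PosReal} (t : Finset ι) (u : ι → PA ends r) :
    toS (∑ i ∈ t, u i) = ∑ i ∈ t, toS (u i) := funext fun γ => by
  rw [Finset.sum_apply]
  exact map_sum (coef γ) u t

theorem toS_mon {r : PosReal} (γ : GPath ends) : toS (mon γ : PA ends r) = mono γ :=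
  funext fun a => by
    classical
    rw [mono_apply]
    exact coef_mon a γ

theorem toS_starA {r : PosReal} (u : PA ends r) : toS (starA u) = adjB (toS u) :=
  funext fun γ => coef_starMap u γ

theorem toS_injective {r : PosReal} {u v : PA ends r} (h : toS u = toS v) : u = v :=
  ext_coef fun γ => congrFun h γ

theorem ev_toS {r : PosReal} {y : DEdge ends → Op ends} (hy : ∀ e, ‖y e‖ ≤ r.1) (u : PA ends r) :
    ev y (toS u) = evalA proj y r u :=
  (lift_apply (evalA_bdd norm_proj_le hy) u).symm

theorem take_comp (a b : GPath ends) (h) : (comp a b h).take a.len = a := by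
  ext1
  · rfl
  · exact List.take_left

theorem drop_comp (a b : GPath ends) (h) : (comp a b h).drop a.len = b := by
  ext1
  · have h1 : (comp a b h).edges.take a.edges.length = a.edges := List.take_left
    change endpoint a.src ((comp a b h).edges.take a.edges.length) = b.src
    rw [h1]
    exact h
  · exact List.drop_left

open Classical in
theorem mulB_mono (a b γ : GPath ends) :
    mulB (mono a) (mono b) γ = if ∃ h, comp a b h = γ then 1 else 0 := by
  rw [mulB, mulMap]
  simp only [tensor, mono_apply]
  split_ifs with h
  · obtain ⟨h, rfl⟩ := h
    rw [Finset.sum_eq_single_of_mem a.len]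
    · rw [take_comp, drop_comp, if_pos rfl, if_pos rfl, mul_one]
    · rw [Finset.mem_range, len_comp]; omega
    · intro i hi hne
      rw [if_neg, zero_mul]
      intro h'
      rw [Finset.mem_range] at hi
      exact hne (by rw [← h', len_take (by omega)])
  · refine Finset.sum_eq_zero fun i _ => ?_
    by_cases h1 : γ.take i = a
    · by_cases h2 : γ.drop i = b
      · subst h1 h2
        exact absurd ⟨_, take_comp_drop i γ⟩ h
      · rw [if_neg h2, mul_zero]
    · rw [if_neg h1, zero_mul]

theorem coef_mon_mul_mon [Fintype V] {r : PosReal} (a b γ : GPath ends) :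
    coef γ (mon a * mon b : PA ends r) = mulB (mono a) (mono b) γ := by
  classical
  rw [mulB_mono]
  by_cases h : a.tgt = b.src
  · rw [PA.mon_mul_mon_of_eq h, coef_mon]
    by_cases h1 : γ = comp a b h
    · rw [if_pos h1, if_pos ⟨h, h1.symm⟩]
    · rw [if_neg h1, if_neg]
      rintro ⟨_, h2⟩
      exact h1 h2.symm
  · rw [PA.mon_mul_mon_of_ne h, map_zero, if_neg]
    rintro ⟨h', _⟩
    exact h h'

theorem toS_mul [Fintype V] {r : PosReal} (u v : PA ends r) :
    toS (u * v) = mulB (toS u) (toS v) := funext fun γ => by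
  have h := ext_apply₂
    (S := (ContinuousLinearMap.compL ℂ (PA ends r) (PA ends r) ℂ (coef γ)).comp
      (ContinuousLinearMap.mul ℂ (PA ends r)))
    (T := ∑ i ∈ Finset.range (γ.len + 1), (ContinuousLinearMap.mul ℂ ℂ).bilinearComp
      (coef (γ.take i) : PA ends r →L[ℂ] ℂ) (coef (γ.drop i) : PA ends r →L[ℂ] ℂ))
    (fun a b => ?_) u v
  · rw [sum_apply, sum_apply] at h
    exact h
  · rw [sum_apply, sum_apply]
    refine (coef_mon_mul_mon a b γ).trans ?_
    rw [← toS_mon (r := r) a, ← toS_mon (r := r) b]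
    rfl

theorem join_eq (a : GPath ends) (e : DEdge ends) (b : GPath ends) (ha : a.tgt = e.src)
    (hb : e.tgt = b.src) : a.join e b ⟨ha, hb⟩ = comp a (cons e b hb) ha := rfl

/-- Every other factorization of `a e b` has a shorter left or a shorter right factor, so `hF`
removes it. -/
theorem join_inj_split {a b : GPath ends} {e : DEdge ends} (h : a.tgt = e.src ∧ e.tgt = b.src)
    {X : Type*} [AddCommMonoid X] {F : GPath ends → DEdge ends → GPath ends → X}
    (hF : ∀ a' f b', (a', f, b') ≠ (a, e, b) → F a' f b' = 0) :
    splitSum (a.join e b h) F = F a e b := by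
  rw [join_eq a e b h.1 h.2, splitSum_comp a (cons e b h.2) h.1, splitSum_eq_zero (γ := a), zero_add, splitSum_cons,
    splitSum_eq_zero (γ := b), add_zero]
  · rw [compD_eq (show a.tgt = (vertex e.src).src from h.1)]
    exact congrArg (F · e b) (comp_vertex _ _ _)
  · intro b₁ f b₂ _ _ _ _ h5
    refine hF _ _ _ fun h' => ?_
    simp only [Prod.mk.injEq] at h'
    have := congrArg len h'.2.2
    omega
  · intro a₁ f a₂ _ _ _ h4 h5
    refine hF _ _ _ fun h' => ?_
    simp only [Prod.mk.injEq] at h'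
    have := congrArg len h'.1
    omega

theorem dq_mono (e : DEdge ends) (γ a' b' : GPath ends) [DecidableEq (DEdge ends)] :
    dq e (mono γ) a' b' =
      splitSum γ fun a f b => if f = e then mono a a' * mono b b' else 0 := by
  classical
  have h0 : ∀ a f b, (a, f, b) ≠ (a', e, b') →
      (if f = e then mono a a' * mono b b' else 0 : ℂ) = 0 := fun a f b h => by
    split_ifs with hf
    · rw [mono_apply, mono_apply]
      by_cases ha : a' = a
      · by_cases hb : b' = b
        · exact absurd (by rw [ha, hb, hf]) h
        · rw [if_neg hb, mul_zero]
      · rw [if_neg ha, zero_mul]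
    · rfl
  rw [dq]
  split_ifs with h
  · rw [mono_apply]
    split_ifs with h1
    · rw [← h1, join_inj_split h h0, if_pos rfl, mono_apply, mono_apply, if_pos rfl, if_pos rfl,
        mul_one]
    · symm
      refine (splitSum_congr_comp (G := fun _ _ _ => (0 : ℂ)) fun a f b ha hb hγ => h0 a f b ?_).trans
        (splitSum_eq_zero fun _ _ _ _ _ _ _ _ => rfl)
      intro h2
      simp only [Prod.mk.injEq] at h2
      obtain ⟨rfl, rfl, rfl⟩ := h2
      exact h1 hγ
  · symm
    refine splitSum_eq_zero fun a f b _ h2 h3 _ _ => h0 a f b fun h4 => ?_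
    simp only [Prod.mk.injEq] at h4
    obtain ⟨rfl, rfl, rfl⟩ := h4
    exact h ⟨h2, h3⟩

theorem cyc_mono (e : DEdge ends) (γ : GPath ends) [DecidableEq (DEdge ends)] :
    cyc e (mono γ) = fun a' =>
      splitSum γ fun a f b => if f = e.op then mulB (mono b) (mono a) a' else 0 := funext fun a' => by
  rw [cyc, mulMap]
  simp only [flip, dq_mono]
  refine (splitSum_sum _ _ _).symm.trans ?_
  refine splitSum_congr fun a f b _ _ _ _ _ => ?_
  split_ifs
  · rw [mulB, mulMap]
    simp only [tensor, mul_comm]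
  · exact Finset.sum_const_zero

/-- Each coefficient of a cyclic derivative is a finite sum of coefficients, hence continuous, so
monomials suffice. The factor `κ` covers `cycA` with `κ = 1` and `dcyc` with the inverse length. -/
theorem toS_eq_cyc [Fintype V] [DecidableEq (DEdge ends)] {r s : PosReal} {e : DEdge ends}
    {D : PA ends r →L[ℂ] PA ends s} {κ : GPath ends → ℂ} {K : PA ends r →L[ℂ] PA ends r}
    (hD : ∀ γ, D (mon γ) = κ γ • splitSum γ fun a f b => if f = e.op then mon b * mon a else 0)
    (hK : ∀ γ, K (mon γ) = κ γ • mon γ) (u : PA ends r) : toS (D u) = cyc e (toS (K u)) := by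
  classical
  funext γ
  let L : PA ends r →L[ℂ] ℂ := ∑ i ∈ Finset.range (γ.len + 1),
    if h : (γ.drop i).tgt = e.op.src ∧ e.op.tgt = (γ.take i).src then
      coef ((γ.drop i).join e.op (γ.take i) h) else 0
  have hL : ∀ u, L u = cyc e (toS u) γ := fun u => by
    rw [cyc, mulMap]
    simp only [L]
    rw [sum_apply]
    refine Finset.sum_congr rfl fun i _ => ?_
    simp only [flip, dq]
    split_ifs <;> rfl
  rw [← hL]
  refine ext_apply (S := (coef γ).comp D) (T := L.comp K) (fun w => ?_) u
  change coef γ (D (mon w)) = L (K (mon w))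
  rw [hD, hK, map_smul, map_smul, hL, toS_mon, cyc_mono, map_splitSum]
  congr 1
  refine splitSum_congr fun a f b _ _ _ _ _ => ?_
  split_ifs
  · exact coef_mon_mul_mon b a γ
  · exact map_zero _

end Coefficients

/-! ### Cyclic derivatives and the potential as formal series. -/

section Translation

variable {V E : Type*} {ends : E → Sym2 V} [Fintype V]

theorem toS_cycA {S s : PosReal} (h : s.1 < S.1) (e : DEdge ends) (u : PA ends S) :
    toS (cycA S s e u) = cyc e (toS u) := by
  classical
  refine toS_eq_cyc (κ := fun _ => 1) (K := ContinuousLinearMap.id ℂ _) (fun γ => ?_)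
    (fun γ => (one_smul ℂ _).symm) u
  rw [cycA_mon h, one_smul]

theorem pv_mul_cycA {S s : PosReal} (h : s.1 < S.1) (e : DEdge ends) (u : PA ends S) :
    PA.pv s e.src * cycA S s e u = cycA S s e u := by
  classical
  refine ext_apply (S := (ContinuousLinearMap.mul ℂ (PA ends s) (PA.pv s e.src)).comp (cycA S s e))
    (T := cycA S s e) (fun γ => ?_) u
  change PA.pv s e.src * cycA S s e (mon γ) = cycA S s e (mon γ)
  rw [cycA_mon h, mul_splitSum]
  refine splitSum_congr fun a f b _ _ h _ _ => ?_
  split_ifs with hf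
  · subst hf
    rw [← mul_assoc, PA.pv_mul_mon (show e.src = b.src from h)]
  · rw [mul_zero]

theorem cycA_mul_pv {S s : PosReal} (h : s.1 < S.1) (e : DEdge ends) (u : PA ends S) :
    cycA S s e u * PA.pv s e.tgt = cycA S s e u := by
  classical
  refine ext_apply (S := ((ContinuousLinearMap.mul ℂ (PA ends s)).flip (PA.pv s e.tgt)).comp
    (cycA S s e)) (T := cycA S s e) (fun γ => ?_) u
  change cycA S s e (mon γ) * PA.pv s e.tgt = cycA S s e (mon γ)
  rw [cycA_mon h, splitSum_mul]
  refine splitSum_congr fun a f b _ h _ _ _ => ?_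
  split_ifs with hf
  · subst hf
    rw [mul_assoc, PA.mon_mul_pv (show a.tgt = e.tgt from h)]
  · rw [zero_mul]

theorem starA_cycA {S s : PosReal} (h : s.1 < S.1) (e : DEdge ends) (u : PA ends S) :
    starA (cycA S s e u) = cycA S s e.op (starA u) := by
  classical
  refine starMap_comp (fun γ => ?_) u
  change starA (cycA S s e (mon γ)) = cycA S s e.op (mon γ.rev)
  rw [cycA_mon h, cycA_mon h, splitSum_rev, starA_splitSum]
  refine splitSum_congr fun a f b _ _ _ _ _ => ?_
  by_cases h : f = e.op
  · rw [if_pos h, if_pos (congrArg DEdge.op h), starA_mul, starA_mon, starA_mon]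
  · rw [if_neg h, if_neg fun h' => h (DEdge.op_injective h')]
    exact map_zero (starHom (revInv ends s))

/-- The inverse of the number operator. -/
def numInv (R : PosReal) : PA ends R →L[ℂ] PA ends R := lift fun γ => (γ.len : ℂ)⁻¹ • mon γ

theorem numInv_mon (R : PosReal) (γ : GPath ends) :
    numInv R (mon γ) = (γ.len : ℂ)⁻¹ • (mon γ : PA ends R) :=
  lift_mon ⟨1, fun γ => by
    rw [norm_smul, norm_inv, Complex.norm_natCast, norm_mon]
    exact mul_le_mul_of_nonneg_right (Nat.cast_inv_le_one γ.len) ((pw ends R).pos γ).le⟩ γ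

variable [Finite E]

theorem toS_dcyc (R : PosReal) (e : DEdge ends) (u : PA ends R) :
    toS (dcyc R e u) = cyc e (toS (numInv R u)) := by
  classical
  refine toS_eq_cyc (κ := fun γ => (γ.len : ℂ)⁻¹) (fun γ => ?_) (fun γ => numInv_mon R γ) u
  rw [dcyc_mon]

theorem starA_quad {S : PosReal} (wt : DEdge ends → ℝ) : starA (quad wt S) = quad wt S := by
  rw [quad]
  refine (starA_sum _ _).trans (Finset.sum_congr rfl fun e _ => ?_)
  rw [starA_smul, starA_mul, PA.z, PA.z, starA_mon, starA_mon]
  rfl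

theorem toS_quad (μ : V → ℝ) (S : PosReal) :
    toS (quad (edgeWeight μ) S : PA ends S) = potential ends μ := by
  rw [quad, potential, toS_sum]
  refine Finset.sum_congr rfl fun e _ => ?_
  rw [toS_smul, toS_mul, PA.z, PA.z, ← toS_mon (r := S), ← toS_starA, starA_mon]
  rfl

theorem cycA_quad {S s : PosReal} (h : s.1 < S.1) {wt : DEdge ends → ℝ}
    (hop : ∀ e, wt e.op = wt e) (e : DEdge ends) :
    cycA S s e (quad wt S) = (wt e : ℂ) • PA.z s e := by
  classical
  -- Either letter can be removed; after summation over `f` the two halves of the weight add up.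
  have h1 : ∀ f : DEdge ends, cycA S s e (PA.z S f.op * PA.z S f) =
      (if f = e then PA.z s e else 0) + if f = e.op then PA.z s e else 0 := fun f => by
    rw [PA.z.eq_1 S f, ← PA.mon_cons f.op (single f) rfl, cycA_mon h,
      splitSum_cons f.op (single f) (show f.op.tgt = (single f).src from rfl), single_eq_cons, splitSum_cons, splitSum_vertex, add_zero]
    congr 1
    · by_cases hf : f = e
      · subst hf
        rw [if_pos rfl, if_pos rfl]
        exact PA.mon_mul_pv rfl
      · rw [if_neg hf, if_neg fun h' => hf (DEdge.op_injective h')]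
    · by_cases hf : f = e.op
      · subst hf
        rw [if_pos rfl, if_pos rfl, consD_eq (show e.op.op.tgt = (vertex e.op.src).src from rfl)]
        exact PA.pv_mul_mon rfl
      · rw [if_neg hf, if_neg hf]
  rw [quad, map_sum]
  simp only [map_smul, h1, smul_add, Finset.sum_add_distrib, smul_ite, smul_zero,
    Finset.sum_ite_eq', Finset.mem_univ, if_true]
  rw [hop, ← add_smul]
  congr 1
  push_cast
  ring

end Translation
end
end FreeGraph

namespace FreeGraph
noncomputable section

open PMon (pmul)
open GPath WL1

/-! ### Composition of evaluations -/

section Evaluations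

variable {V E : Type*} {ends : E → Sym2 V} [Fintype V] {B : Type*} [NormedRing B]
  [NormedAlgebra ℂ B] [CompleteSpace B] {p : V → B} {x : DEdge ends → B} {R s c : PosReal}
  (hp : ∀ v, ‖p v‖ ≤ 1) (hrep : IsRep p x) (hx : ∀ e, ‖x e‖ ≤ R.1)

include hp hx

theorem evalA_pv (v : V) : evalA p x R (PA.pv R v) = p v := by
  rw [PA.pv, evalA_mon hp hx, IsRep.word_vertex]

theorem evalA_res (hc : c.1 ≤ R.1) (hx' : ∀ e, ‖x e‖ ≤ c.1) (u : PA ends R) :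
    evalA p x c (res R c u) = evalA p x R u :=
  ext_apply (S := (evalA p x c).comp (res R c)) (T := evalA p x R) (fun γ => by
    change evalA p x c (res R c (mon γ)) = _
    rw [res_mon hc, evalA_mon hp hx', evalA_mon hp hx]) u

include hrep

theorem evalA_z (e : DEdge ends) : evalA p x R (PA.z R e) = x e := by
  rw [PA.z, evalA_mon hp hx, hrep.word_single]

variable {y : DEdge ends → PA ends R} (hy : IsRep (PA.pv R) y)

include hy

theorem evalA_isRep : IsRep p fun e => evalA p x R (y e) where
  idem := hrep.idem
  orth := hrep.orth
  left e := by
    conv_rhs => rw [← hy.left, evalA_mul hrep hp hx, evalA_pv hp hx]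
  right e := by
    conv_rhs => rw [← hy.right, evalA_mul hrep hp hx, evalA_pv hp hx]

theorem evalA_wordIn (γ : GPath ends) : evalA p x R (wordIn (PA.pv R) y γ) =
    wordIn p (fun e => evalA p x R (y e)) γ := by
  induction γ using GPath.induction with
  | hv v => rw [IsRep.word_vertex, IsRep.word_vertex, evalA_pv hp hx]
  | hc f γ h ih =>
    rw [hy.word_cons, (evalA_isRep hp hrep hx hy).word_cons, evalA_mul hrep hp hx, ih]

theorem evalA_evalA (hys : ∀ e, ‖y e‖ ≤ s.1) (u : PA ends s) :
    evalA p x R (evalA (PA.pv R) y s u) = evalA p (fun e => evalA p x R (y e)) s u :=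
  ext_apply (S := (evalA p x R).comp (evalA (PA.pv R) y s))
    (T := evalA p (fun e => evalA p x R (y e)) s) (fun γ => by
      change evalA p x R (evalA (PA.pv R) y s (mon γ)) = _
      rw [evalA_mon (PA.norm_pv_le R) hys, evalA_mon hp (fun e => (norm_evalA_le hp hx _).trans
        (hys e)), evalA_wordIn hp hrep hx hy]) u

end Evaluations

section FockEvaluations

variable {V E : Type*} {ends : E → Sym2 V} [Fintype V] {s : PosReal} {y : DEdge ends → Op ends}

theorem star_evalA (hy : IsRep proj y) (hs : ∀ e, ‖y e‖ ≤ s.1) (hst : ∀ e, star (y e) = y e.op)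
    (u : PA ends s) : star (evalA proj y s u) = evalA proj y s (starA u) := by
  have h1 := (hasSum_lift (evalA_bdd norm_proj_le hs) u).star
  have h2 := hasSum_lift (evalA_bdd (s := s) norm_proj_le hs) (starA u)
  have h3 := (Equiv.hasSum_iff (Function.Involutive.toPerm (rev : GPath ends → GPath ends)
    rev_rev)).2 h2
  refine h1.unique (Eq.mp (congrArg (HasSum · _) (funext fun γ => ?_)) h3)
  change coef γ.rev (starA u) • wordIn proj y γ.rev = star (coef γ u • wordIn proj y γ)
  rw [star_smul, star_word hy hst, starA, coef_starMap]
  refine congrArg (fun a => star (coef a u) • wordIn proj y γ.rev) (rev_rev γ)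

theorem evalA_mem_graphAlgebra {μ : V → ℝ} (hs : ∀ e : DEdge ends, ‖gen μ e‖ ≤ s.1)
    (u : PA ends s) : evalA proj (gen μ) s u ∈ graphAlgebra ends μ := by
  have hsub : ∀ T ∈ Set.range (proj : V → Op ends) ∪ Set.range (gen μ : DEdge ends → Op ends),
      T ∈ graphAlgebra ends μ := fun T hT =>
    StarSubalgebra.le_topologicalClosure _ (StarAlgebra.subset_adjoin ℂ _ hT)
  have hw : ∀ γ : GPath ends, wordIn proj (gen μ) γ ∈ graphAlgebra ends μ := fun γ => by
    refine mul_mem (hsub _ (Or.inl ⟨_, rfl⟩)) (list_prod_mem fun T hT => ?_)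
    obtain ⟨e, _, rfl⟩ := List.mem_map.1 hT
    exact hsub _ (Or.inr ⟨e, rfl⟩)
  have h1 := hasSum_lift (evalA_bdd norm_proj_le hs) u
  exact (StarSubalgebra.isClosed_topologicalClosure _).mem_of_tendsto h1
    (Filter.Eventually.of_forall fun t => sum_mem fun γ _ =>
      (graphAlgebra ends μ).smul_mem (hw γ) _)

end FockEvaluations

/-! ### From words to polynomials -/

section SchwingerDyson

variable {V E : Type*} {ends : E → Sym2 V}

open Classical in
theorem hasSum_dq_mono (e : DEdge ends) (γ : GPath ends) (F : GPath ends → ℂ) :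
    HasSum (fun p : GPath ends × GPath ends => dq e (mono γ) p.1 p.2 * (F p.1 * F p.2))
      (splitSum γ fun a f b => if f = e then F a * F b else 0) := by
  simp only [dq_mono, splitSum_mul]
  refine hasSum_sum fun i _ => ?_
  by_cases h : γ.edges[i] = e
  · simp only [if_pos h, mono_apply]
    refine Eq.mp (congrArg (HasSum _) ?_)
      (hasSum_single (γ.take i, γ.drop (i + 1)) fun p hp => ?_)
    · simp
    · by_cases h1 : p.1 = γ.take i
      · rw [if_neg (c := p.2 = _) fun h2 => hp (Prod.ext h1 h2), mul_zero, zero_mul]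
      · rw [if_neg h1, zero_mul, zero_mul]
  · simp only [if_neg h, zero_mul]
    exact hasSum_zero

theorem dq_sum {ι : Type*} (t : Finset ι) (e : DEdge ends) (c : ι → Series ends)
    (a b : GPath ends) : dq e (∑ i ∈ t, c i) a b = ∑ i ∈ t, dq e (c i) a b := by
  simp only [dq]
  split_ifs
  · rw [Finset.sum_apply]
  · exact Finset.sum_const_zero.symm

theorem dq_smul (t : ℂ) (e : DEdge ends) (c : Series ends) (a b : GPath ends) :
    dq e (t • c) a b = t * dq e c a b := by
  simp only [dq]
  split_ifs
  · rfl
  · exact (mul_zero t).symm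

theorem IsPoly.eq_sum {q : Series ends} (hq : IsPoly q) :
    q = ∑ γ ∈ Set.Finite.toFinset hq, q γ • mono γ := by
  classical
  funext a
  simp only [Finset.sum_apply, Pi.smul_apply, mono_apply, smul_eq_mul, mul_ite, mul_one, mul_zero]
  rw [Finset.sum_ite_eq]
  split_ifs with h
  · rfl
  · by_contra h'
    exact h ((Set.Finite.mem_toFinset hq).2 h')

variable [Fintype V] {μ : V → ℝ} {S s : PosReal} {y : DEdge ends → Op ends}

theorem law_mono (hy : ∀ e, ‖y e‖ ≤ s.1) (γ : GPath ends) :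
    law μ y (mono γ) = trace μ (wordIn proj y γ) := by
  rw [law, ← toS_mon (r := s), ev_toS hy, evalA_mon norm_proj_le hy]

open Classical in
/-- The Schwinger–Dyson equation for words implies it for all polynomials. -/
theorem hasSum_schwingerDyson (hrep : IsRep proj y) (hy : ∀ e, ‖y e‖ ≤ s.1) (hsS : s.1 < S.1)
    {U : PA ends S}
    (hSD : ∀ e γ, γ.src = e.src → γ.tgt = e.tgt →
      trace μ (evalA proj y s (cycA S s e.op (starA U)) * wordIn proj y γ) =
        splitSum γ fun a f b => if f = e then
          trace μ (wordIn proj y a) * trace μ (wordIn proj y b) else 0)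
    (e : DEdge ends) {q : Series ends} (hq : IsPoly q) :
    HasSum (fun p : GPath ends × GPath ends =>
      dq e q p.1 p.2 * (law μ y (mono p.1) * law μ y (mono p.2)))
      (law μ y (mulB (adjB (cyc e (toS U))) q)) := by
  -- For words that do not run from `s(e)` to `t(e)` both sides vanish by orthogonality of the
  -- projections.
  have h1 : ∀ γ : GPath ends,
      trace μ (evalA proj y s (cycA S s e.op (starA U)) * wordIn proj y γ) =
        splitSum γ fun a f b => if f = e then
          trace μ (wordIn proj y a) * trace μ (wordIn proj y b) else 0 := fun γ => by
    by_cases h2 : γ.src = e.src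
    · by_cases h3 : γ.tgt = e.tgt
      · exact hSD e γ h2 h3
      · rw [← pv_mul_cycA hsS, evalA_mul hrep norm_proj_le hy, evalA_pv norm_proj_le hy,
          splitSum_eq_zero]
        · refine Finset.sum_eq_zero fun v _ => ?_
          by_cases hv : γ.tgt = v
          · rw [mul_assoc, condExp_proj_mul_ne (show e.op.src ≠ v from fun h => h3 (hv.trans h.symm)),
              mul_zero]
          · rw [← hrep.word_mul_tgt, ← mul_assoc, condExp_mul_proj_ne hv, mul_zero]
        · intro a f b _ _ h4 h5 _
          split_ifs with hf
          · rw [trace_word_of_ne hrep (γ := b), mul_zero]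
            rw [h5, ← h4, hf]
            exact fun h => h3 h.symm
          · rfl
    · rw [← cycA_mul_pv hsS, evalA_mul hrep norm_proj_le hy, evalA_pv norm_proj_le hy, mul_assoc,
        hrep.ne_mul_word (show e.op.tgt ≠ γ.src from Ne.symm h2), mul_zero, splitSum_eq_zero]
      · exact (traceL_apply μ _).symm.trans (map_zero _)
      · intro a f b h4 h5 _ _ _
        split_ifs with hf
        · rw [trace_word_of_ne hrep (γ := a), zero_mul]
          rw [h4, h5, hf]
          exact h2
        · rfl
  have h2 : law μ y (mulB (adjB (cyc e (toS U))) q) = ∑ γ ∈ Set.Finite.toFinset hq, q γ *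
      splitSum γ fun a f b => if f = e then law μ y (mono a) * law μ y (mono b) else 0 := by
    let q' : PA ends s := ∑ γ ∈ Set.Finite.toFinset hq, q γ • mon γ
    have h3 : q = toS q' := by
      conv_lhs => rw [hq.eq_sum]
      simp only [q', toS_sum, toS_smul, toS_mon]
    -- Since `(𝒟_e U)^* = 𝒟_{e^op}(U^*)`, the equation for `U` is the word equation for the adjoint
    -- potential.
    have h4 : law μ y (mulB (adjB (cyc e (toS U))) (toS q')) = traceL ends μ
        (evalA proj y s (cycA S s e.op (starA U)) * evalA proj y s q') := by
      rw [law, ← toS_cycA hsS, ← toS_starA, starA_cycA hsS, ← toS_mul, ev_toS hy,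
        evalA_mul hrep norm_proj_le hy, traceL_apply]
    rw [← h3] at h4
    rw [h4]
    simp only [q', map_sum, map_smul, Finset.mul_sum, mul_smul_comm, smul_eq_mul,
      evalA_mon norm_proj_le hy, traceL_apply, h1, law_mono hy]
  rw [h2]
  have h5 : ∀ p : GPath ends × GPath ends,
      dq e q p.1 p.2 * (law μ y (mono p.1) * law μ y (mono p.2)) =
      ∑ γ ∈ Set.Finite.toFinset hq, q γ * (dq e (mono γ) p.1 p.2 *
        (law μ y (mono p.1) * law μ y (mono p.2))) := fun p => by
    conv_lhs => rw [hq.eq_sum]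
    rw [dq_sum, Finset.sum_mul]
    exact Finset.sum_congr rfl fun γ _ => by rw [dq_smul, mul_assoc]
  simp only [h5]
  -- Summability is kept along with the value, so that the equations of different edges can be added
  -- later.
  exact hasSum_sum fun γ _ => (hasSum_dq_mono e γ fun a => law μ y (mono a)).mul_left _

end SchwingerDyson

/-! ### The adjoint of the Jacobian -/

section JacobianAdjoint

variable {V E : Type*} {ends : E → Sym2 V}

theorem cyc_ne_zero {e : DEdge ends} {c : Series ends} {γ : GPath ends} (h : cyc e c γ ≠ 0) :
    γ.src = e.src ∧ γ.tgt = e.tgt := by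
  rw [cyc, mulMap] at h
  obtain ⟨i, _, hi⟩ := Finset.exists_ne_zero_of_sum_ne_zero h
  simp only [flip, dq] at hi
  split_ifs at hi with h1
  · exact ⟨h1.2.symm, (tgt_drop i γ).symm.trans h1.1⟩
  · exact absurd rfl hi

theorem mono_vertex (v : V) (a : GPath ends) [Decidable (a.len = 0 ∧ a.src = v)] :
    mono (vertex v) a = if a.len = 0 ∧ a.src = v then 1 else 0 := by
  classical
  have : a = vertex v ↔ a.len = 0 ∧ a.src = v := by
    constructor
    · rintro rfl
      exact ⟨len_vertex v, src_vertex v⟩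
    · rintro ⟨h1, h2⟩
      ext1
      · exact h2
      · exact List.length_eq_zero_iff.1 h1
  rw [mono_apply]
  simp only [this]

theorem take_zero_eq (a : GPath ends) : a.take 0 = vertex a.src := rfl

theorem drop_zero_eq (a : GPath ends) : a.drop 0 = a := rfl

theorem take_len_eq (a : GPath ends) : a.take a.len = a := by
  ext1
  · rfl
  · exact List.take_length

theorem drop_len_eq (a : GPath ends) : a.drop a.len = vertex a.tgt := by
  ext1
  · exact congrArg (endpoint a.src) List.take_length
  · exact List.drop_length

theorem madj_matP_ne {e e' : DEdge ends} (h : e' ≠ e) : madj (matP : Mat ends) e e' = 0 := by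
  funext a b
  rw [madj, tadj, matP, if_neg h]
  exact star_zero ℂ

/-- The entry `p_{s(e)} ⊗ p_{t(e)}` acts as a unit on derivatives of series in the corner of `e`;
only the cut at the start of the first leg and at the end of the second survives. -/
theorem tmul_madj_matP (e : DEdge ends) {f : Series ends}
    (hf : ∀ γ, f γ ≠ 0 → γ.src = e.src ∧ γ.tgt = e.tgt) (e' : DEdge ends) :
    tmul (madj matP e e) (dq e' f) = dq e' f := by
  classical
  funext a b
  have hm : ∀ a b : GPath ends, madj matP e e a b =
      mono (vertex e.src) a * mono (vertex e.tgt) b := fun a b => by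
    rw [madj, tadj, matP, if_pos rfl, tensor, star_mul', mono_vertex, mono_vertex, mono_vertex,
      mono_vertex, len_rev, len_rev, src_rev, src_rev]
    have h1 : ∀ (a : GPath ends) (v : V), (a.len = 0 ∧ a.tgt = v) = (a.len = 0 ∧ a.src = v) :=
      fun a v => by
        refine propext (and_congr_right fun h => ?_)
        have h2 : a.edges = [] := List.length_eq_zero_iff.1 h
        rw [show a.tgt = endpoint a.src a.edges from rfl, h2]
        rfl
    simp only [h1]
    split_ifs <;> simp
  rw [tmul, Finset.sum_eq_single_of_mem 0 (Finset.mem_range.2 (Nat.succ_pos _)),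
    Finset.sum_eq_single_of_mem b.len (Finset.mem_range.2 (Nat.lt_succ_self _))]
  · rw [hm, take_zero_eq, drop_zero_eq, take_len_eq, drop_len_eq, mono_apply, mono_apply]
    by_cases h : dq e' f a b = 0
    · rw [h, mul_zero]
    · have h1 : a.src = e.src ∧ b.tgt = e.tgt := by
        rw [dq] at h
        split_ifs at h with h2
        · have h3 := hf _ h
          refine ⟨h3.1, ?_⟩
          rw [← h3.2, join_eq a e' b h2.1 h2.2]
          exact ((tgt_comp _ _ _).trans (tgt_cons _ _ _)).symm
        · exact absurd rfl h
      rw [h1.1, h1.2, if_pos rfl, if_pos rfl, one_mul, one_mul]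
  · intro j hj hne
    rw [Finset.mem_range] at hj
    rw [hm, mono_vertex e.tgt, if_neg, mul_zero, zero_mul]
    rintro ⟨h, _⟩
    rw [len_drop] at h
    omega
  · intro i hi hne
    rw [Finset.mem_range] at hi
    refine Finset.sum_eq_zero fun j _ => ?_
    rw [hm, mono_vertex e.src, if_neg, zero_mul, zero_mul]
    rintro ⟨h, _⟩
    rw [len_take (by omega)] at h
    exact hne h

variable [Fintype V] [Finite E] {μ : V → ℝ} {S s : PosReal} {y : DEdge ends → Op ends}

/-- Finite truncations keep the corner conditions, and evaluation is a contraction. -/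
theorem exists_polyVec_near (hy : ∀ e, ‖y e‖ ≤ s.1) {U : DEdge ends → PA ends s}
    (hU : ∀ e γ, toS (U e) γ ≠ 0 → γ.src = e.src ∧ γ.tgt = e.tgt) {η : ℝ} (hη : 0 < η) :
    ∃ f : DEdge ends → Series ends, IsPolyVec f ∧
      ∀ e, ‖evalA proj y s (U e) - ev y (f e)‖ < η := by
  have h1 : ∀ e, ∃ t : Finset (GPath ends), ‖∑ γ ∈ t, coef γ (U e) • mon γ - U e‖ < η := fun e => by
    have h2 := (Metric.tendsto_nhds.1 (hasSum_mon (U e))) η hη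
    obtain ⟨t, ht⟩ := h2.exists
    exact ⟨t, by rwa [dist_eq_norm] at ht⟩
  choose t ht using h1
  refine ⟨fun e => toS (∑ γ ∈ t e, coef γ (U e) • mon γ : PA ends s), fun e => ?_, fun e => ?_⟩
  · have h3 : ∀ γ, toS (∑ γ ∈ t e, coef γ (U e) • mon γ : PA ends s) γ ≠ 0 →
        γ ∈ t e ∧ toS (U e) γ ≠ 0 := fun γ h => by
      classical
      simp only [toS_sum, toS_smul, toS_mon, Finset.sum_apply, Pi.smul_apply, mono_apply,
        smul_eq_mul, mul_ite, mul_one, mul_zero, Finset.sum_ite_eq] at h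
      split_ifs at h with h4
      · exact ⟨h4, h⟩
      · exact absurd rfl h
    exact ⟨(t e).finite_toSet.subset fun γ h => (h3 γ h).1, fun γ h => hU e γ (h3 γ h).2⟩
  · rw [ev_toS hy, ← map_sub]
    refine (norm_evalA_le norm_proj_le hy _).trans_lt ?_
    rw [norm_sub_rev]
    exact ht e

/-- Thanks to `y_e^* = y_{e^op}`, the product `(𝒟_e U)(y)^* f_e(y)` is the value of the series `[𝒟_e
U]^* f_e`. The pairing is thus the sum over `e` of the Schwinger–Dyson equations tested on `f_e`,
and `P` selects the diagonal of `𝒥f`. -/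
theorem isJacobianAdjoint_of_eqn (hμ : ∀ v, 0 < μ v) (hμ1 : ∑ v, μ v = 1) (hrep : IsRep proj y)
    (hy : ∀ e, ‖y e‖ ≤ s.1) (hsS : s.1 < S.1) (hst : ∀ e, star (y e) = y e.op) {U : PA ends S}
    (hU : ∀ e {q : Series ends}, IsPoly q →
      HasSum (fun p : GPath ends × GPath ends =>
        dq e q p.1 p.2 * (law μ y (mono p.1) * law μ y (mono p.2)))
        (law μ y (mulB (adjB (cyc e (toS U))) q))) :
    IsJacobianAdjoint μ y matP fun e => ev y (cyc e (toS U)) where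
  mem_closure δ hδ := by
    set n : ℝ := (Fintype.card (DEdge ends) : ℝ)
    have hn : 0 ≤ n := Nat.cast_nonneg _
    -- The bound by `1` reduces `η²` to `η`, and `n + 1` leaves a strict inequality after summation
    -- over the `n` directed edges.
    let η : ℝ := min 1 (δ / (n + 1))
    have hη : 0 < η := lt_min one_pos (by positivity)
    obtain ⟨f, hf, hfη⟩ := exists_polyVec_near hy (U := fun e => cycA S s e U)
      (fun e γ h => cyc_ne_zero (by rwa [toS_cycA hsS] at h)) hη
    refine ⟨f, hf, ?_⟩
    set a : DEdge ends → Op ends := fun e => ev y (cyc e (toS U)) - ev y (f e) with ha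
    have h1 : ∀ e, ‖a e‖ ≤ η := fun e => by
      have := hfη e
      rw [← ev_toS hy, toS_cycA hsS] at this
      exact this.le
    have h2 : ‖vecInner μ a a‖ ≤ n * η := by
      rw [vecInner]
      refine (norm_trace_le hμ hμ1 _).trans ((norm_sum_le _ _).trans ?_)
      calc ∑ e : DEdge ends, ‖star (a e.op) * a e.op‖ ≤ ∑ _e : DEdge ends, η := by
            refine Finset.sum_le_sum fun e _ => (norm_mul_le _ _).trans ?_
            have h3 : ‖star (a e.op)‖ = ‖a e.op‖ :=
              LinearIsometryEquiv.norm_map ContinuousLinearMap.adjoint (a e.op)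
            rw [h3]
            calc ‖a e.op‖ * ‖a e.op‖ ≤ 1 * η := by
                  gcongr
                  · exact (h1 _).trans (min_le_left _ _)
                  · exact h1 _
              _ = η := one_mul _
        _ = n * η := by rw [Finset.sum_const, Finset.card_univ, nsmul_eq_mul]
    refine (Complex.re_le_norm _).trans_lt (h2.trans_lt ?_)
    calc n * η ≤ n * (δ / (n + 1)) := by gcongr; exact min_le_right _ _
      _ < δ := by
        rw [mul_div_assoc', div_lt_iff₀ (by positivity)]
        nlinarith
  pairing f hf := by
    have h1 : ∀ e, star (ev y (cyc e (toS U))) * ev y (f e) =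
        ev y (mulB (adjB (cyc e (toS U))) (f e)) := fun e => by
      have h2 : f e = toS (∑ γ ∈ Set.Finite.toFinset (hf e).1, f e γ • mon γ : PA ends s) := by
        conv_lhs => rw [(hf e).1.eq_sum]
        simp only [toS_sum, toS_smul, toS_mon]
      rw [h2, ← toS_cycA hsS, ← toS_starA, ← toS_mul, ev_toS hy, ev_toS hy, ev_toS hy,
        evalA_mul hrep norm_proj_le hy, star_evalA hrep hy hst]
    have h3 : vecInner μ (fun e => ev y (cyc e (toS U))) (fun e => ev y (f e)) =
        ∑ e, law μ y (mulB (adjB (cyc e (toS U))) (f e)) := by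
      rw [vecInner, sum_comp_op fun e => star (ev y (cyc e (toS U))) * ev y (f e),
        ← traceL_apply, map_sum]
      exact Finset.sum_congr rfl fun e _ => by rw [h1, traceL_apply]; rfl
    have h4 : (∑ e : DEdge ends, ∑ e' : DEdge ends, tmul (madj matP e e') (jac f e' e)) =
        ∑ e : DEdge ends, dq e (f e) := Finset.sum_congr rfl fun e _ => by
      rw [Finset.sum_eq_single_of_mem e (Finset.mem_univ _)]
      · exact tmul_madj_matP e (hf e).2 e
      · intro e' _ he
        rw [madj_matP_ne he]
        funext a b
        simp only [tmul, Pi.zero_apply, zero_mul, Finset.sum_const_zero]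
    rw [h3, matInner, h4, lawTensor]
    refine ((hasSum_sum fun e _ => hU e (hf e).1).tsum_eq).symm.trans (tsum_congr fun p => ?_)
    rw [Finset.sum_apply, Finset.sum_apply, Finset.sum_mul]

end JacobianAdjoint
end
end FreeGraph

namespace FreeGraph
noncomputable section

open GPath WL1

/-! ### Existence of the transport and the final constants. -/

section Existence

variable {V E : Type*} {ends : E → Sym2 V} [Fintype V] {μ : V → ℝ}

/-- The two norms differ only on the vertices, where one takes the sum and the other the supremum;
this costs the factor `|V|`. -/
theorem norm_toA_le [Nonempty V] {S : PosReal} {W : Series ends} (hW : MemB S.1 W) :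
    ‖toA S W hW‖ ≤ Fintype.card V * normB S.1 W := by
  classical
  have hS := S.2
  have h0 : HasSum (fun γ => ‖W γ‖ * S.1 ^ γ.len) ‖toA S W hW‖ := by
    have h := hasSum_norm (toA S W hW)
    refine Eq.mp (congrArg (HasSum · _) (funext fun γ => ?_)) h
    rw [← congrFun (toS_toA hW) γ]
    rfl
  have h1 := h0.summable.tsum_subtype_add_tsum_subtype_compl {γ : GPath ends | γ.len = 0}
  rw [h0.tsum_eq] at h1
  let ι : V ≃ {γ : GPath ends | γ.len = 0} :=
    { toFun := fun v => ⟨vertex v, len_vertex v⟩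
      invFun := fun γ => γ.1.src
      left_inv := fun v => rfl
      right_inv := fun γ => Subtype.ext (by
        ext1
        · rfl
        · exact (List.length_eq_zero_iff.1 γ.2).symm) }
  have h2 : ∑' γ : {γ : GPath ends | γ.len = 0}, ‖W γ‖ * S.1 ^ γ.1.len ≤
      Fintype.card V * ⨆ v : V, ‖W (vertex v)‖ := by
    rw [← ι.tsum_eq, tsum_fintype]
    calc _ ≤ ∑ _v : V, ⨆ v : V, ‖W (vertex v)‖ := Finset.sum_le_sum fun v _ => by
          change ‖W (vertex v)‖ * S.1 ^ (vertex v : GPath ends).len ≤ _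
          rw [len_vertex, pow_zero, mul_one]
          exact le_ciSup (f := fun v => ‖W (vertex v)‖) (Set.finite_range _).bddAbove v
      _ = _ := by rw [Finset.sum_const, Finset.card_univ, nsmul_eq_mul]
  have h3 : (1 : ℝ) ≤ Fintype.card V := by exact_mod_cast Fintype.card_pos
  have h4 : 0 ≤ ∑' γ : {γ : GPath ends // γ.len ≠ 0}, ‖W γ‖ * S.1 ^ γ.1.len :=
    tsum_nonneg fun γ => by positivity
  rw [← h1, normB, mul_add]
  exact add_le_add h2 (le_mul_of_one_le_left h4 h3)

variable [Finite E]

theorem exists_transport (hμ : ∀ v, 0 < μ v) (hμ1 : ∑ v, μ v = 1) {R s S : PosReal}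
    (hs : s.1 = R.1 + 1 / R.1) (hsS : s.1 < S.1) (hR4 : 4 < R.1)
    (hw : ∀ e : DEdge ends, 4 < R.1 * edgeWeight μ e) {W : Series ends} (hW : MemB S.1 W)
    (hW1 : ‖toA S W hW‖ ≤ S.1 - s.1) (hW2 : ‖toA S W hW‖ ≤ 1 / R.1) :
    ∃ g : Series ends, MemB R.1 g ∧
      LawSatisfiesSD μ S.1 (potential ends μ + W) (perturbed μ g) ∧
      (adjB W = W →
        (∀ e : DEdge ends, star (perturbed μ g e) = perturbed μ g e.op) ∧
        (∀ e : DEdge ends, (edgeWeight μ e : ℂ) • perturbed μ g e +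
            ev (perturbed μ g) (cyc e W) = ev (perturbed μ g) (cyc e (potential ends μ + W))) ∧
        IsJacobianAdjoint μ (perturbed μ g) matP
          fun e => ev (perturbed μ g) (cyc e (potential ends μ + W))) := by
  classical
  have hR := R.2
  -- Half of `R` still dominates `2 / μ(e) ≥ ‖x_e‖` because `R μ(e) > 4`, and it makes the geometric
  -- series for the Jacobian converge.
  let c : PosReal := ⟨R.1 / 2, by positivity⟩
  have h2 : R.1 = 2 * c.1 := by change R.1 = 2 * (R.1 / 2); ring
  have hcR : c.1 ≤ R.1 := by change R.1 / 2 ≤ R.1; linarith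
  have hwpos : ∀ e : DEdge ends, 0 < edgeWeight μ e := fun e =>
    Real.sqrt_pos.2 (mul_pos (hμ _) (hμ _))
  have hop : ∀ e : DEdge ends, edgeWeight μ e.op = edgeWeight μ e := fun e =>
    congrArg Real.sqrt (mul_comm _ _)
  have hw0 : ∀ e : DEdge ends, 4 / R.1 ≤ edgeWeight μ e := fun e => by
    rw [div_le_iff₀ hR]; linarith [hw e]
  have hw1 : ∀ e : DEdge ends, edgeWeight μ e ≤ 1 := fun e => by
    have h3 := le_one_of_sum hμ hμ1 e.src
    have h4 := le_one_of_sum hμ hμ1 e.tgt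
    rw [edgeWeight, Real.sqrt_le_one]
    exact mul_le_one₀ h3 (hμ _).le h4
  have hcw : ∀ e : DEdge ends, 2 / edgeWeight μ e ≤ c.1 := fun e => by
    rw [div_le_iff₀ (hwpos e)]
    change 2 ≤ R.1 / 2 * edgeWeight μ e
    linarith [hw e]
  have hφ := pathLaw_genLaw hμ hμ1 hcw
  have hgc : ∀ e : DEdge ends, ‖gen μ e‖ ≤ c.1 := norm_gen_le_radius hμ hμ1 hcw
  have hgR : ∀ e : DEdge ends, ‖gen μ e‖ ≤ R.1 := fun e => (hgc e).trans hcR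
  have hgen := isRep_gen (ends := ends) μ
  set W' : PA ends S := toA S W hW with hW'
  have hWst : ‖starA W'‖ = ‖W'‖ := norm_starMap _
  -- The Schwinger–Dyson equation involves `[𝒟_e U]^* = 𝒟_{e^op}(U^*)`, so the fixed point is taken
  -- for the adjoint of `W`.
  obtain ⟨G, hG, hfix, huniq⟩ := exists_potential hφ h2 hR4 hw0 hw1 hs hsS (W := starA W')
    (hWst.trans_le hW1) (hWst.trans_le hW2)
  let T : PA ends R →L[ℂ] Op ends := evalA proj (gen μ) R
  have hY : ∀ e, perturbed μ (toS (numInv R G)) e = T (shift R G e) := fun e => by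
    rw [perturbed, ← toS_dcyc, ev_toS hgR, shift, map_add]
    congr 1
    exact (evalA_z norm_proj_le hgen hgR e).symm
  have hY' : perturbed μ (toS (numInv R G)) = fun e => T (shift R G e) := funext hY
  have hsh : ∀ e : DEdge ends, ‖shift R G e‖ ≤ s.1 := norm_shift_le hs hG
  have hrepA : IsRep (PA.pv R) (shift R G : DEdge ends → PA ends R) := isRep_add_dcyc R G
  have hrep : IsRep proj fun e => T (shift R G e) := evalA_isRep norm_proj_le hgen hgR hrepA
  have hn : ∀ e, ‖T (shift R G e)‖ ≤ s.1 := fun e => (norm_evalA_le norm_proj_le hgR _).trans (hsh e)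
  have hlaw : ∀ u : PA ends R, genLaw ends μ c (res R c u) = trace μ (T u) := fun u => by
    rw [genLaw_apply hμ hμ1 hcw, evalA_res norm_proj_le hgR hcR hgc]
  have hTw : ∀ γ, T (wordIn (PA.pv R) (shift R G) γ) = wordIn proj (fun e => T (shift R G e)) γ :=
    evalA_wordIn norm_proj_le hgen hgR hrepA
  let U : PA ends S := quad (edgeWeight μ) S + W'
  have hU : toS U = potential ends μ + W := by
    rw [toS_add, toS_quad, hW', toS_toA]
  have hUst : starA U = quad (edgeWeight μ) S + starA W' := by
    rw [starA, starMap_add, ← starA, ← starA, starA_quad]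
  have heqn : ∀ e {q : Series ends}, IsPoly q →
      HasSum (fun p : GPath ends × GPath ends => dq e q p.1 p.2 *
        (law μ (fun e => T (shift R G e)) (mono p.1) * law μ (fun e => T (shift R G e)) (mono p.2)))
        (law μ (fun e => T (shift R G e)) (mulB (adjB (cyc e (toS U))) q)) := fun e q hq => by
    refine hasSum_schwingerDyson hrep hn hsS (fun e γ h3 h4 => ?_) e hq
    have h5 := hφ.schwingerDyson_shift h2 hR4 hw0 hs hsS hG hfix h3 h4
    rw [← res_mul hcR, ← hUst] at h5
    simp only [hlaw, hTw] at h5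
    rw [← h5]
    have h6 : T (evalA (PA.pv R) (shift R G) s (cycA S s e.op (starA U)) *
        wordIn (PA.pv R) (shift R G) γ) =
        T (evalA (PA.pv R) (shift R G) s (cycA S s e.op (starA U))) *
          T (wordIn (PA.pv R) (shift R G) γ) := evalA_mul hgen norm_proj_le hgR _ _
    have h7 : T (evalA (PA.pv R) (shift R G) s (cycA S s e.op (starA U))) =
        evalA proj (fun e => T (shift R G e)) s (cycA S s e.op (starA U)) :=
      evalA_evalA norm_proj_le hgen hgR hrepA hsh _
    rw [h6, h7, hTw]
  -- The witness is `g = N⁻¹ G`, for which `𝒟g` is the normalized gradient of `G`.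
  refine ⟨toS (numInv R G), memB_toS _, ⟨fun e => ?_, fun e => ?_, fun e => ?_, fun e q hq => ?_⟩,
    fun hadj => ?_⟩
  · rw [hY]
    exact evalA_mem_graphAlgebra hgR _
  · rw [hY]
    exact (congrArg (· * _) (hrep.left e)).trans (hrep.right e)
  · rw [hY]
    exact (hn e).trans_lt hsS
  · rw [hY', ← hU]
    exact (heqn e hq).tsum_eq.symm
  · have hWs : starA W' = W' := toS_injective (by rw [toS_starA, hW', toS_toA, hadj])
    have hGs : starA G = G := starA_potential hφ (genLaw_rev hμ hμ1 hcw) h2 hR4 hw0 hs hsS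
      (by rw [hWs, hWs]) hG hfix huniq
    have hst : ∀ e, star (T (shift R G e)) = T (shift R G e.op) := fun e => by
      have h3 := starA_shift G e.op
      rw [DEdge.op_op, hGs] at h3
      rw [← h3]
      exact star_evalA hgen hgR (star_gen μ) _
    rw [hY']
    refine ⟨hst, fun e => ?_, ?_⟩
    · rw [← hU, ← toS_cycA hsS, ← toS_toA hW, ← toS_cycA hsS, ev_toS hn, ev_toS hn, map_add, map_add,
        cycA_quad hsS hop, map_smul, evalA_z norm_proj_le hrep hn]
    · rw [← hU]
      exact isJacobianAdjoint_of_eqn hμ hμ1 hrep hn hsS hst heqn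

/-- The bound `R > 4` is obtained from an edge; without edges all conditions are vacuous or read `0
= 0`. -/
theorem exists_transport_of_isEmpty [IsEmpty (DEdge ends)] (μ : V → ℝ) (R S : ℝ)
    (U W : Series ends) :
    ∃ g : Series ends, MemB R g ∧ LawSatisfiesSD μ S U (perturbed μ g) ∧
      (adjB W = W →
        (∀ e : DEdge ends, star (perturbed μ g e) = perturbed μ g e.op) ∧
        (∀ e : DEdge ends, (edgeWeight μ e : ℂ) • perturbed μ g e +
            ev (perturbed μ g) (cyc e W) = ev (perturbed μ g) (cyc e U)) ∧
        IsJacobianAdjoint μ (perturbed μ g) matP fun e => ev (perturbed μ g) (cyc e U)) := by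
  have h0 : trace μ (0 : Op ends) = 0 := (traceL_apply μ _).symm.trans (map_zero _)
  have hv : ∀ f h : DEdge ends → Op ends, vecInner μ f h = 0 := fun f h => by
    rw [vecInner, Finset.univ_eq_empty, Finset.sum_empty, h0]
  refine ⟨0, ?_, ⟨isEmptyElim, isEmptyElim, isEmptyElim, isEmptyElim⟩, fun _ =>
    ⟨isEmptyElim, isEmptyElim, fun δ hδ => ⟨isEmptyElim, isEmptyElim, ?_⟩, fun f _ => ?_⟩⟩
  · simp only [MemB, Pi.zero_apply, norm_zero, zero_mul]
    exact summable_zero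
  · rw [hv, Complex.zero_re]
    exact hδ
  · rw [hv, matInner, Finset.univ_eq_empty, Finset.sum_empty, lawTensor]
    simp only [Pi.zero_apply, zero_mul, tsum_zero]

end Existence
end
end FreeGraph

theorem corollary2p13 {V : Type*} [Fintype V] (μ : V → ℝ) (hμ : ∀ v, 0 < μ v)
    (hμ1 : ∑ v, μ v = 1) (R S : ℝ) (hR : 0 < R) (hS : R + 1 / R < S) :
    ∃ K : ℝ, 0 < K ∧
      ∀ {E : Type*} [Finite E] (ends : E → Sym2 V),
        (∀ e : FreeGraph.DEdge ends, 4 < R * FreeGraph.edgeWeight μ e) →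
        ∀ W : FreeGraph.Series ends, FreeGraph.MemB S W →
          (∀ e : FreeGraph.DEdge ends,
            FreeGraph.normB S W ≤ 1 / 2 * FreeGraph.edgeWeight μ e) →
          FreeGraph.normB S W ≤
            2 * Real.exp 1 * (R + 1 / R) * Real.log (S / (R + 1 / R)) →
          FreeGraph.normB S W < K →
          ∃ g : FreeGraph.Series ends, FreeGraph.MemB R g ∧
            FreeGraph.LawSatisfiesSD μ S (FreeGraph.potential ends μ + W)
              (FreeGraph.perturbed μ g) ∧
            (FreeGraph.adjB W = W →
              (∀ e : FreeGraph.DEdge ends,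
                star (FreeGraph.perturbed μ g e) = FreeGraph.perturbed μ g e.op) ∧
              (∀ e : FreeGraph.DEdge ends,
                (FreeGraph.edgeWeight μ e : ℂ) • FreeGraph.perturbed μ g e +
                    FreeGraph.ev (FreeGraph.perturbed μ g) (FreeGraph.cyc e W) =
                  FreeGraph.ev (FreeGraph.perturbed μ g)
                    (FreeGraph.cyc e (FreeGraph.potential ends μ + W))) ∧
              FreeGraph.IsJacobianAdjoint μ (FreeGraph.perturbed μ g) FreeGraph.matP
                (fun e => FreeGraph.ev (FreeGraph.perturbed μ g)
                  (FreeGraph.cyc e (FreeGraph.potential ends μ + W)))) := by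
  have hne : Nonempty V := by
    by_contra h
    rw [not_nonempty_iff] at h
    rw [Finset.univ_eq_empty, Finset.sum_empty] at hμ1
    exact zero_ne_one hμ1
  have hV : (0 : ℝ) < Fintype.card V := Nat.cast_pos.2 Fintype.card_pos
  have hs0 : 0 < R + 1 / R := by positivity
  have hpos : 0 < min (S - (R + 1 / R)) (1 / R) := lt_min (sub_pos.2 hS) (by positivity)
  -- With `s = R + 1/R`, which bounds the norms of `z + 𝒟g`, the term `S - s` controls the Lipschitz
  -- constant of `W` under transport, `1 / R` the starting value of the iteration, and `|V|` the
  -- comparison of norms.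
  refine ⟨min (S - (R + 1 / R)) (1 / R) / Fintype.card V, div_pos hpos hV, ?_⟩
  intro E _ ends hw W hW _ _ hK
  cases isEmpty_or_nonempty (FreeGraph.DEdge ends)
  · exact FreeGraph.exists_transport_of_isEmpty μ R S _ W
  · obtain ⟨e⟩ := ‹Nonempty (FreeGraph.DEdge ends)›
    -- Vertex weights are at most `1`, hence so are edge weights, and `4 < R μ(e) ≤ R`.
    have hR4 : 4 < R := by
      have h1 : FreeGraph.edgeWeight μ e ≤ 1 := by
        rw [FreeGraph.edgeWeight, Real.sqrt_le_one]
        exact mul_le_one₀ (FreeGraph.le_one_of_sum hμ hμ1 _) (hμ _).le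
          (FreeGraph.le_one_of_sum hμ hμ1 _)
      nlinarith [hw e]
    have hW' := FreeGraph.norm_toA_le (S := ⟨S, hs0.trans hS⟩) hW
    rw [lt_div_iff₀ hV, mul_comm] at hK
    have h2 := hW'.trans hK.le
    exact FreeGraph.exists_transport hμ hμ1 (R := ⟨R, hR⟩) (s := ⟨R + 1 / R, hs0⟩)
      (S := ⟨S, hs0.trans hS⟩) rfl hS hR4 hw hW (h2.trans (min_le_left _ _))
      (h2.trans (min_le_right _ _))
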